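/- **Setting.** Let $n,d,k,t'$ be natural numbers with $1\le k\le d$ and $t'<n/2$, and let $\alpha_S\in(0,1]$, $\beta,\delta\in(0,1)$, $\varepsilon>0$. For given constants $c_m\ge c_s>0$ put $$m=\Big\lceil c_m\,\frac{k\log(2k/\beta)}{\alpha_S^2}\Big\rceil,\qquad s=\Big\lceil c_s\,\frac{\log(2k/\beta)}{\alpha_S}\Big\rceil .$$ Let $A\in\mathbb R^{n\times d}$ satisfy $|A_{ij}|\le\eta$ for all $i,j$; client $i$ holds the row $a_i$ of $A$, and $t'$ is the number of (semi-honest) corrupt clients that is tolerated. *Sketch.* An OSNAP sketch is drawn: independently for each of the $n$ columns, $s$ of the $m$ rows are chosen uniformly at random and receive independent uniform signs, all other entries are $0$. The $s$ non-zero entries of each column are distributed uniformly at random among matrices $S_1,\dots,S_s\in\{-1,0,1\}^{m\times n}$ that have one non-zero entry per column, and $S=s^{-1/2}\sum_{i\le s} S_i$. *Mechanism $(R_D,T_S,A_k)$.* Independently of the sketch and of each other, the clients apply the randomizer $R_D:\mathbb R^d\to\mathbb R^{ds}$. It outputs $0$ if $n<8m\ln(dm/\delta)+t'$; otherwise it outputs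 $s$ concatenated copies of its input plus a noise vector with $ds$ independent entries from $D=\mathcal N(0,\sigma^2)$, where $$\sigma^2=\frac{4s^3\eta^2\,\ln\!\big(1.25\,s/(\delta/d-m\,e^{-(n-s-t')/(8m)})\big)\,m\,d^2}{\varepsilon^2\,(n-s-t')}$$ (if $m e^{-(n-s-t')/(8m)}\ge\delta/d$, so that this formula is meaningless, $\sigma^2\ge0$ is arbitrary). From the stacked messages $Y=(Y_1,\dots,Y_s)$ with $Y_i\in\mathbb R^{n\times d}$, the trusted component computes $T_S(Y)=s^{-1/2}\sum_{i\le s} S_iY_i\in\mathbb R^{m\times d}$. Finally $A_k$ is any function that maps each $B\in\mathbb R^{m\times d}$ to an exact minimiser of $\|B-BXX^T\|_F^2$ over all $X\in\mathbb R^{d\times k}$ with $X^TX=I_k$. The output is $X'=A_k(T_S(R_D(a_1),\dots,R_D(a_n)))$. **Theorem.** There are absolute constants $c_m\ge c_s>0$ and $C>0$ such that, for all parameters, all $A$ and all $A_k$ as above, if $\varepsilon\le1$ or $n\ge 8m\ln(2dm/\delta)+s+t'$, then with probability at least $1-\beta$ the output satisfies $X'^TX'=I_k$ (so $X'X'^T$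 is an orthogonal projection of rank $k$) and $$\|A-AX'X'^T\|_F\;\le\;(1+C\alpha_S)\min_{X\in\mathbb R^{d\times k},\,X^TX=I_k}\|A-AXX^T\|_F\;+\;C\,\eta\,\frac{k\,d^{3/2}}{\alpha_S^{3}}\,\log^{3/2}\!\Big(\frac2\beta\Big)\,\varepsilon^{-1}\,\log^{1/2}\!\Big(\frac2\delta\Big)\cdot\log\!\Big(\frac{2d}{\beta}\Big).$$ The multiplicative error is thus $1+O(\alpha_S)$ and the additive error is $\tilde O\big(\eta\,k\,d^{3/2}\alpha_S^{-3}\log^{3/2}(1/\beta)\,\varepsilon^{-1}\log^{1/2}(1/\delta)\big)$, where the suppressed factor is the single logarithm $\log(2d/\beta)$. -/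

import Mathlib

open MeasureTheory ProbabilityTheory Matrix

-- `‖M‖` for a real matrix `M` is its Frobenius norm.
attribute [local instance] Matrix.frobeniusNormedAddCommGroup

namespace LTM

/-! ### Low rank approximation -/

/-- `X ∈ ℝ^{d × k}` has orthonormal columns, so that `X Xᵀ` is a rank `k` orthogonal projection. -/
def IsOrthoProj {d k : ℕ} (X : Matrix (Fin d) (Fin k) ℝ) : Prop :=
  Xᵀ * X = 1

/-- The low rank approximation error `‖B - B X Xᵀ‖_F`. -/
noncomputable def lowRankError {r d k : ℕ} (B : Matrix (Fin r) (Fin d) ℝ)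
    (X : Matrix (Fin d) (Fin k) ℝ) : ℝ :=
  ‖B - B * X * Xᵀ‖

/-- `OPT`, the least rank `k` approximation error of `B`. -/
noncomputable def lowRankOpt {r d : ℕ} (k : ℕ) (B : Matrix (Fin r) (Fin d) ℝ) : ℝ :=
  ⨅ X : {X : Matrix (Fin d) (Fin k) ℝ // IsOrthoProj X}, lowRankError B X.1

/-- `Ak` is an analysis function that returns on every input `B` an exact minimiser of
`‖B - B X Xᵀ‖_F²` over all `X ∈ ℝ^{d × k}` with orthonormal columns. Ties are broken arbitrarily. -/
def IsLowRankSolver {r d k : ℕ}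
    (Ak : Matrix (Fin r) (Fin d) ℝ → Matrix (Fin d) (Fin k) ℝ) : Prop :=
  ∀ B, IsOrthoProj (Ak B) ∧
    ∀ Y : Matrix (Fin d) (Fin k) ℝ, IsOrthoProj Y →
      lowRankError B (Ak B) ^ 2 ≤ lowRankError B Y ^ 2

/-! ### The random sketch and its decomposition -/

/-- The randomness behind a sketch with `s` non-zero entries per column together with its
decomposition. For each of the `n` columns it consists of an injection `Fin s ↪ Fin m`, which lists
the `s` rows of the non-zero entries (the `i`-th listed entry is assigned to the `i`-th summand of
the decomposition), and of `s` signs. -/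
def SketchSample (m n s : ℕ) : Type :=
  Fin n → (Fin s ↪ Fin m) × (Fin s → ℤˣ)

noncomputable instance (m n s : ℕ) : Fintype (SketchSample m n s) :=
  inferInstanceAs (Fintype (Fin n → (Fin s ↪ Fin m) × (Fin s → ℤˣ)))

instance (m n s : ℕ) : MeasurableSpace (SketchSample m n s) := ⊤

/-- The uniform law: independently for each column, a uniformly random set of `s` rows, uniformly
random signs there, and a uniformly random assignment of these entries to the `s` summands. -/
noncomputable def sketchLaw (m n s : ℕ) : Measure (SketchSample m n s) :=
  uniformOn Set.univ

/-- The summands `S₁, …, S_s ∈ {-1,0,1}^{m × n}`, each with one non-zero entry per column. -/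
def sketchPart {m n s : ℕ} (ω : SketchSample m n s) (i : Fin s) : Matrix (Fin m) (Fin n) ℝ :=
  Matrix.of fun r c => if (ω c).1 i = r then (((ω c).2 i : ℤ) : ℝ) else 0

/-! ### The mechanism -/

/-- The law of `x^s + g`, where `x^s` is the concatenation of `s` copies of `x ∈ ℝ^d` and the `ds`
entries of `g` are independent with law `D`. -/
noncomputable def denseRandomizer {d : ℕ} (s : ℕ) (D : Measure ℝ) (x : Fin d → ℝ) :
    Measure (Fin s × Fin d → ℝ) :=
  (Measure.pi fun _ : Fin s × Fin d => D).map fun g p => x p.2 + g p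

/-- The law of `R_D(x)`: the zero vector if `n < 8 m ln(dm/δ) + t'`, and `x^s + g` otherwise. -/
noncomputable def sparseRandomizer {d : ℕ} (n m s t' : ℕ) (δ : ℝ) (D : Measure ℝ)
    (x : Fin d → ℝ) : Measure (Fin s × Fin d → ℝ) :=
  if (n : ℝ) < 8 * m * Real.log (d * m / δ) + t' then Measure.dirac 0
  else denseRandomizer s D x

/-- `T_S(Y) = s^{-1/2} ∑ᵢ Sᵢ Yᵢ`, where row `c` of `Y ∈ ℝ^{n × ds}` is the message of client `c` and
`Yᵢ ∈ ℝ^{n × d}` is the `i`-th block of `Y`. -/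
noncomputable def linearTransform {m n s d : ℕ} (S : Fin s → Matrix (Fin m) (Fin n) ℝ)
    (Y : Fin n → Fin s × Fin d → ℝ) : Matrix (Fin m) (Fin d) ℝ :=
  (1 / Real.sqrt s) • ∑ i, S i * Matrix.of fun c j => Y c (i, j)

/-- The joint law of the public sketch and of the independent messages of the `n` clients, where
client `c` holds row `c` of `A`. -/
noncomputable def runLaw {n d : ℕ} (m s t' : ℕ) (δ : ℝ) (D : Measure ℝ)
    (A : Matrix (Fin n) (Fin d) ℝ) :
    Measure (SketchSample m n s × (Fin n → Fin s × Fin d → ℝ)) :=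
  (sketchLaw m n s).prod (Measure.pi fun c => sparseRandomizer n m s t' δ D (A c))

/-- The output `A_k(T_S(R_D(a₁), …, R_D(a_n)))` of a run. -/
noncomputable def runOutput {m n s d k : ℕ}
    (Ak : Matrix (Fin m) (Fin d) ℝ → Matrix (Fin d) (Fin k) ℝ)
    (ω : SketchSample m n s × (Fin n → Fin s × Fin d → ℝ)) : Matrix (Fin d) (Fin k) ℝ :=
  Ak (linearTransform (sketchPart ω.1) ω.2)

/-! ### Parameters -/

/-- `m exp(-(n-s-t')/(8m))`. -/
noncomputable def failureTerm (n m s t' : ℕ) : ℝ :=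
  m * Real.exp (-((n : ℝ) - s - t') / (8 * m))

/-- The variance `σ²` of the Gaussian noise; meaningful if `failureTerm n m s t' < δ / d`. -/
noncomputable def noiseVariance (n d m s t' : ℕ) (η ε δ : ℝ) : ℝ :=
  4 * (s : ℝ) ^ 3 * η ^ 2 * Real.log (1.25 * s / (δ / d - failureTerm n m s t')) * m * (d : ℝ) ^ 2
    / (ε ^ 2 * ((n : ℝ) - s - t'))

/-- The target dimension `m = ⌈c k log(2k/β) / α²⌉`. -/
noncomputable def sketchRows (c : ℝ) (k : ℕ) (α β : ℝ) : ℕ :=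
  ⌈c * (k * Real.log (2 * k / β) / α ^ 2)⌉₊

/-- The column sparsity `s = ⌈c log(2k/β) / α⌉`. -/
noncomputable def sketchSparsity (c : ℝ) (k : ℕ) (α β : ℝ) : ℕ :=
  ⌈c * (Real.log (2 * k / β) / α)⌉₊

/-- The additive error
`η (k d^{3/2} / α³) log^{3/2}(2/β) ε⁻¹ log^{1/2}(2/δ) · log(2d/β)`;
its last factor is the logarithmic factor that is suppressed in soft-O notation. -/
noncomputable def additiveError (k d : ℕ) (η α β ε δ : ℝ) : ℝ :=
  η * (k * (d : ℝ) ^ (3 / 2 : ℝ) / α ^ 3) * Real.log (2 / β) ^ (3 / 2 : ℝ) * ε⁻¹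
    * Real.log (2 / δ) ^ (1 / 2 : ℝ) * Real.log (2 * d / β)

end LTM

/-!
The sketch `S` is shown to preserve the quadratic form of `A` after regularisation: with probability
at least `1 - β / 4`, for all `u`,
`|‖S A u‖² - ‖A u‖²| ≤ γ (‖A u‖² + ρ² ‖u‖²)`,
where `γ` is a small multiple of `α` and `k ρ²` is slightly larger than the squared error of a
nearly optimal rank `k` projection. At this scale `A = W B` with a contraction `W` of squared
Frobenius norm at most `2 k` and `Bᵀ B = Aᵀ A + ρ² 1` (`exists_ridge_factor`), so the claim is that
the operator norm of `(S W)ᵀ S W - Wᵀ W` is at most `γ`, although the ambient dimension may be much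
larger than `k`.

This operator norm is controlled by the trace of a matrix exponential
(`sum_trace_exp_chaosMatrix_le`). The matrix is a quadratic form in the entries of the sketch.
Convexity of the trace exponential permits two replacements: the quadratic form is decoupled into
two disjoint groups of columns, and the entries of a sketch column, which are dependent because
their number is fixed, are dominated in the convex order by independent sparse signs
(`sum_sketchCol_le`). The rows are then independent, and the Golden–Thompson inequality
(`trace_exp_add_le`) yields a matrix Bernstein inequality (`sum_trace_exp_le`) in which the
dimension is replaced by `‖W‖_F² ≤ 2 k`. The moments of a single row come from a Rademacher
exponential inequality for squared norms, `sum_exp_sq_norm_le`. Markov's inequality for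
`trace (exp Y - 1 - Y)` completes the estimate (`sketchLaw_bad_le`).

Given such a sketch, let `P'` be the projection that is optimal for `S A + N`, where `N` is the
sketched noise, and `P` the nearly optimal one for `A`. The difference of the complementary
projections splits into pieces of rank at most `k` on which `A` is small
(`trace_mul_sub_proj`), hence the regularised guarantee bounds the effect of the sketch by
`O(γ)` times the squared errors, and `‖N‖` enters additively (`lowRankError_le_of_sketch`).

Conditionally on the sketch, `N` is Gaussian. Its squared norm is linearised by a Gaussian dual
vector, and as each row of `S` has at most `n` non-zero entries, `‖N‖² ≤ 6 n d v` up to probability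
`exp (-s d)` (`pi_denseRandomizer_bad_le`). Inserting the variance `v` gives the additive error. If
`n` is too small for the randomizer to be useful, then `ε ≤ 1` and already `‖A‖ ≤ η √(n d)` is below
the additive error.
-/

namespace LTM

/-! ### The Golden–Thompson inequality -/

section GoldenThompson

variable {ι : Type*} [Fintype ι]

lemma trace_mul_pow_comm [DecidableEq ι] (M N : Matrix ι ι ℝ) (j : ℕ) :
    trace ((M * N) ^ j) = trace ((N * M) ^ j) := by
  cases j with
  | zero => simp
  | succ j =>
    have h : ∀ i : ℕ, (M * N) ^ (i + 1) = M * ((N * M) ^ i * N) := by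
      intro i
      induction i with
      | zero => simp
      | succ i ih =>
        rw [pow_succ', ih, pow_succ' (N * M) i]
        simp only [Matrix.mul_assoc]
    rw [h, trace_mul_comm, Matrix.mul_assoc, ← pow_succ]

lemma trace_transpose_mul_self_nonneg {ι κ : Type*} [Fintype ι] [Fintype κ] (M : Matrix κ ι ℝ) :
    0 ≤ trace (Mᵀ * M) := by
  simp only [trace, diag, mul_apply, transpose_apply]
  exact Finset.sum_nonneg fun i _ => Finset.sum_nonneg fun j _ => mul_self_nonneg _

lemma two_trace_mul_le {A B : Matrix ι ι ℝ} (hA : Aᵀ = A) (hB : Bᵀ = B) :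
    2 * trace (A * B) ≤ trace (A * A) + trace (B * B) := by
  have h := trace_transpose_mul_self_nonneg (A - B)
  rw [transpose_sub, hA, hB, sub_mul, mul_sub, mul_sub, trace_sub, trace_sub, trace_sub,
    trace_mul_comm B A] at h
  linarith

lemma trace_mul_self_le (X : Matrix ι ι ℝ) : trace (X * X) ≤ trace (Xᵀ * X) := by
  have h := trace_transpose_mul_self_nonneg (X - Xᵀ)
  have h2 : trace (Xᵀ * Xᵀ) = trace (X * X) := by
    rw [← transpose_mul, trace_transpose]
  rw [transpose_sub, transpose_transpose, sub_mul, mul_sub, mul_sub, trace_sub, trace_sub,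
    trace_sub, h2, trace_mul_comm X Xᵀ] at h
  linarith

lemma transpose_pow_of_symm [DecidableEq ι] {A : Matrix ι ι ℝ} (hA : Aᵀ = A) (j : ℕ) :
    (A ^ j)ᵀ = A ^ j := by
  rw [transpose_pow, hA]

/-- The trace inequalities behind the Golden–Thompson inequality. They are proved together, because
each of them at level `k + 1` uses the other one at level `k`. -/
lemma trace_pow_two_pow_le [DecidableEq ι] (k : ℕ) :
    (∀ X : Matrix ι ι ℝ, trace (X ^ 2 ^ (k + 1)) ≤ trace ((Xᵀ * X) ^ 2 ^ k)) ∧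
    ∀ A B : Matrix ι ι ℝ, Aᵀ = A → Bᵀ = B →
      trace ((A * B) ^ 2 ^ k) ≤ trace (A ^ 2 ^ k * B ^ 2 ^ k) := by
  induction k with
  | zero =>
    refine ⟨fun X => ?_, fun A B _ _ => ?_⟩
    · simpa [sq] using trace_mul_self_le X
    · simp
  | succ k ih =>
    obtain ⟨ihP, ihQ⟩ := ih
    refine ⟨fun X => ?_, fun A B hA hB => ?_⟩
    · have h1 := ihP (X * X)
      have e1 : X ^ 2 ^ (k + 1 + 1) = (X * X) ^ 2 ^ (k + 1) := by
        rw [← sq, ← pow_mul]; congr 1; ring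
      have e2 : ((X * X)ᵀ * (X * X)) = Xᵀ * (Xᵀ * X * X) := by
        rw [transpose_mul]; simp only [Matrix.mul_assoc]
      have e3 : (Xᵀ * X * X) * Xᵀ = (Xᵀ * X) * (X * Xᵀ) := by
        simp only [Matrix.mul_assoc]
      have s1 : (Xᵀ * X)ᵀ = Xᵀ * X := by simp
      have s2 : (X * Xᵀ)ᵀ = X * Xᵀ := by simp
      have h2 := ihQ _ _ s1 s2
      have h3 := two_trace_mul_le (transpose_pow_of_symm s1 (2 ^ k))
        (transpose_pow_of_symm s2 (2 ^ k))
      rw [← pow_add, ← pow_add, ← two_mul, ← pow_succ', trace_mul_pow_comm X Xᵀ] at h3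
      rw [e2, trace_mul_pow_comm Xᵀ (Xᵀ * X * X), e3] at h1
      rw [e1]
      linarith
    · have h1 := ihP (A * B)
      have e2 : (A * B)ᵀ * (A * B) = B * (A * A * B) := by
        rw [transpose_mul, hA, hB]; simp only [Matrix.mul_assoc]
      have e3 : (A * A * B) * B = (A * A) * (B * B) := by simp only [Matrix.mul_assoc]
      have h2 := ihQ (A * A) (B * B) (by rw [transpose_mul, hA]) (by rw [transpose_mul, hB])
      rw [e2, trace_mul_pow_comm B (A * A * B), e3] at h1
      rw [← sq, ← sq, ← pow_mul, ← pow_mul, ← pow_succ'] at h2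
      rw [← sq, ← sq] at h1
      linarith

end GoldenThompson

lemma norm_exp_le_exp_norm {𝔸 : Type*} [NormedRing 𝔸] [NormedAlgebra ℝ 𝔸] [CompleteSpace 𝔸]
    [NormOneClass 𝔸] (x : 𝔸) : ‖NormedSpace.exp x‖ ≤ Real.exp ‖x‖ := by
  rw [NormedSpace.exp_eq_tsum ℝ]
  refine tsum_of_norm_bounded (g := fun n => (n.factorial : ℝ)⁻¹ • ‖x‖ ^ n) ?_ fun n => ?_
  · have h := NormedSpace.exp_series_hasSum_exp' (𝕂 := ℝ) ‖x‖
    rwa [← Real.exp_eq_exp_ℝ] at h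
  · rw [norm_smul, smul_eq_mul, Real.norm_of_nonneg (by positivity)]
    gcongr
    exact norm_pow_le x n

lemma norm_pow_sub_pow_le {𝔸 : Type*} [NormedRing 𝔸] [NormOneClass 𝔸] {x y : 𝔸} {M : ℝ}
    (hM : 1 ≤ M) (hx : ‖x‖ ≤ M) (hy : ‖y‖ ≤ M) (N : ℕ) :
    ‖x ^ N - y ^ N‖ ≤ N * ‖x - y‖ * M ^ N := by
  induction N with
  | zero => simp
  | succ N ih =>
    have e : x ^ (N + 1) - y ^ (N + 1) = x * (x ^ N - y ^ N) + (x - y) * y ^ N := by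
      rw [pow_succ', pow_succ']; noncomm_ring
    have h1 : ‖x * (x ^ N - y ^ N)‖ ≤ M * (N * ‖x - y‖ * M ^ N) :=
      (norm_mul_le _ _).trans (by gcongr)
    have h2 : ‖(x - y) * y ^ N‖ ≤ ‖x - y‖ * M ^ (N + 1) := by
      refine (norm_mul_le _ _).trans ?_
      gcongr
      calc ‖y ^ N‖ ≤ ‖y‖ ^ N := norm_pow_le y N
        _ ≤ M ^ N := by gcongr
        _ ≤ M ^ (N + 1) := pow_le_pow_right₀ hM (Nat.le_succ N)
    rw [e]
    refine (norm_add_le _ _).trans ((add_le_add h1 h2).trans (le_of_eq ?_))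
    push_cast
    ring

/-- The Lie product formula along powers of two. -/
lemma tendsto_exp_mul_exp_pow {𝔸 : Type*} [NormedRing 𝔸] [NormedAlgebra ℝ 𝔸]
    [FiniteDimensional ℝ 𝔸] [NormOneClass 𝔸] (a b : 𝔸) :
    Filter.Tendsto (fun k : ℕ => (NormedSpace.exp (((2 : ℝ) ^ k)⁻¹ • a) *
      NormedSpace.exp (((2 : ℝ) ^ k)⁻¹ • b)) ^ 2 ^ k) Filter.atTop
      (nhds (NormedSpace.exp (a + b))) := by
  have : CompleteSpace 𝔸 := FiniteDimensional.complete ℝ 𝔸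
  let f : ℝ → 𝔸 := fun t => NormedSpace.exp (t • a) * NormedSpace.exp (t • b)
    - NormedSpace.exp (t • (a + b))
  have hf : HasDerivAt f 0 0 := by
    have h := ((hasDerivAt_exp_smul_const (𝕂 := ℝ) a 0).mul
      (hasDerivAt_exp_smul_const (𝕂 := ℝ) b 0)).sub (hasDerivAt_exp_smul_const (𝕂 := ℝ) (a + b) 0)
    have e : NormedSpace.exp ((0 : ℝ) • a) * a * NormedSpace.exp ((0 : ℝ) • b)
        + NormedSpace.exp ((0 : ℝ) • a) * (NormedSpace.exp ((0 : ℝ) • b) * b)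
        - NormedSpace.exp ((0 : ℝ) • (a + b)) * (a + b) = 0 := by
      simp [NormedSpace.exp_zero]
    rw [e] at h
    exact h
  have hf0 : f 0 = 0 := by simp [f, NormedSpace.exp_zero]
  have ht : Filter.Tendsto (fun k : ℕ => ((2 : ℝ) ^ k)⁻¹) Filter.atTop (nhdsWithin 0 {0}ᶜ) := by
    refine tendsto_nhdsWithin_iff.2 ⟨?_, Filter.Eventually.of_forall fun k => ?_⟩
    · exact (tendsto_pow_atTop_atTop_of_one_lt (by norm_num : (1 : ℝ) < 2)).inv_tendsto_atTop
    · simp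
  have hs := ((hasDerivAt_iff_tendsto_slope_zero.1 hf).comp ht).norm
  simp only [Function.comp_def, zero_add, hf0, sub_zero, inv_inv, norm_zero, norm_smul] at hs
  have hlim : Filter.Tendsto (fun k : ℕ => ‖(2 : ℝ) ^ k‖ * ‖f ((2 : ℝ) ^ k)⁻¹‖ *
      Real.exp (‖a‖ + ‖b‖)) Filter.atTop (nhds 0) := by
    simpa using hs.mul_const (Real.exp (‖a‖ + ‖b‖))
  rw [tendsto_iff_norm_sub_tendsto_zero]
  refine squeeze_zero (fun _ => norm_nonneg _) (fun k => ?_) hlim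
  set t : ℝ := ((2 : ℝ) ^ k)⁻¹ with htdef
  have htpos : 0 ≤ t := by positivity
  have htn : t * ((2 ^ k : ℕ) : ℝ) = 1 := by
    rw [htdef]; push_cast; exact inv_mul_cancel₀ (by positivity)
  have ey : NormedSpace.exp (a + b) = NormedSpace.exp (t • (a + b)) ^ 2 ^ k := by
    let _ : NormedAlgebra ℚ 𝔸 := NormedAlgebra.restrictScalars ℚ ℝ 𝔸
    rw [← NormedSpace.exp_nsmul, ← Nat.cast_smul_eq_nsmul ℝ, smul_smul, mul_comm, htn, one_smul]
  have hM : 1 ≤ Real.exp (t * (‖a‖ + ‖b‖)) := Real.one_le_exp (by positivity)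
  have nt : ∀ c : 𝔸, ‖t • c‖ = t * ‖c‖ := fun c => by rw [norm_smul, Real.norm_of_nonneg htpos]
  have hx : ‖NormedSpace.exp (t • a) * NormedSpace.exp (t • b)‖ ≤
      Real.exp (t * (‖a‖ + ‖b‖)) := by
    rw [mul_add, Real.exp_add, ← nt a, ← nt b]
    exact (norm_mul_le _ _).trans
      (mul_le_mul (norm_exp_le_exp_norm _) (norm_exp_le_exp_norm _) (norm_nonneg _)
        (Real.exp_pos _).le)
  have hy : ‖NormedSpace.exp (t • (a + b))‖ ≤ Real.exp (t * (‖a‖ + ‖b‖)) := by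
    refine (norm_exp_le_exp_norm _).trans (Real.exp_le_exp.2 ?_)
    rw [nt]
    gcongr
    exact norm_add_le a b
  have h := norm_pow_sub_pow_le hM hx hy (2 ^ k)
  rw [← ey, ← Real.exp_nat_mul, ← mul_assoc, mul_comm _ t, htn, one_mul] at h
  refine h.trans (le_of_eq ?_)
  rw [Real.norm_of_nonneg (by positivity)]
  push_cast
  rfl

/-- The Golden–Thompson inequality for real symmetric matrices. -/
theorem trace_exp_add_le {ι : Type*} [Fintype ι] [DecidableEq ι] {A B : Matrix ι ι ℝ}
    (hA : Aᵀ = A) (hB : Bᵀ = B) :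
    trace (NormedSpace.exp (A + B)) ≤ trace (NormedSpace.exp A * NormedSpace.exp B) := by
  cases isEmpty_or_nonempty ι
  · simp [trace]
  have hlim := by
    let _ : NormedRing (Matrix ι ι ℝ) := Matrix.linftyOpNormedRing
    let _ : NormedAlgebra ℝ (Matrix ι ι ℝ) := Matrix.linftyOpNormedAlgebra
    exact tendsto_exp_mul_exp_pow A B
  have htr : Continuous fun M : Matrix ι ι ℝ => trace M := continuous_id.matrix_trace
  refine le_of_tendsto ((htr.tendsto _).comp hlim) (Filter.Eventually.of_forall fun k => ?_)
  have hsym : ∀ {M : Matrix ι ι ℝ}, Mᵀ = M →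
      (NormedSpace.exp (((2 : ℝ) ^ k)⁻¹ • M))ᵀ = NormedSpace.exp (((2 : ℝ) ^ k)⁻¹ • M) := by
    intro M hM
    rw [← Matrix.exp_transpose, transpose_smul, hM]
  have hpow : ∀ M : Matrix ι ι ℝ,
      NormedSpace.exp (((2 : ℝ) ^ k)⁻¹ • M) ^ 2 ^ k = NormedSpace.exp M := by
    intro M
    rw [← Matrix.exp_nsmul, ← Nat.cast_smul_eq_nsmul ℝ, smul_smul]
    push_cast
    rw [mul_inv_cancel₀ (by positivity), one_smul]
  have h := (trace_pow_two_pow_le k).2 _ _ (hsym hA) (hsym hB)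
  rwa [hpow, hpow] at h

/-! ### Spectral estimates for the matrix exponential -/

section Spectral

variable {ι : Type*} [Fintype ι] [DecidableEq ι]

/-- Orthogonal diagonalisation of a symmetric matrix, and of its exponential in the same basis. -/
lemma exists_spectral {A : Matrix ι ι ℝ} (hA : Aᵀ = A) :
    ∃ (U : Matrix ι ι ℝ) (l : ι → ℝ), Uᵀ * U = 1 ∧ U * Uᵀ = 1 ∧ A = U * diagonal l * Uᵀ ∧
      NormedSpace.exp A = U * diagonal (fun i => Real.exp (l i)) * Uᵀ := by
  have hH : A.IsHermitian := by rw [IsHermitian, conjTranspose_eq_transpose_of_trivial, hA]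
  let U : Matrix ι ι ℝ := hH.eigenvectorUnitary
  have h1 : Uᵀ * U = 1 := by
    have := (Matrix.mem_unitaryGroup_iff' (A := U)).1 hH.eigenvectorUnitary.2
    rwa [star_eq_conjTranspose, conjTranspose_eq_transpose_of_trivial] at this
  have h2 : U * Uᵀ = 1 := mul_eq_one_comm.1 h1
  have h3 : A = U * diagonal hH.eigenvalues * Uᵀ := by
    have := hH.spectral_theorem
    rw [Unitary.conjStarAlgAut_apply] at this
    simpa [U, star_eq_conjTranspose, conjTranspose_eq_transpose_of_trivial, Function.comp_def]
      using this
  refine ⟨U, hH.eigenvalues, h1, h2, h3, ?_⟩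
  have hinv : U⁻¹ = Uᵀ := Matrix.inv_eq_left_inv h1
  have hu : IsUnit U := (Matrix.isUnit_iff_isUnit_det U).2 (Matrix.isUnit_det_of_left_inverse h1)
  have hd : (fun i => Real.exp (hH.eigenvalues i)) = NormedSpace.exp hH.eigenvalues := by
    ext i
    rw [Pi.coe_exp, Real.exp_eq_exp_ℝ]
  conv_lhs => rw [h3, ← hinv, Matrix.exp_conj U _ hu, Matrix.exp_diagonal]
  rw [hinv, hd]

lemma dotProduct_conj_diagonal (U : Matrix ι ι ℝ) (l v : ι → ℝ) :
    v ⬝ᵥ (U * diagonal l * Uᵀ) *ᵥ v = ∑ i, l i * (Uᵀ *ᵥ v) i ^ 2 := by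
  rw [← mulVec_mulVec, ← mulVec_mulVec, dotProduct_mulVec, ← mulVec_transpose]
  simp only [dotProduct, mulVec_diagonal]
  exact Finset.sum_congr rfl fun i _ => by ring

lemma sum_sq_transpose_mulVec {U : Matrix ι ι ℝ} (hU : U * Uᵀ = 1) (v : ι → ℝ) :
    ∑ i, (Uᵀ *ᵥ v) i ^ 2 = v ⬝ᵥ v := by
  have h := dotProduct_conj_diagonal U 1 v
  simp only [Pi.one_apply, one_mul] at h
  rw [← h, show diagonal (1 : ι → ℝ) = 1 from diagonal_one, mul_one, hU, one_mulVec]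

lemma trace_conj_diagonal_mul (U : Matrix ι ι ℝ) (l : ι → ℝ) (M : Matrix ι ι ℝ) :
    trace (U * diagonal l * Uᵀ * M) = ∑ i, l i * (U.col i ⬝ᵥ M *ᵥ U.col i) := by
  have e : trace (U * diagonal l * Uᵀ * M) = trace (diagonal l * (Uᵀ * M * U)) := by
    rw [Matrix.mul_assoc, Matrix.mul_assoc, trace_mul_comm, Matrix.mul_assoc, Matrix.mul_assoc,
      ← Matrix.mul_assoc Uᵀ]
  rw [e, trace]
  refine Finset.sum_congr rfl fun i _ => ?_
  rw [diag_apply, diagonal_mul, Matrix.mul_assoc]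
  rfl

lemma col_dotProduct_self {U : Matrix ι ι ℝ} (hU : Uᵀ * U = 1) (i : ι) :
    U.col i ⬝ᵥ U.col i = 1 := by
  have h : (Uᵀ * U) i i = 1 := by rw [hU, one_apply_eq]
  exact h

lemma exp_dotProduct_le {A : Matrix ι ι ℝ} (hA : Aᵀ = A) {v : ι → ℝ} (hv : v ⬝ᵥ v = 1) :
    Real.exp (v ⬝ᵥ A *ᵥ v) ≤ v ⬝ᵥ NormedSpace.exp A *ᵥ v := by
  obtain ⟨U, l, -, h2, h3, h4⟩ := exists_spectral hA
  rw [h4, dotProduct_conj_diagonal, h3, dotProduct_conj_diagonal]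
  have h := convexOn_exp.map_sum_le (t := Finset.univ) (w := fun i => (Uᵀ *ᵥ v) i ^ 2) (p := l)
    (fun i _ => sq_nonneg _) (by rw [sum_sq_transpose_mulVec h2, hv]) (fun i _ => Set.mem_univ _)
  simpa only [smul_eq_mul, mul_comm] using h

/-- Convexity of the trace exponential, as Jensen's inequality over a finite family. -/
lemma trace_exp_sum_le {κ : Type*} (s : Finset κ) (p : κ → ℝ) (hp : ∀ j ∈ s, 0 ≤ p j)
    (hp1 : ∑ j ∈ s, p j = 1) (A : κ → Matrix ι ι ℝ) (hA : ∀ j ∈ s, (A j)ᵀ = A j) :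
    trace (NormedSpace.exp (∑ j ∈ s, p j • A j)) ≤
      ∑ j ∈ s, p j * trace (NormedSpace.exp (A j)) := by
  have hX : (∑ j ∈ s, p j • A j)ᵀ = ∑ j ∈ s, p j • A j := by
    rw [transpose_sum]
    exact Finset.sum_congr rfl fun j hj => by rw [transpose_smul, hA j hj]
  obtain ⟨U, l, h1, h2, h3, h4⟩ := exists_spectral hX
  have htr : ∀ M : Matrix ι ι ℝ, trace M = ∑ i, U.col i ⬝ᵥ M *ᵥ U.col i := by
    intro M
    have := trace_conj_diagonal_mul U 1 M
    rw [show diagonal (1 : ι → ℝ) = 1 from diagonal_one, mul_one, h2, one_mul] at this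
    simpa using this
  have hdiag : ∀ i, U.col i ⬝ᵥ (∑ j ∈ s, p j • A j) *ᵥ U.col i = l i := by
    intro i
    have : (Uᵀ * (U * diagonal l * Uᵀ) * U) i i = l i := by
      rw [show Uᵀ * (U * diagonal l * Uᵀ) * U = (Uᵀ * U) * diagonal l * (Uᵀ * U) by
        simp only [Matrix.mul_assoc], h1, one_mul, mul_one, diagonal_apply_eq]
    rw [← h3, Matrix.mul_assoc] at this
    exact this
  have hL : trace (NormedSpace.exp (∑ j ∈ s, p j • A j)) = ∑ i, Real.exp (l i) := by
    rw [h4, trace_mul_comm, ← Matrix.mul_assoc, h1, one_mul, trace_diagonal]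
  rw [hL]
  calc ∑ i, Real.exp (l i)
      = ∑ i, Real.exp (∑ j ∈ s, p j • (U.col i ⬝ᵥ A j *ᵥ U.col i)) := by
        refine Finset.sum_congr rfl fun i _ => ?_
        rw [← hdiag i, Matrix.sum_mulVec, dotProduct_sum]
        simp only [smul_mulVec, dotProduct_smul]
    _ ≤ ∑ i, ∑ j ∈ s, p j • Real.exp (U.col i ⬝ᵥ A j *ᵥ U.col i) :=
        Finset.sum_le_sum fun i _ => convexOn_exp.map_sum_le hp hp1 fun _ _ => Set.mem_univ _
    _ ≤ ∑ i, ∑ j ∈ s, p j * (U.col i ⬝ᵥ NormedSpace.exp (A j) *ᵥ U.col i) :=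
        Finset.sum_le_sum fun i _ => Finset.sum_le_sum fun j hj =>
          mul_le_mul_of_nonneg_left (exp_dotProduct_le (hA j hj) (col_dotProduct_self h1 i))
            (hp j hj)
    _ = ∑ j ∈ s, p j * trace (NormedSpace.exp (A j)) := by
        rw [Finset.sum_comm]
        exact Finset.sum_congr rfl fun j _ => by rw [htr, Finset.mul_sum]

lemma exp_le_one_add_add_sq_mul_exp {x c : ℝ} (hx : |x| ≤ c) :
    Real.exp x ≤ 1 + x + x ^ 2 * Real.exp c := by
  have h := Complex.norm_exp_sub_sum_le_norm_mul_exp (x : ℂ) 2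
  have e : Complex.exp x - ∑ m ∈ Finset.range 2, (x : ℂ) ^ m / (m.factorial : ℂ)
      = ((Real.exp x - (1 + x) : ℝ) : ℂ) := by
    simp [Finset.sum_range_succ]
  rw [e, Complex.norm_real, Complex.norm_real, Real.norm_eq_abs, Real.norm_eq_abs, sq_abs] at h
  have h2 := (le_abs_self _).trans h
  have h3 : x ^ 2 * Real.exp |x| ≤ x ^ 2 * Real.exp c := by gcongr
  linarith

/-- The bound `exp A ≤ 1 + A + exp c • A ^ 2` of quadratic forms for a symmetric `A` with spectrum
in `[-c, c]`. -/
lemma dotProduct_exp_le {A : Matrix ι ι ℝ} (hA : Aᵀ = A) {c : ℝ}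
    (hc : ∀ u : ι → ℝ, |u ⬝ᵥ A *ᵥ u| ≤ c * (u ⬝ᵥ u)) (v : ι → ℝ) :
    v ⬝ᵥ NormedSpace.exp A *ᵥ v ≤
      v ⬝ᵥ v + v ⬝ᵥ A *ᵥ v + Real.exp c * (A *ᵥ v ⬝ᵥ A *ᵥ v) := by
  obtain ⟨U, l, h1, h2, h3, h4⟩ := exists_spectral hA
  have hl : ∀ i, |l i| ≤ c := by
    intro i
    have h : (Uᵀ * (U * diagonal l * Uᵀ) * U) i i = l i := by
      rw [show Uᵀ * (U * diagonal l * Uᵀ) * U = (Uᵀ * U) * diagonal l * (Uᵀ * U) by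
        simp only [Matrix.mul_assoc], h1, one_mul, mul_one, diagonal_apply_eq]
    rw [← h3, Matrix.mul_assoc] at h
    have h' : U.col i ⬝ᵥ A *ᵥ U.col i = l i := h
    have := hc (U.col i)
    rwa [h', col_dotProduct_self h1, mul_one] at this
  have hsq : A *ᵥ v ⬝ᵥ A *ᵥ v = ∑ i, l i ^ 2 * (Uᵀ *ᵥ v) i ^ 2 := by
    have e : A * A = U * diagonal (fun i => l i ^ 2) * Uᵀ := by
      rw [show (fun i => l i ^ 2) = fun i => l i * l i by ext; ring, ← diagonal_mul_diagonal, h3,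
        show U * diagonal l * Uᵀ * (U * diagonal l * Uᵀ)
          = U * diagonal l * (Uᵀ * U) * diagonal l * Uᵀ by simp only [Matrix.mul_assoc], h1,
        mul_one, Matrix.mul_assoc U]
    rw [← dotProduct_conj_diagonal, ← e, ← mulVec_mulVec, dotProduct_comm,
      dotProduct_mulVec, ← mulVec_transpose, hA, dotProduct_comm]
  rw [hsq, h4, dotProduct_conj_diagonal, ← sum_sq_transpose_mulVec h2 v, h3,
    dotProduct_conj_diagonal, Finset.mul_sum, ← Finset.sum_add_distrib, ← Finset.sum_add_distrib]
  refine Finset.sum_le_sum fun i _ => ?_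
  have := mul_le_mul_of_nonneg_right (exp_le_one_add_add_sq_mul_exp (hl i))
    (sq_nonneg ((Uᵀ *ᵥ v) i))
  linarith

/-- In `exp H * V = (1 + H) * V + (exp H - 1 - H) * V` the last factor `exp H - 1 - H` is positive
semidefinite, so there `V` may be replaced by its upper bound `c • 1`. -/
lemma trace_exp_mul_one_add_le {H : Matrix ι ι ℝ} (hH : Hᵀ = H) {V : Matrix ι ι ℝ} {c : ℝ}
    (hV : ∀ u : ι → ℝ, u ⬝ᵥ V *ᵥ u ≤ c * (u ⬝ᵥ u)) :
    trace (NormedSpace.exp H * (1 + V)) ≤ trace (NormedSpace.exp H) + trace V + trace (H * V)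
      + c * (trace (NormedSpace.exp H) - Fintype.card ι - trace H) := by
  obtain ⟨U, l, h1, h2, h3, h4⟩ := exists_spectral hH
  have e1 : NormedSpace.exp H - 1 - H
      = U * diagonal (fun i => Real.exp (l i) - 1 - l i) * Uᵀ := by
    have : diagonal (fun i => Real.exp (l i) - 1 - l i)
        = diagonal (fun i => Real.exp (l i)) - 1 - diagonal l := by
      rw [← diagonal_one, diagonal_sub, diagonal_sub]
    rw [this, mul_sub, mul_sub, sub_mul, sub_mul, mul_one, h2, ← h3, ← h4]
  have h5 : trace ((NormedSpace.exp H - 1 - H) * V) ≤ c * trace (NormedSpace.exp H - 1 - H) := by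
    conv_rhs => rw [← mul_one (NormedSpace.exp H - 1 - H)]
    rw [e1, trace_conj_diagonal_mul, trace_conj_diagonal_mul, Finset.mul_sum]
    refine Finset.sum_le_sum fun i _ => ?_
    have h6 : 0 ≤ Real.exp (l i) - 1 - l i := by linarith [Real.add_one_le_exp (l i)]
    have h7 := mul_le_mul_of_nonneg_left (hV (U.col i)) h6
    rw [one_mulVec]
    linarith
  rw [sub_mul, sub_mul, one_mul, trace_sub, trace_sub, trace_sub, trace_sub, trace_one] at h5
  rw [mul_add, mul_one, trace_add]
  linarith

/-- The trace of `exp Y - 1 - Y` controls the quadratic form of `Y` from above. -/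
lemma exp_sub_one_sub_le_trace {Y : Matrix ι ι ℝ} (hY : Yᵀ = Y) {v : ι → ℝ} (hv : v ⬝ᵥ v = 1)
    {x : ℝ} (hx : 0 ≤ x) (hxv : x ≤ v ⬝ᵥ Y *ᵥ v) :
    Real.exp x - 1 - x ≤ trace (NormedSpace.exp Y) - Fintype.card ι - trace Y := by
  obtain ⟨U, l, h1, h2, h3, h4⟩ := exists_spectral hY
  have e1 : trace (NormedSpace.exp Y) - Fintype.card ι - trace Y
      = ∑ i, (Real.exp (l i) - 1 - l i) := by
    have e2 : trace (NormedSpace.exp Y) = ∑ i, Real.exp (l i) := by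
      rw [h4, trace_mul_comm, ← Matrix.mul_assoc, h1, one_mul, trace_diagonal]
    have e3 : trace Y = ∑ i, l i := by
      rw [h3, trace_mul_comm, ← Matrix.mul_assoc, h1, one_mul, trace_diagonal]
    rw [e2, e3, Finset.sum_sub_distrib, Finset.sum_sub_distrib]
    simp
  have hmono : Real.exp x - 1 - x ≤ Real.exp (v ⬝ᵥ Y *ᵥ v) - 1 - v ⬝ᵥ Y *ᵥ v := by
    set y := v ⬝ᵥ Y *ᵥ v
    have h5 : Real.exp y = Real.exp x * Real.exp (y - x) := by rw [← Real.exp_add]; ring_nf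
    have h6 := Real.add_one_le_exp (y - x)
    have h7 := Real.one_le_exp hx
    nlinarith
  have hle := exp_dotProduct_le hY hv
  have hexp : v ⬝ᵥ NormedSpace.exp Y *ᵥ v - 1 - v ⬝ᵥ Y *ᵥ v
      = ∑ i, (Real.exp (l i) - 1 - l i) * (Uᵀ *ᵥ v) i ^ 2 := by
    rw [h4, dotProduct_conj_diagonal]
    nth_rw 1 [← hv]
    rw [← sum_sq_transpose_mulVec h2 v, h3, dotProduct_conj_diagonal, ← Finset.sum_sub_distrib,
      ← Finset.sum_sub_distrib]
    exact Finset.sum_congr rfl fun i _ => by ring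
  have hbound : ∑ i, (Real.exp (l i) - 1 - l i) * (Uᵀ *ᵥ v) i ^ 2
      ≤ ∑ i, (Real.exp (l i) - 1 - l i) := by
    refine Finset.sum_le_sum fun i _ => ?_
    have h6 : 0 ≤ Real.exp (l i) - 1 - l i := by linarith [Real.add_one_le_exp (l i)]
    have h7 : (Uᵀ *ᵥ v) i ^ 2 ≤ 1 := by
      rw [← hv, ← sum_sq_transpose_mulVec h2 v]
      exact Finset.single_le_sum (f := fun i => (Uᵀ *ᵥ v) i ^ 2) (fun j _ => sq_nonneg _)
        (Finset.mem_univ i)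
    nlinarith
  rw [e1]
  linarith

end Spectral

/-! ### Weighted sums over finite product spaces -/

lemma sum_fin_cons {α M : Type*} [Fintype α] [AddCommMonoid M] {n : ℕ}
    (F : (Fin (n + 1) → α) → M) :
    ∑ ω, F ω = ∑ a, ∑ ω : Fin n → α, F (Fin.cons a ω) := by
  rw [← Fintype.sum_prod_type']
  exact (Fintype.sum_equiv (Fin.consEquiv fun _ => α) _ _ fun _ => rfl).symm

lemma sum_prod_weight {κ α : Type*} [Fintype κ] [DecidableEq κ] [Fintype α] (p : κ → α → ℝ) :
    ∑ ω : κ → α, ∏ i, p i (ω i) = ∏ i, ∑ a, p i a := by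
  rw [Finset.prod_univ_sum, Fintype.piFinset_univ]

lemma sum_prod_weight_eq_one {κ α : Type*} [Fintype κ] [DecidableEq κ] [Fintype α] {p : α → ℝ}
    (hp : ∑ a, p a = 1) : ∑ ω : κ → α, ∏ i, p (ω i) = 1 := by
  rw [sum_prod_weight fun _ => p]
  simp [hp]

lemma sum_intUnits {M : Type*} [AddCommMonoid M] (f : ℤˣ → M) : ∑ x, f x = f 1 + f (-1) := by
  rw [UnitsInt.univ, Finset.sum_pair (by decide)]

/-! ### Exponential trace bounds for sums of independent symmetric matrices -/

/-- Matrix Bernstein recursion for `j` independent copies of a centred random symmetric matrix `X`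
whose exponential moment is close to the identity. The factor `K` plays the role of an intrinsic
dimension: the ambient dimension enters only through the subtracted trace of the identity. -/
theorem sum_trace_exp_le {ι Ω : Type*} [Fintype ι] [DecidableEq ι] [Fintype Ω]
    {p : Ω → ℝ} (hp : ∀ a, 0 ≤ p a) (hp1 : ∑ a, p a = 1) {X : Ω → Matrix ι ι ℝ}
    (hX : ∀ a, (X a)ᵀ = X a) (hX0 : ∑ a, p a • X a = 0) {K c : ℝ} (hc : 0 ≤ c)
    (hV : ∀ u : ι → ℝ,
      u ⬝ᵥ (∑ a, p a • NormedSpace.exp (X a)) *ᵥ u ≤ (1 + c) * (u ⬝ᵥ u))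
    (hK : trace (∑ a, p a • NormedSpace.exp (X a)) ≤ Fintype.card ι + K * c) (j : ℕ) :
    ∑ ω : Fin j → Ω, (∏ i, p (ω i)) * trace (NormedSpace.exp (∑ i, X (ω i)))
      ≤ Fintype.card ι + K * ((1 + c) ^ j - 1) := by
  -- the sum of the first `j` matrices is centred
  have hcent : ∀ j : ℕ, ∑ ω : Fin j → Ω, (∏ i, p (ω i)) • ∑ i, X (ω i) = 0 := by
    intro j
    induction j with
    | zero => simp
    | succ j ih =>
      rw [sum_fin_cons]
      simp only [Fin.prod_univ_succ, Fin.sum_univ_succ, Fin.cons_zero, Fin.cons_succ, smul_add,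
        Finset.sum_add_distrib]
      have e1 : ∑ a, ∑ ω : Fin j → Ω, (p a * ∏ i, p (ω i)) • X a = 0 := by
        simp only [← Finset.sum_smul, ← Finset.mul_sum, sum_prod_weight_eq_one hp1, mul_one, hX0]
      have e2 : ∑ a, ∑ ω : Fin j → Ω, (p a * ∏ i, p (ω i)) • ∑ i, X (ω i) = 0 := by
        simp only [mul_smul, ← Finset.smul_sum, ih, smul_zero, Finset.sum_const_zero]
      rw [e1, e2, add_zero]
  induction j with
  | zero => simp [trace_one]
  | succ j ih =>
    set V : Matrix ι ι ℝ := ∑ a, p a • NormedSpace.exp (X a) - 1 with hVdef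
    have hVq : ∀ u : ι → ℝ, u ⬝ᵥ V *ᵥ u ≤ c * (u ⬝ᵥ u) := by
      intro u
      rw [hVdef, sub_mulVec, dotProduct_sub, one_mulVec]
      linarith [hV u]
    have hVt : trace V ≤ K * c := by
      rw [hVdef, trace_sub, trace_one]
      linarith
    rw [sum_fin_cons, Finset.sum_comm]
    simp only [Fin.prod_univ_succ, Fin.sum_univ_succ, Fin.cons_zero, Fin.cons_succ]
    have hstep : ∀ ω : Fin j → Ω,
        ∑ a, p a * (∏ i, p (ω i)) * trace (NormedSpace.exp (X a + ∑ i, X (ω i)))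
        ≤ (∏ i, p (ω i)) * ((1 + c) * trace (NormedSpace.exp (∑ i, X (ω i))) + K * c
          - c * Fintype.card ι + trace ((∑ i, X (ω i)) * V) - c * trace (∑ i, X (ω i))) := by
      intro ω
      set H := ∑ i, X (ω i) with hHdef
      have hH : Hᵀ = H := by
        rw [hHdef, transpose_sum]
        exact Finset.sum_congr rfl fun i _ => hX _
      have hw : 0 ≤ ∏ i, p (ω i) := Finset.prod_nonneg fun i _ => hp _
      have h1 : ∑ a, p a * trace (NormedSpace.exp (X a + H))
          ≤ trace (NormedSpace.exp H * (1 + V)) := by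
        have e : NormedSpace.exp H * (1 + V)
            = ∑ a, p a • (NormedSpace.exp H * NormedSpace.exp (X a)) := by
          rw [hVdef, add_sub_cancel, Finset.mul_sum]
          exact Finset.sum_congr rfl fun a _ => by rw [mul_smul_comm]
        rw [e, trace_sum]
        refine Finset.sum_le_sum fun a _ => ?_
        rw [trace_smul, smul_eq_mul, add_comm]
        exact mul_le_mul_of_nonneg_left (trace_exp_add_le hH (hX a)) (hp a)
      have h2 := trace_exp_mul_one_add_le hH hVq
      have e : ∑ a, p a * (∏ i, p (ω i)) * trace (NormedSpace.exp (X a + H))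
          = (∏ i, p (ω i)) * ∑ a, p a * trace (NormedSpace.exp (X a + H)) := by
        rw [Finset.mul_sum]
        exact Finset.sum_congr rfl fun a _ => by ring
      rw [e]
      refine mul_le_mul_of_nonneg_left ?_ hw
      linarith
    refine (Finset.sum_le_sum fun ω _ => hstep ω).trans ?_
    have hw1 : ∑ ω : Fin j → Ω, ∏ i, p (ω i) = 1 := sum_prod_weight_eq_one hp1
    have hz1 : ∑ ω : Fin j → Ω, (∏ i, p (ω i)) * trace ((∑ i, X (ω i)) * V) = 0 := by
      have := congrArg (fun M => trace (M * V)) (hcent j)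
      simpa only [Finset.sum_mul, trace_sum, smul_mul_assoc, trace_smul, smul_eq_mul, zero_mul,
        trace_zero] using this
    have hz2 : ∑ ω : Fin j → Ω, (∏ i, p (ω i)) * trace (∑ i, X (ω i)) = 0 := by
      have := congrArg trace (hcent j)
      simpa only [trace_sum, trace_smul, smul_eq_mul, trace_zero] using this
    have e : ∑ ω : Fin j → Ω, (∏ i, p (ω i)) *
          ((1 + c) * trace (NormedSpace.exp (∑ i, X (ω i))) + K * c
            - c * Fintype.card ι + trace ((∑ i, X (ω i)) * V) - c * trace (∑ i, X (ω i)))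
        = (1 + c) * ∑ ω : Fin j → Ω, (∏ i, p (ω i)) * trace (NormedSpace.exp (∑ i, X (ω i)))
          + (K * c - c * Fintype.card ι) * ∑ ω : Fin j → Ω, ∏ i, p (ω i)
          + ∑ ω : Fin j → Ω, (∏ i, p (ω i)) * trace ((∑ i, X (ω i)) * V)
          - c * ∑ ω : Fin j → Ω, (∏ i, p (ω i)) * trace (∑ i, X (ω i)) := by
      simp only [Finset.mul_sum, ← Finset.sum_add_distrib, ← Finset.sum_sub_distrib]
      exact Finset.sum_congr rfl fun ω _ => by ring
    rw [e, hw1, hz1, hz2]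
    have := mul_le_mul_of_nonneg_left ih (by linarith : (0 : ℝ) ≤ 1 + c)
    rw [pow_succ]
    linarith

/-! ### Exponential moments of Rademacher sums -/

section Rademacher

variable {ι : Type*} [Fintype ι]

lemma isUnit_of_coercive [DecidableEq ι] {N : Matrix ι ι ℝ} {μ : ℝ} (hμ : 0 < μ)
    (h : ∀ u : ι → ℝ, μ * (u ⬝ᵥ u) ≤ u ⬝ᵥ N *ᵥ u) : IsUnit N := by
  rw [← Matrix.mulVec_injective_iff_isUnit]
  intro a b hab
  have h1 := h (a - b)
  rw [mulVec_sub, sub_eq_zero.2 hab, dotProduct_zero] at h1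
  have h2 : (a - b) ⬝ᵥ (a - b) ≤ 0 := by
    by_contra h3
    push Not at h3
    have := mul_pos hμ h3
    linarith
  have h3 : (a - b) ⬝ᵥ (a - b) = 0 := by
    refine le_antisymm h2 (Finset.sum_nonneg fun i _ => mul_self_nonneg _)
  exact sub_eq_zero.1 (dotProduct_self_eq_zero.1 h3)

lemma mulVec_inv_mulVec [DecidableEq ι] {N : Matrix ι ι ℝ} (hN : IsUnit N) (x : ι → ℝ) :
    N *ᵥ (N⁻¹ *ᵥ x) = x := by
  rw [mulVec_mulVec, Matrix.mul_nonsing_inv _ ((Matrix.isUnit_iff_isUnit_det N).1 hN), one_mulVec]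

lemma dotProduct_mulVec_comm {N : Matrix ι ι ℝ} (hN : Nᵀ = N) (a b : ι → ℝ) :
    a ⬝ᵥ N *ᵥ b = b ⬝ᵥ N *ᵥ a := by
  rw [dotProduct_mulVec, ← mulVec_transpose, hN, dotProduct_comm]

/-- A one-sided Sherman–Morrison inequality. -/
lemma inv_add_sq_le_inv_sub [DecidableEq ι] {N : Matrix ι ι ℝ} (hN : Nᵀ = N) {μ : ℝ} (hμ : 0 < μ)
    {y : ι → ℝ} (h : ∀ u : ι → ℝ, μ * (u ⬝ᵥ u) ≤ u ⬝ᵥ (N - (2 : ℝ) • vecMulVec y y) *ᵥ u)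
    (x : ι → ℝ) :
    x ⬝ᵥ N⁻¹ *ᵥ x + 2 * (x ⬝ᵥ N⁻¹ *ᵥ y) ^ 2
      ≤ x ⬝ᵥ (N - (2 : ℝ) • vecMulVec y y)⁻¹ *ᵥ x := by
  set N' := N - (2 : ℝ) • vecMulVec y y with hN'
  have hmul : ∀ u : ι → ℝ, N' *ᵥ u = N *ᵥ u - (2 * (y ⬝ᵥ u)) • y := by
    intro u
    rw [hN', sub_mulVec, smul_mulVec, vecMulVec_mulVec]
    ext i; simp; ring
  have hN1 : ∀ u : ι → ℝ, μ * (u ⬝ᵥ u) ≤ u ⬝ᵥ N *ᵥ u := by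
    intro u
    have := h u
    rw [hmul, dotProduct_sub, dotProduct_smul, smul_eq_mul, dotProduct_comm u y] at this
    nlinarith [sq_nonneg (y ⬝ᵥ u)]
  have ha := mulVec_inv_mulVec (isUnit_of_coercive hμ hN1) x
  have ha' := mulVec_inv_mulVec (isUnit_of_coercive hμ h) x
  have hNinv : (N⁻¹)ᵀ = N⁻¹ := by rw [transpose_nonsing_inv, hN]
  set a := N⁻¹ *ᵥ x
  set a' := N'⁻¹ *ᵥ x
  have e0 : x ⬝ᵥ N⁻¹ *ᵥ y = y ⬝ᵥ a := dotProduct_mulVec_comm hNinv x y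
  have e1 : x ⬝ᵥ a' = x ⬝ᵥ a + 2 * (y ⬝ᵥ a') * (y ⬝ᵥ a) := by
    have h1 : a' ⬝ᵥ N *ᵥ a = a ⬝ᵥ N *ᵥ a' := dotProduct_mulVec_comm hN _ _
    have h2 : N *ᵥ a' = x + (2 * (y ⬝ᵥ a')) • y := by rw [← ha', hmul]; simp
    rw [h2, ha, dotProduct_add, dotProduct_smul, smul_eq_mul, dotProduct_comm a y,
      dotProduct_comm a x, dotProduct_comm a' x] at h1
    exact h1
  have e2 : N' *ᵥ (a' - a) = (2 * (y ⬝ᵥ a)) • y := by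
    rw [mulVec_sub, ha', hmul a, ha]; simp
  have h3 := h (a' - a)
  have h4 : 0 ≤ (a' - a) ⬝ᵥ (a' - a) := Finset.sum_nonneg fun i _ => mul_self_nonneg _
  rw [e2, dotProduct_smul, smul_eq_mul, dotProduct_comm _ y, dotProduct_sub y] at h3
  have h5 := mul_nonneg hμ.le h4
  rw [e0, e1]
  nlinarith

lemma dotProduct_inv_le [DecidableEq ι] {N : Matrix ι ι ℝ} {μ : ℝ} (hμ : 0 < μ)
    (h : ∀ u : ι → ℝ, μ * (u ⬝ᵥ u) ≤ u ⬝ᵥ N *ᵥ u) (y : ι → ℝ) :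
    y ⬝ᵥ N⁻¹ *ᵥ y ≤ μ⁻¹ * (y ⬝ᵥ y) := by
  have ha := mulVec_inv_mulVec (isUnit_of_coercive hμ h) y
  set a := N⁻¹ *ᵥ y
  have h1 := h a
  rw [ha, dotProduct_comm a y] at h1
  have h2 : 0 ≤ (μ • a - y) ⬝ᵥ (μ • a - y) := Finset.sum_nonneg fun i _ => mul_self_nonneg _
  simp only [sub_dotProduct, dotProduct_sub, smul_dotProduct, dotProduct_smul, smul_eq_mul,
    dotProduct_comm a y] at h2
  have h3 : μ * (y ⬝ᵥ a) ≤ y ⬝ᵥ y := by nlinarith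
  rw [inv_mul_eq_div, le_div_iff₀ hμ]
  linarith

/-- Exponential moment of a quadratic form at a Rademacher sum. The signs are averaged one at a
time, and each vector `y` so removed is paid for by passing from `N` to `N - 2 y yᵀ`. -/
lemma sum_exp_quadratic_le [DecidableEq ι] {μ : ℝ} (hμ : 0 < μ) {N : Matrix ι ι ℝ} (hN : Nᵀ = N)
    (n : ℕ) (y : Fin n → ι → ℝ)
    (h : ∀ u : ι → ℝ, μ * (u ⬝ᵥ u) ≤ u ⬝ᵥ (N - (2 : ℝ) • ∑ c, vecMulVec (y c) (y c)) *ᵥ u)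
    (x : ι → ℝ) :
    ∑ σ : Fin n → ℤˣ, Real.exp ((x + ∑ c, ((σ c : ℤ) : ℝ) • y c) ⬝ᵥ
        N⁻¹ *ᵥ (x + ∑ c, ((σ c : ℤ) : ℝ) • y c))
      ≤ 2 ^ n * Real.exp (μ⁻¹ * ∑ c, y c ⬝ᵥ y c) *
        Real.exp (x ⬝ᵥ (N - (2 : ℝ) • ∑ c, vecMulVec (y c) (y c))⁻¹ *ᵥ x) := by
  induction n generalizing x with
  | zero => simp
  | succ n ih =>
    set y' : Fin n → ι → ℝ := fun c => y c.succ
    set N₁ := N - (2 : ℝ) • ∑ c, vecMulVec (y' c) (y' c) with hN₁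
    have hsum : N - (2 : ℝ) • ∑ c, vecMulVec (y c) (y c)
        = N₁ - (2 : ℝ) • vecMulVec (y 0) (y 0) := by
      rw [hN₁, Fin.sum_univ_succ, smul_add]; abel
    rw [hsum] at h ⊢
    have hN₁s : N₁ᵀ = N₁ := by
      rw [hN₁, transpose_sub, hN, transpose_smul, transpose_sum]
      simp only [transpose_vecMulVec]
    have h' : ∀ u : ι → ℝ, μ * (u ⬝ᵥ u) ≤ u ⬝ᵥ N₁ *ᵥ u := by
      intro u
      have := h u
      rw [sub_mulVec, smul_mulVec, vecMulVec_mulVec, dotProduct_sub, dotProduct_smul] at this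
      have e : u ⬝ᵥ MulOpposite.op (y 0 ⬝ᵥ u) • y 0 = (y 0 ⬝ᵥ u) ^ 2 := by
        rw [op_smul_eq_smul, dotProduct_smul, smul_eq_mul, dotProduct_comm u, sq]
      rw [e, smul_eq_mul] at this
      nlinarith [sq_nonneg (y 0 ⬝ᵥ u)]
    have hinv : (N₁⁻¹)ᵀ = N₁⁻¹ := by rw [transpose_nonsing_inv, hN₁s]
    rw [sum_fin_cons]
    simp only [Fin.sum_univ_succ, Fin.cons_zero, Fin.cons_succ]
    have hstep : ∀ a : ℤˣ, ∑ σ : Fin n → ℤˣ,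
        Real.exp ((x + (((a : ℤ) : ℝ) • y 0 + ∑ c, ((σ c : ℤ) : ℝ) • y c.succ)) ⬝ᵥ
          N⁻¹ *ᵥ (x + (((a : ℤ) : ℝ) • y 0 + ∑ c, ((σ c : ℤ) : ℝ) • y c.succ)))
        ≤ 2 ^ n * Real.exp (μ⁻¹ * ∑ c, y' c ⬝ᵥ y' c) *
          Real.exp ((x + ((a : ℤ) : ℝ) • y 0) ⬝ᵥ N₁⁻¹ *ᵥ (x + ((a : ℤ) : ℝ) • y 0)) := by
      intro a
      simpa only [add_assoc] using ih y' h' (x + ((a : ℤ) : ℝ) • y 0)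
    refine (Finset.sum_le_sum fun a _ => hstep a).trans ?_
    rw [← Finset.mul_sum, sum_intUnits]
    set b := x ⬝ᵥ N₁⁻¹ *ᵥ y 0 with hb
    have e1 : (x + (((1 : ℤˣ) : ℤ) : ℝ) • y 0) ⬝ᵥ N₁⁻¹ *ᵥ (x + (((1 : ℤˣ) : ℤ) : ℝ) • y 0)
        = (x ⬝ᵥ N₁⁻¹ *ᵥ x + y 0 ⬝ᵥ N₁⁻¹ *ᵥ y 0) + 2 * b := by
      simp only [Units.val_one, Int.cast_one, one_smul, mulVec_add, add_dotProduct, dotProduct_add]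
      rw [dotProduct_mulVec_comm hinv (y 0) x]
      ring
    have e2 : (x + (((-1 : ℤˣ) : ℤ) : ℝ) • y 0) ⬝ᵥ N₁⁻¹ *ᵥ (x + (((-1 : ℤˣ) : ℤ) : ℝ) • y 0)
        = (x ⬝ᵥ N₁⁻¹ *ᵥ x + y 0 ⬝ᵥ N₁⁻¹ *ᵥ y 0) + -(2 * b) := by
      simp only [Units.val_neg, Units.val_one, Int.cast_neg, Int.cast_one, neg_smul, one_smul,
        mulVec_add, mulVec_neg, add_dotProduct, dotProduct_add, neg_dotProduct, dotProduct_neg]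
      rw [dotProduct_mulVec_comm hinv (y 0) x]
      ring
    have hcosh : Real.exp (2 * b) + Real.exp (-(2 * b)) ≤ 2 * Real.exp (2 * b ^ 2) := by
      have := Real.cosh_le_exp_half_sq (2 * b)
      rw [Real.cosh_eq] at this
      have e : (2 * b) ^ 2 / 2 = 2 * b ^ 2 := by ring
      rw [e] at this
      linarith
    have hSM := inv_add_sq_le_inv_sub hN₁s hμ h x
    have hq := dotProduct_inv_le hμ h' (y 0)
    rw [e1, e2, Real.exp_add, Real.exp_add _ (-(2 * b)), ← mul_add]
    calc 2 ^ n * Real.exp (μ⁻¹ * ∑ c, y' c ⬝ᵥ y' c) *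
          (Real.exp (x ⬝ᵥ N₁⁻¹ *ᵥ x + y 0 ⬝ᵥ N₁⁻¹ *ᵥ y 0) *
            (Real.exp (2 * b) + Real.exp (-(2 * b))))
        ≤ 2 ^ n * Real.exp (μ⁻¹ * ∑ c, y' c ⬝ᵥ y' c) *
          (Real.exp (x ⬝ᵥ N₁⁻¹ *ᵥ x + y 0 ⬝ᵥ N₁⁻¹ *ᵥ y 0) * (2 * Real.exp (2 * b ^ 2))) := by
          gcongr
      _ = 2 ^ (n + 1) * Real.exp (μ⁻¹ * ∑ c, y' c ⬝ᵥ y' c + y 0 ⬝ᵥ N₁⁻¹ *ᵥ y 0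
          + (x ⬝ᵥ N₁⁻¹ *ᵥ x + 2 * b ^ 2)) := by
          simp only [Real.exp_add, pow_succ]; ring
      _ ≤ 2 ^ (n + 1) * Real.exp (μ⁻¹ * ∑ c, y' c ⬝ᵥ y' c + μ⁻¹ * (y 0 ⬝ᵥ y 0)
          + x ⬝ᵥ (N₁ - (2 : ℝ) • vecMulVec (y 0) (y 0))⁻¹ *ᵥ x) := by
          gcongr
      _ = _ := by
          simp only [Real.exp_add, mul_add]; ring

/-- Exponential moment of the squared norm of a Rademacher sum of vectors whose second moment matrix
is at most the identity. -/
lemma sum_exp_sq_norm_le {n : ℕ} {y : Fin n → ι → ℝ}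
    (hy : ∀ u : ι → ℝ, ∑ c, (y c ⬝ᵥ u) ^ 2 ≤ u ⬝ᵥ u) {r : ℝ} (hr : 0 < r) (hr4 : r ≤ 1 / 4) :
    ∑ σ : Fin n → ℤˣ, Real.exp (r * ((∑ c, ((σ c : ℤ) : ℝ) • y c) ⬝ᵥ
        (∑ c, ((σ c : ℤ) : ℝ) • y c)))
      ≤ 2 ^ n * Real.exp (2 * r * ∑ c, y c ⬝ᵥ y c) := by
  classical
  have hμ : 0 < (2 * r)⁻¹ := by positivity
  have hinv : (r⁻¹ • (1 : Matrix ι ι ℝ))⁻¹ = r • 1 :=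
    Matrix.inv_eq_left_inv (by rw [smul_mul_smul_comm, mul_inv_cancel₀ hr.ne', one_smul, one_mul])
  have h := sum_exp_quadratic_le hμ (N := r⁻¹ • (1 : Matrix ι ι ℝ)) (by simp) n y (fun u => ?_)
    (0 : ι → ℝ)
  · simpa [hinv, smul_mulVec] using h
  · rw [sub_mulVec, smul_mulVec, smul_mulVec, one_mulVec, Matrix.sum_mulVec, dotProduct_sub,
      dotProduct_smul, dotProduct_smul, dotProduct_sum]
    have e : ∀ c, u ⬝ᵥ vecMulVec (y c) (y c) *ᵥ u = (y c ⬝ᵥ u) ^ 2 := by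
      intro c
      rw [vecMulVec_mulVec, op_smul_eq_smul, dotProduct_smul, smul_eq_mul, dotProduct_comm u, sq]
    simp only [e, smul_eq_mul]
    have h1 := hy u
    have h2 : 0 ≤ u ⬝ᵥ u := Finset.sum_nonneg fun i _ => mul_self_nonneg _
    have h3 : (2 : ℝ) ≤ (2 * r)⁻¹ := by
      rw [le_inv_comm₀ (by norm_num) (by positivity)]; linarith
    have h4 : r⁻¹ = 2 * (2 * r)⁻¹ := by field_simp
    rw [h4]
    nlinarith

/-- The fourth moment of a shifted Rademacher sum. -/
lemma sum_pow_four_le (n : ℕ) (a : Fin n → ℝ) (x : ℝ) :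
    ∑ σ : Fin n → ℤˣ, (x + ∑ c, ((σ c : ℤ) : ℝ) * a c) ^ 4
      ≤ 2 ^ n * (x ^ 4 + 6 * x ^ 2 * ∑ c, a c ^ 2 + 3 * (∑ c, a c ^ 2) ^ 2) := by
  induction n generalizing x with
  | zero => simp
  | succ n ih =>
    rw [sum_fin_cons, sum_intUnits]
    simp only [Fin.sum_univ_succ, Fin.cons_zero, Fin.cons_succ, ← add_assoc]
    refine (add_le_add (ih (fun c => a c.succ) _) (ih (fun c => a c.succ) _)).trans ?_
    set S := ∑ c : Fin n, a c.succ ^ 2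
    have hS : 0 ≤ S := Finset.sum_nonneg fun _ _ => sq_nonneg _
    simp only [Units.val_one, Int.cast_one, Units.val_neg, Int.cast_neg]
    rw [← mul_add, pow_succ (2 : ℝ) n, mul_assoc ((2 : ℝ) ^ n) 2]
    refine mul_le_mul_of_nonneg_left ?_ (by positivity : (0 : ℝ) ≤ 2 ^ n)
    nlinarith [sq_nonneg (a 0 ^ 2)]

end Rademacher

/-! ### Sparse random signs -/

/-- The weight of an atom `(b, e)`, where `b` tells whether an entry is non-zero, which has
probability `q`, and `e` is its uniformly random sign. -/
noncomputable def atomWeight (q : ℝ) (a : Bool × ℤˣ) : ℝ :=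
  (if a.1 then q else 1 - q) / 2

/-- The value of the entry described by an atom. -/
def atomValue (a : Bool × ℤˣ) : ℝ :=
  if a.1 then ((a.2 : ℤ) : ℝ) else 0

lemma atomWeight_nonneg {q : ℝ} (h0 : 0 ≤ q) (h1 : q ≤ 1) (a : Bool × ℤˣ) :
    0 ≤ atomWeight q a := by
  unfold atomWeight
  split_ifs <;> linarith

lemma sum_atomWeight (q : ℝ) : ∑ a, atomWeight q a = 1 := by
  rw [Fintype.sum_prod_type]
  simp only [Fintype.sum_bool, sum_intUnits, atomWeight]
  norm_num

/-- The vector `∑ b_c w_c` over `c ∈ T`, for the sparse random signs `b`. -/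
noncomputable def sparseSum {ι : Type*} {n : ℕ} (w : Fin n → ι → ℝ) (T : Finset (Fin n))
    (a : Fin n → Bool × ℤˣ) : ι → ℝ :=
  ∑ c ∈ T, atomValue (a c) • w c

/-- Functions of disjoint sets of independent coordinates have uncorrelated values: in the double
sum over two independent copies, exchange the coordinates outside `T`. -/
lemma sum_mul_of_disjoint_support {α κ : Type*} [Fintype κ] [DecidableEq κ] [Fintype α]
    {p : α → ℝ} (hp1 : ∑ a, p a = 1) (T : Finset κ) {F G : (κ → α) → ℝ}
    (hF : ∀ a b : κ → α, (∀ c ∈ T, a c = b c) → F a = F b)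
    (hG : ∀ a b : κ → α, (∀ c ∉ T, a c = b c) → G a = G b) :
    ∑ a : κ → α, (∏ c, p (a c)) * (F a * G a)
      = (∑ a : κ → α, (∏ c, p (a c)) * F a) * ∑ a : κ → α, (∏ c, p (a c)) * G a := by
  let mix : (κ → α) × (κ → α) → (κ → α) × (κ → α) := fun x =>
    (fun c => if c ∈ T then x.1 c else x.2 c, fun c => if c ∈ T then x.2 c else x.1 c)
  have hinv : Function.Involutive mix := by
    intro x
    ext c <;> simp only [mix] <;> split_ifs <;> rfl
  have hw : ∀ x, (∏ c, p ((mix x).1 c)) * (∏ c, p ((mix x).2 c))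
      = (∏ c, p (x.1 c)) * ∏ c, p (x.2 c) := by
    intro x
    rw [← Finset.prod_mul_distrib, ← Finset.prod_mul_distrib]
    refine Finset.prod_congr rfl fun c _ => ?_
    simp only [mix]
    split_ifs
    · rfl
    · exact mul_comm _ _
  have h1 : ∀ x : (κ → α) × (κ → α), F (mix x).1 = F x.1 := fun x =>
    hF _ _ fun c hc => by simp only [mix, if_pos hc]
  have h2 : ∀ x : (κ → α) × (κ → α), G (mix x).1 = G x.2 := fun x =>
    hG _ _ fun c hc => by simp only [mix, if_neg hc]
  rw [Finset.sum_mul_sum, ← Fintype.sum_prod_type']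
  have h3 : ∑ x : (κ → α) × (κ → α), (∏ c, p (x.1 c)) * F x.1 * ((∏ c, p (x.2 c)) * G x.2)
      = ∑ x : (κ → α) × (κ → α), (∏ c, p (x.1 c)) * (∏ c, p (x.2 c)) * (F x.1 * G x.1) := by
    refine Fintype.sum_equiv (Equiv.ofBijective mix hinv.bijective) _ _ fun x => ?_
    rw [Equiv.ofBijective_apply, hw, h1, h2]
    ring
  rw [h3, Fintype.sum_prod_type]
  refine Finset.sum_congr rfl fun a _ => ?_
  dsimp only
  rw [← Finset.sum_mul, ← Finset.mul_sum, sum_prod_weight_eq_one hp1, mul_one]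

section RowMoments

variable {ι : Type*} [Fintype ι] {n : ℕ}

/-- Given which entries are non-zero, the sum is a Rademacher sum. -/
lemma sum_signs_exp_mul_sq_le {y : Fin n → ι → ℝ}
    (hy : ∀ u : ι → ℝ, ∑ c, (y c ⬝ᵥ u) ^ 2 ≤ u ⬝ᵥ u) {r : ℝ} (hr : 0 < r) (hr8 : r ≤ 1 / 8)
    (v : ι → ℝ) :
    ∑ σ : Fin n → ℤˣ, Real.exp (r * ((∑ c, ((σ c : ℤ) : ℝ) • y c) ⬝ᵥ
        (∑ c, ((σ c : ℤ) : ℝ) • y c))) * ((∑ c, ((σ c : ℤ) : ℝ) • y c) ⬝ᵥ v) ^ 2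
      ≤ 2 ^ n * (2 * (∑ c, (y c ⬝ᵥ v) ^ 2) * Real.exp (1 / 2 * ∑ c, y c ⬝ᵥ y c)) := by
  set A := ∑ c, (y c ⬝ᵥ v) ^ 2 with hA
  have hA0 : 0 ≤ A := Finset.sum_nonneg fun _ _ => sq_nonneg _
  have hin : ∀ σ : Fin n → ℤˣ, (∑ c, ((σ c : ℤ) : ℝ) • y c) ⬝ᵥ v
      = 0 + ∑ c, ((σ c : ℤ) : ℝ) * (y c ⬝ᵥ v) := by
    intro σ
    rw [sum_dotProduct, zero_add]
    simp only [smul_dotProduct, smul_eq_mul]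
  have hyy : 0 ≤ ∑ c, y c ⬝ᵥ y c :=
    Finset.sum_nonneg fun _ _ => Finset.sum_nonneg fun _ _ => mul_self_nonneg _
  rcases hA0.eq_or_lt with h0 | hpos
  · have hz : ∀ c, y c ⬝ᵥ v = 0 := by
      intro c
      have := (Finset.sum_eq_zero_iff_of_nonneg fun c _ => sq_nonneg (y c ⬝ᵥ v)).1 h0.symm c
        (Finset.mem_univ c)
      exact pow_eq_zero_iff (two_ne_zero) |>.1 this
    simp [hin, hz, ← h0]
  · set z : (Fin n → ℤˣ) → ι → ℝ := fun σ => ∑ c, ((σ c : ℤ) : ℝ) • y c with hz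
    have hpt : ∀ σ, Real.exp (r * (z σ ⬝ᵥ z σ)) * (z σ ⬝ᵥ v) ^ 2
        ≤ (z σ ⬝ᵥ v) ^ 4 * (1 / (2 * A)) + A / 2 * Real.exp (2 * r * (z σ ⬝ᵥ z σ)) := by
      intro σ
      have e : Real.exp (2 * r * (z σ ⬝ᵥ z σ)) = Real.exp (r * (z σ ⬝ᵥ z σ)) ^ 2 := by
        rw [← Real.exp_nat_mul]; push_cast; ring_nf
      rw [e]
      set x := Real.exp (r * (z σ ⬝ᵥ z σ))
      set s := (z σ ⬝ᵥ v) ^ 2 with hs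
      have e4 : (z σ ⬝ᵥ v) ^ 4 = s ^ 2 := by rw [hs]; ring
      rw [e4]
      -- the product is split as `x s ≤ s² / (2 A) + A x² / 2`
      have : 0 ≤ (s - A * x) ^ 2 / (2 * A) := by positivity
      have e5 : (s - A * x) ^ 2 / (2 * A) = s ^ 2 * (1 / (2 * A)) + A / 2 * x ^ 2 - x * s := by
        field_simp; ring
      linarith
    refine (Finset.sum_le_sum fun σ _ => hpt σ).trans ?_
    rw [Finset.sum_add_distrib, ← Finset.sum_mul, ← Finset.mul_sum]
    have h4 := sum_pow_four_le n (fun c => y c ⬝ᵥ v) 0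
    have h2 := sum_exp_sq_norm_le hy (r := 2 * r) (by linarith) (by linarith)
    simp only [← hin] at h4
    rw [← hA] at h4
    have h5 : Real.exp (2 * (2 * r) * ∑ c, y c ⬝ᵥ y c) ≤ Real.exp (1 / 2 * ∑ c, y c ⬝ᵥ y c) :=
      Real.exp_le_exp.2 (by nlinarith)
    have h6 : 1 ≤ Real.exp (1 / 2 * ∑ c, y c ⬝ᵥ y c) := Real.one_le_exp (by positivity)
    set Q := Real.exp (1 / 2 * ∑ c, y c ⬝ᵥ y c)
    have h7 : (∑ σ, (z σ ⬝ᵥ v) ^ 4) * (1 / (2 * A)) ≤ 2 ^ n * (3 * A ^ 2) * (1 / (2 * A)) := by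
      refine mul_le_mul_of_nonneg_right (h4.trans (le_of_eq (by ring))) (by positivity)
    have e7 : 2 ^ n * (3 * A ^ 2) * (1 / (2 * A)) = 2 ^ n * (3 / 2 * A) := by
      field_simp
    have h8 : A / 2 * ∑ σ, Real.exp (2 * r * (z σ ⬝ᵥ z σ)) ≤ A / 2 * (2 ^ n * Q) := by
      refine mul_le_mul_of_nonneg_left (h2.trans ?_) (by positivity)
      exact mul_le_mul_of_nonneg_left h5 (by positivity)
    have h9 : (2 : ℝ) ^ n * (3 / 2 * A) ≤ 2 ^ n * (3 / 2 * A) * Q :=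
      le_mul_of_one_le_right (by positivity) h6
    rw [e7] at h7
    linarith

lemma dotProduct_self_le_one {w : Fin n → ι → ℝ}
    (hw : ∀ u : ι → ℝ, ∑ c, (w c ⬝ᵥ u) ^ 2 ≤ u ⬝ᵥ u) (c : Fin n) : w c ⬝ᵥ w c ≤ 1 := by
  have h1 := (Finset.single_le_sum (f := fun c' => (w c' ⬝ᵥ w c) ^ 2)
    (fun _ _ => sq_nonneg _) (Finset.mem_univ c)).trans (hw (w c))
  have h2 : 0 ≤ w c ⬝ᵥ w c := Finset.sum_nonneg fun _ _ => mul_self_nonneg _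
  nlinarith

lemma exp_three_halves_le : 2 * Real.exp (3 / 2) ≤ 10 := by
  have h : Real.exp (3 / 2) ^ 2 ≤ 25 := by
    rw [← Real.exp_nat_mul]
    have e : ((2 : ℕ) : ℝ) * (3 / 2) = ((3 : ℕ) : ℝ) * 1 := by norm_num
    rw [e, Real.exp_nat_mul]
    have h2 := Real.exp_one_lt_d9
    have h3 : Real.exp 1 ≤ 2.8 := by linarith
    calc Real.exp 1 ^ 3 ≤ 2.8 ^ 3 := by gcongr
      _ ≤ 25 := by norm_num
  nlinarith [Real.exp_pos (3 / 2)]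

/-- Exponentially weighted second moment of a sparse random sign sum. -/
lemma sum_exp_mul_sq_sparseSum_le {w : Fin n → ι → ℝ}
    (hw : ∀ u : ι → ℝ, ∑ c, (w c ⬝ᵥ u) ^ 2 ≤ u ⬝ᵥ u) {q : ℝ} (h0 : 0 ≤ q) (h1 : q ≤ 1)
    (hK : q * ∑ c, w c ⬝ᵥ w c ≤ 1) {r : ℝ} (hr : 0 < r) (hr8 : r ≤ 1 / 8) (T : Finset (Fin n))
    (v : ι → ℝ) :
    ∑ a : Fin n → Bool × ℤˣ, (∏ c, atomWeight q (a c)) *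
        (Real.exp (r * (sparseSum w T a ⬝ᵥ sparseSum w T a)) * (sparseSum w T a ⬝ᵥ v) ^ 2)
      ≤ 10 * q * ∑ c, (w c ⬝ᵥ v) ^ 2 := by
  have hww : ∀ c, 0 ≤ w c ⬝ᵥ w c := fun c => Finset.sum_nonneg fun _ _ => mul_self_nonneg _
  let pB : Bool → ℝ := fun b => if b then q else 1 - q
  have hpB : ∀ b, 0 ≤ pB b := by
    intro b; simp only [pB]; split_ifs <;> linarith
  let y : (Fin n → Bool) → Fin n → ι → ℝ := fun δ c => if c ∈ T ∧ δ c then w c else 0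
  have hsplit : ∑ a : Fin n → Bool × ℤˣ, (∏ c, atomWeight q (a c)) *
        (Real.exp (r * (sparseSum w T a ⬝ᵥ sparseSum w T a)) * (sparseSum w T a ⬝ᵥ v) ^ 2)
      = ∑ δ : Fin n → Bool, (∏ c, pB (δ c)) * ((2 ^ n)⁻¹ * ∑ σ : Fin n → ℤˣ,
        Real.exp (r * ((∑ c, ((σ c : ℤ) : ℝ) • y δ c) ⬝ᵥ (∑ c, ((σ c : ℤ) : ℝ) • y δ c)))
          * ((∑ c, ((σ c : ℤ) : ℝ) • y δ c) ⬝ᵥ v) ^ 2) := by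
    trans ∑ x : (Fin n → Bool) × (Fin n → ℤˣ), (∏ c, atomWeight q (x.1 c, x.2 c)) *
        (Real.exp (r * (sparseSum w T (fun c => (x.1 c, x.2 c)) ⬝ᵥ
          sparseSum w T (fun c => (x.1 c, x.2 c)))) *
          (sparseSum w T (fun c => (x.1 c, x.2 c)) ⬝ᵥ v) ^ 2)
    · exact Fintype.sum_equiv
        (Equiv.arrowProdEquivProdArrow (Fin n) (fun _ => Bool) (fun _ => ℤˣ)) _ _ fun a => rfl
    rw [Fintype.sum_prod_type]
    refine Finset.sum_congr rfl fun δ _ => ?_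
    rw [Finset.mul_sum, Finset.mul_sum]
    refine Finset.sum_congr rfl fun σ _ => ?_
    have e1 : ∏ c, atomWeight q (δ c, σ c) = (∏ c, pB (δ c)) * (2 ^ n)⁻¹ := by
      simp only [atomWeight, pB, div_eq_mul_inv, Finset.prod_mul_distrib, Finset.prod_const,
        Finset.card_univ, Fintype.card_fin, inv_pow]
    have e2 : sparseSum w T (fun c => (δ c, σ c)) = ∑ c, ((σ c : ℤ) : ℝ) • y δ c := by
      rw [sparseSum, ← Finset.sum_subset (Finset.subset_univ T)]
      · refine Finset.sum_congr rfl fun c hc => ?_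
        simp only [y, atomValue, hc, true_and]
        split_ifs <;> simp
      · intro c _ hc
        simp [y, hc]
    rw [e1, e2, mul_assoc]
  rw [hsplit]
  have hinner : ∀ δ : Fin n → Bool, (2 ^ n)⁻¹ * ∑ σ : Fin n → ℤˣ,
        Real.exp (r * ((∑ c, ((σ c : ℤ) : ℝ) • y δ c) ⬝ᵥ (∑ c, ((σ c : ℤ) : ℝ) • y δ c)))
          * ((∑ c, ((σ c : ℤ) : ℝ) • y δ c) ⬝ᵥ v) ^ 2
      ≤ ∑ c, 2 * (w c ⬝ᵥ v) ^ 2 * ∏ c', ((if c' = c then (if δ c' then 1 else 0) else 1) *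
          Real.exp (if δ c' then 1 / 2 * (w c' ⬝ᵥ w c') else 0)) := by
    intro δ
    have hle : ∀ (c : Fin n) (u : ι → ℝ), (y δ c ⬝ᵥ u) ^ 2 ≤ (w c ⬝ᵥ u) ^ 2 := by
      intro c u
      simp only [y]
      split_ifs
      · exact le_rfl
      · rw [zero_dotProduct, sq, mul_zero]; positivity
    have h := sum_signs_exp_mul_sq_le (y := y δ)
      (fun u => (Finset.sum_le_sum fun c _ => hle c u).trans (hw u)) hr hr8 v
    rw [inv_mul_le_iff₀ (by positivity)]
    refine h.trans (mul_le_mul_of_nonneg_left ?_ (by positivity))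
    have hE : Real.exp (1 / 2 * ∑ c, y δ c ⬝ᵥ y δ c)
        ≤ ∏ c, Real.exp (if δ c then 1 / 2 * (w c ⬝ᵥ w c) else 0) := by
      rw [← Real.exp_sum, Finset.mul_sum]
      refine Real.exp_le_exp.2 (Finset.sum_le_sum fun c _ => ?_)
      have := hww c
      by_cases hc : c ∈ T <;> by_cases hδ : δ c = true <;> simp [y, hc, hδ] <;>
        linarith
    have hA : ∑ c, (y δ c ⬝ᵥ v) ^ 2 ≤ ∑ c, (w c ⬝ᵥ v) ^ 2 * (if δ c then 1 else 0) := by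
      refine Finset.sum_le_sum fun c _ => ?_
      by_cases hc : c ∈ T <;> by_cases hδ : δ c = true <;> simp [y, hc, hδ]
      positivity
    calc 2 * (∑ c, (y δ c ⬝ᵥ v) ^ 2) * Real.exp (1 / 2 * ∑ c, y δ c ⬝ᵥ y δ c)
        ≤ 2 * (∑ c, (w c ⬝ᵥ v) ^ 2 * (if δ c then 1 else 0)) *
          ∏ c, Real.exp (if δ c then 1 / 2 * (w c ⬝ᵥ w c) else 0) := by
          gcongr
      _ = _ := by
          rw [Finset.mul_sum, Finset.sum_mul]
          refine Finset.sum_congr rfl fun c _ => ?_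
          rw [Finset.prod_mul_distrib, Finset.prod_ite_eq' Finset.univ c]
          simp only [Finset.mem_univ, if_true]
          ring
  refine (Finset.sum_le_sum fun δ _ =>
    mul_le_mul_of_nonneg_left (hinner δ) (Finset.prod_nonneg fun c _ => hpB _)).trans ?_
  simp only [Finset.mul_sum]
  rw [Finset.sum_comm]
  refine Finset.sum_le_sum fun c _ => ?_
  have e : ∀ δ : Fin n → Bool, (∏ c', pB (δ c')) * (2 * (w c ⬝ᵥ v) ^ 2 *
        ∏ c', ((if c' = c then (if δ c' then 1 else 0) else 1) *
          Real.exp (if δ c' then 1 / 2 * (w c' ⬝ᵥ w c') else 0)))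
      = 2 * (w c ⬝ᵥ v) ^ 2 * ∏ c', (pB (δ c') * ((if c' = c then (if δ c' then 1 else 0) else 1) *
          Real.exp (if δ c' then 1 / 2 * (w c' ⬝ᵥ w c') else 0))) := by
    intro δ
    rw [Finset.prod_mul_distrib (f := fun c' => pB (δ c'))]
    ring
  simp only [e]
  rw [← Finset.mul_sum, sum_prod_weight fun c' b => pB b * ((if c' = c then (if b then 1 else 0)
    else 1) * Real.exp (if b then 1 / 2 * (w c' ⬝ᵥ w c') else 0))]
  have hfac : ∀ c', ∑ b : Bool, pB b * ((if c' = c then (if b then 1 else 0)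
      else 1) * Real.exp (if b then 1 / 2 * (w c' ⬝ᵥ w c') else 0))
      ≤ (if c' = c then q * Real.exp (1 / 2) else 1) * Real.exp (q * (w c' ⬝ᵥ w c')) := by
    intro c'
    have hle1 := dotProduct_self_le_one hw c'
    have hge0 := hww c'
    set x := w c' ⬝ᵥ w c'
    have hq1 : 1 ≤ Real.exp (q * x) := Real.one_le_exp (by positivity)
    simp only [Fintype.sum_bool, pB]
    by_cases hc : c' = c
    · simp only [hc, if_true]
      have h3 : Real.exp (1 / 2 * x) ≤ Real.exp (1 / 2) := Real.exp_le_exp.2 (by linarith)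
      have h4 : q * Real.exp (1 / 2 * x) ≤ q * Real.exp (1 / 2) :=
        mul_le_mul_of_nonneg_left h3 h0
      have h5 : q * Real.exp (1 / 2) ≤ q * Real.exp (1 / 2) * Real.exp (q * x) :=
        le_mul_of_one_le_right (by positivity) hq1
      simp
      linarith
    · simp only [hc, if_false, if_true, one_mul]
      have h3 : Real.exp (1 / 2 * x) ≤ 1 + x := by
        have := Real.abs_exp_sub_one_sub_id_le (x := 1 / 2 * x)
          (by rw [abs_of_nonneg (by positivity)]; linarith)
        have := (le_abs_self _).trans this
        nlinarith
      have h4 := Real.add_one_le_exp (q * x)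
      simp
      nlinarith
  have hprod := Finset.prod_le_prod (s := Finset.univ) (fun c' _ =>
    Finset.sum_nonneg fun b _ => mul_nonneg (hpB b) (mul_nonneg (by split_ifs <;> norm_num)
      (Real.exp_pos (if b then 1 / 2 * (w c' ⬝ᵥ w c') else 0)).le)) (fun c' _ => hfac c')
  rw [Finset.prod_mul_distrib, Finset.prod_ite_eq' Finset.univ c, ← Real.exp_sum,
    ← Finset.mul_sum] at hprod
  simp only [Finset.mem_univ, if_true] at hprod
  have h6 : q * Real.exp (1 / 2) * Real.exp (q * ∑ c, w c ⬝ᵥ w c) ≤ q * Real.exp (3 / 2) := by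
    rw [mul_assoc, ← Real.exp_add]
    exact mul_le_mul_of_nonneg_left (Real.exp_le_exp.2 (by linarith)) h0
  have h7 := mul_le_mul_of_nonneg_left (hprod.trans h6)
    (by positivity : 0 ≤ 2 * (w c ⬝ᵥ v) ^ 2)
  refine h7.trans ?_
  have h8 := mul_le_mul_of_nonneg_left exp_three_halves_le
    (by positivity : 0 ≤ q * (w c ⬝ᵥ v) ^ 2)
  linarith

end RowMoments

section RowBernstein

variable {ι : Type*} {n : ℕ}

/-- The decoupled contribution of one row of the sketch: `z` collects the columns in `T` and `z'`
the others, so that `z` and `z'` are independent. -/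
noncomputable def rowMatrix (x : ℝ) (w : Fin n → ι → ℝ) (T : Finset (Fin n))
    (a : Fin n → Bool × ℤˣ) : Matrix ι ι ℝ :=
  x • (vecMulVec (sparseSum w T a) (sparseSum w Tᶜ a)
    + vecMulVec (sparseSum w Tᶜ a) (sparseSum w T a))

lemma rowMatrix_transpose (x : ℝ) (w : Fin n → ι → ℝ) (T : Finset (Fin n))
    (a : Fin n → Bool × ℤˣ) : (rowMatrix x w T a)ᵀ = rowMatrix x w T a := by
  rw [rowMatrix, transpose_smul, transpose_add, transpose_vecMulVec, transpose_vecMulVec, add_comm]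

lemma sparseSum_congr (w : Fin n → ι → ℝ) (T : Finset (Fin n)) {a b : Fin n → Bool × ℤˣ}
    (h : ∀ c ∈ T, a c = b c) : sparseSum w T a = sparseSum w T b :=
  Finset.sum_congr rfl fun c hc => by rw [h c hc]

lemma dotProduct_vecMulVec_mulVec [Fintype ι] (a b u v : ι → ℝ) :
    u ⬝ᵥ vecMulVec a b *ᵥ v = (a ⬝ᵥ u) * (b ⬝ᵥ v) := by
  rw [vecMulVec_mulVec, op_smul_eq_smul, dotProduct_smul, smul_eq_mul, dotProduct_comm u, mul_comm]

lemma sum_smul_rowMatrix (q x : ℝ) (w : Fin n → ι → ℝ) (T : Finset (Fin n)) :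
    ∑ a : Fin n → Bool × ℤˣ, (∏ c, atomWeight q (a c)) • rowMatrix x w T a = 0 := by
  -- flipping the signs of the columns in `T` preserves the weights and negates the matrix
  let f : (Fin n → Bool × ℤˣ) → Fin n → Bool × ℤˣ := fun a c =>
    if c ∈ T then ((a c).1, -(a c).2) else a c
  have hf : Function.Involutive f := by
    intro a
    funext c
    simp only [f]
    split_ifs <;> simp
  have hw : ∀ a, ∏ c, atomWeight q (f a c) = ∏ c, atomWeight q (a c) := by
    intro a
    refine Finset.prod_congr rfl fun c _ => ?_
    simp only [f]
    split_ifs <;> rfl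
  have h1 : ∀ a, sparseSum w T (f a) = -sparseSum w T a := by
    intro a
    rw [sparseSum, sparseSum, ← Finset.sum_neg_distrib]
    refine Finset.sum_congr rfl fun c hc => ?_
    simp only [f, hc, if_true, atomValue]
    split_ifs <;> simp
  have h2 : ∀ a, sparseSum w Tᶜ (f a) = sparseSum w Tᶜ a := by
    intro a
    refine sparseSum_congr w _ fun c hc => ?_
    simp only [f, if_neg (Finset.mem_compl.1 hc)]
  have h3 : ∀ a, rowMatrix x w T (f a) = -rowMatrix x w T a := by
    intro a
    rw [rowMatrix, rowMatrix, h1, h2, neg_vecMulVec, vecMulVec_neg, ← neg_add, smul_neg]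
  have h4 : ∑ a, (∏ c, atomWeight q (a c)) • rowMatrix x w T a
      = -∑ a, (∏ c, atomWeight q (a c)) • rowMatrix x w T a := by
    rw [← Finset.sum_neg_distrib]
    refine Fintype.sum_equiv (Equiv.ofBijective f hf.bijective) _ _ fun a => ?_
    rw [Equiv.ofBijective_apply, hw, h3, smul_neg, neg_neg]
  ext i j
  have := congrFun (congrFun h4 i) j
  rw [neg_apply] at this
  rw [Matrix.zero_apply]
  linarith

variable [Fintype ι] [DecidableEq ι]

lemma dotProduct_sum_smul_exp_rowMatrix_le {w : Fin n → ι → ℝ}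
    (hw : ∀ u : ι → ℝ, ∑ c, (w c ⬝ᵥ u) ^ 2 ≤ u ⬝ᵥ u) {q : ℝ} (h0 : 0 ≤ q) (h1 : q ≤ 1)
    (hK : q * ∑ c, w c ⬝ᵥ w c ≤ 1) {x : ℝ} (hx : 0 < |x|) (hx8 : |x| ≤ 1 / 8)
    (T : Finset (Fin n)) (u : ι → ℝ) :
    u ⬝ᵥ (∑ a : Fin n → Bool × ℤˣ, (∏ c, atomWeight q (a c)) •
        NormedSpace.exp (rowMatrix x w T a)) *ᵥ u
      ≤ u ⬝ᵥ u + 400 * x ^ 2 * q ^ 2 * (∑ c, w c ⬝ᵥ w c) * ∑ c, (w c ⬝ᵥ u) ^ 2 := by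
  set P : (Fin n → Bool × ℤˣ) → ℝ := fun a => ∏ c, atomWeight q (a c) with hP
  have hP0 : ∀ a, 0 ≤ P a := fun a => Finset.prod_nonneg fun c _ => atomWeight_nonneg h0 h1 _
  have hP1 : ∑ a, P a = 1 := sum_prod_weight_eq_one (sum_atomWeight q)
  set r := |x| with hr
  have hself : ∀ z : ι → ℝ, 0 ≤ z ⬝ᵥ z := fun z => Finset.sum_nonneg fun _ _ => mul_self_nonneg _
  have hcs : ∀ a b : ι → ℝ, (a ⬝ᵥ b) ^ 2 ≤ (a ⬝ᵥ a) * (b ⬝ᵥ b) := by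
    intro a b
    have := Finset.sum_mul_sq_le_sq_mul_sq Finset.univ a b
    simpa only [dotProduct, sq] using this
  -- the exponentially weighted second moments over the two halves
  let E : Finset (Fin n) → (Fin n → Bool × ℤˣ) → ℝ := fun S a =>
    Real.exp (r * (sparseSum w S a ⬝ᵥ sparseSum w S a))
  let Q : Finset (Fin n) → (ι → ℝ) → (Fin n → Bool × ℤˣ) → ℝ := fun S v a =>
    E S a * (sparseSum w S a ⬝ᵥ v) ^ 2
  let N : Finset (Fin n) → (Fin n → Bool × ℤˣ) → ℝ := fun S a =>
    E S a * (sparseSum w S a ⬝ᵥ sparseSum w S a)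
  have hpt : ∀ a, u ⬝ᵥ NormedSpace.exp (rowMatrix x w T a) *ᵥ u
      ≤ u ⬝ᵥ u + u ⬝ᵥ rowMatrix x w T a *ᵥ u
        + 2 * x ^ 2 * (N T a * Q Tᶜ u a + Q T u a * N Tᶜ a) := by
    intro a
    set z := sparseSum w T a with hz
    set z' := sparseSum w Tᶜ a with hz'
    have hq : ∀ v, |v ⬝ᵥ rowMatrix x w T a *ᵥ v| ≤ (r * (z ⬝ᵥ z) + r * (z' ⬝ᵥ z')) * (v ⬝ᵥ v) := by
      intro v
      rw [rowMatrix, smul_mulVec, add_mulVec, dotProduct_smul, dotProduct_add,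
        dotProduct_vecMulVec_mulVec, dotProduct_vecMulVec_mulVec, smul_eq_mul, abs_mul, ← hr,
        ← mul_add, mul_assoc]
      refine mul_le_mul_of_nonneg_left ?_ hx.le
      rw [← hz, ← hz']
      have e1 := hcs z v
      have e2 := hcs z' v
      rw [abs_le]
      constructor <;> nlinarith [sq_nonneg (z ⬝ᵥ v + z' ⬝ᵥ v), sq_nonneg (z ⬝ᵥ v - z' ⬝ᵥ v)]
    have h := dotProduct_exp_le (rowMatrix_transpose x w T a) hq u
    have hEE : Real.exp (r * (z ⬝ᵥ z) + r * (z' ⬝ᵥ z')) = E T a * E Tᶜ a := Real.exp_add _ _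
    rw [hEE] at h
    have hX : rowMatrix x w T a *ᵥ u ⬝ᵥ rowMatrix x w T a *ᵥ u
        ≤ 2 * x ^ 2 * ((z ⬝ᵥ z) * (z' ⬝ᵥ u) ^ 2 + (z ⬝ᵥ u) ^ 2 * (z' ⬝ᵥ z')) := by
      have e : rowMatrix x w T a *ᵥ u = x • ((z' ⬝ᵥ u) • z + (z ⬝ᵥ u) • z') := by
        rw [rowMatrix, smul_mulVec, add_mulVec, vecMulVec_mulVec, vecMulVec_mulVec,
          op_smul_eq_smul, op_smul_eq_smul]
      rw [e]
      have h2 := hself ((z' ⬝ᵥ u) • z - (z ⬝ᵥ u) • z')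
      simp only [smul_dotProduct, dotProduct_smul, add_dotProduct, dotProduct_add, sub_dotProduct,
        dotProduct_sub, smul_eq_mul, dotProduct_comm z' z] at h2 ⊢
      have h3 := mul_nonneg (sq_nonneg x) h2
      linarith
    have hE0 : 0 ≤ E T a * E Tᶜ a := mul_nonneg (Real.exp_pos _).le (Real.exp_pos _).le
    have h5 := mul_le_mul_of_nonneg_left hX hE0
    have e5 : E T a * E Tᶜ a * (2 * x ^ 2 * ((z ⬝ᵥ z) * (z' ⬝ᵥ u) ^ 2 + (z ⬝ᵥ u) ^ 2 * (z' ⬝ᵥ z')))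
        = 2 * x ^ 2 * (N T a * Q Tᶜ u a + Q T u a * N Tᶜ a) := by
      simp only [N, Q, ← hz, ← hz']
      ring
    linarith
  have hQ : ∀ S v, ∑ a, P a * Q S v a ≤ 10 * q * ∑ c, (w c ⬝ᵥ v) ^ 2 := fun S v =>
    sum_exp_mul_sq_sparseSum_le hw h0 h1 hK hx hx8 S v
  have hQ0 : ∀ S v, 0 ≤ ∑ a, P a * Q S v a := fun S v => Finset.sum_nonneg fun a _ =>
    mul_nonneg (hP0 a) (mul_nonneg (Real.exp_pos _).le (sq_nonneg _))
  have hbasis : ∀ z : ι → ℝ, ∑ i, (z ⬝ᵥ Pi.single i 1) ^ 2 = z ⬝ᵥ z := by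
    intro z
    simp only [dotProduct_single, mul_one]
    exact Finset.sum_congr rfl fun i _ => sq (z i)
  have hN : ∀ S, ∑ a, P a * N S a ≤ 10 * q * ∑ c, w c ⬝ᵥ w c := by
    intro S
    have e : ∑ a, P a * N S a = ∑ i, ∑ a, P a * Q S (Pi.single i 1) a := by
      rw [Finset.sum_comm]
      refine Finset.sum_congr rfl fun a _ => ?_
      simp only [N, Q]
      rw [← Finset.mul_sum, ← Finset.mul_sum, hbasis]
    rw [e]
    refine (Finset.sum_le_sum fun i _ => hQ S (Pi.single i 1)).trans (le_of_eq ?_)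
    rw [← Finset.mul_sum, Finset.sum_comm]
    simp only [hbasis]
  have hN0 : ∀ S, 0 ≤ ∑ a, P a * N S a := fun S => Finset.sum_nonneg fun a _ =>
    mul_nonneg (hP0 a) (mul_nonneg (Real.exp_pos _).le (hself _))
  have hc1 : ∀ a b : Fin n → Bool × ℤˣ, (∀ c ∈ T, a c = b c) →
      sparseSum w T a = sparseSum w T b := fun a b h => sparseSum_congr w T h
  have hc2 : ∀ a b : Fin n → Bool × ℤˣ, (∀ c ∉ T, a c = b c) →
      sparseSum w Tᶜ a = sparseSum w Tᶜ b := fun a b h =>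
    sparseSum_congr w _ fun c hc => h c (Finset.mem_compl.1 hc)
  have hI1 : ∑ a, P a * (N T a * Q Tᶜ u a) = (∑ a, P a * N T a) * ∑ a, P a * Q Tᶜ u a :=
    sum_mul_of_disjoint_support (sum_atomWeight q) T
      (fun a b h => by simp only [N, E, hc1 a b h]) (fun a b h => by simp only [Q, E, hc2 a b h])
  have hI2 : ∑ a, P a * (Q T u a * N Tᶜ a) = (∑ a, P a * Q T u a) * ∑ a, P a * N Tᶜ a :=
    sum_mul_of_disjoint_support (sum_atomWeight q) T
      (fun a b h => by simp only [Q, E, hc1 a b h]) (fun a b h => by simp only [N, E, hc2 a b h])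
  have hX0 : ∑ a, P a * (u ⬝ᵥ rowMatrix x w T a *ᵥ u) = 0 := by
    have := congrArg (fun M => u ⬝ᵥ M *ᵥ u) (sum_smul_rowMatrix q x w T)
    simpa only [Matrix.sum_mulVec, dotProduct_sum, smul_mulVec, dotProduct_smul, smul_eq_mul,
      zero_mulVec, dotProduct_zero] using this
  have hL : u ⬝ᵥ (∑ a, P a • NormedSpace.exp (rowMatrix x w T a)) *ᵥ u
      = ∑ a, P a * (u ⬝ᵥ NormedSpace.exp (rowMatrix x w T a) *ᵥ u) := by
    simp only [Matrix.sum_mulVec, dotProduct_sum, smul_mulVec, dotProduct_smul, smul_eq_mul]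
  rw [hL]
  refine (Finset.sum_le_sum fun a _ => mul_le_mul_of_nonneg_left (hpt a) (hP0 a)).trans ?_
  have e : ∑ a, P a * (u ⬝ᵥ u + u ⬝ᵥ rowMatrix x w T a *ᵥ u
        + 2 * x ^ 2 * (N T a * Q Tᶜ u a + Q T u a * N Tᶜ a))
      = (∑ a, P a) * (u ⬝ᵥ u) + ∑ a, P a * (u ⬝ᵥ rowMatrix x w T a *ᵥ u)
        + 2 * x ^ 2 * (∑ a, P a * (N T a * Q Tᶜ u a) + ∑ a, P a * (Q T u a * N Tᶜ a)) := by
    rw [Finset.sum_mul]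
    simp only [mul_add, Finset.sum_add_distrib, Finset.mul_sum]
    congr 1
    congr 1 <;> exact Finset.sum_congr rfl fun a _ => by ring
  rw [e, hP1, hX0, hI1, hI2]
  have hSK : 0 ≤ ∑ c, w c ⬝ᵥ w c := Finset.sum_nonneg fun c _ => hself _
  have hSu : 0 ≤ ∑ c, (w c ⬝ᵥ u) ^ 2 := Finset.sum_nonneg fun c _ => sq_nonneg _
  have g1 := mul_le_mul (hN T) (hQ Tᶜ u) (hQ0 _ _) (by positivity)
  have g2 := mul_le_mul (hQ T u) (hN Tᶜ) (hN0 _) (by positivity)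
  have g3 := mul_le_mul_of_nonneg_left (add_le_add g1 g2) (by positivity : 0 ≤ 2 * x ^ 2)
  linarith

/-- The trace exponential moment of the decoupled sketch with independent sparse random signs. -/
theorem sum_trace_exp_rowMatrix_le {w : Fin n → ι → ℝ}
    (hw : ∀ u : ι → ℝ, ∑ c, (w c ⬝ᵥ u) ^ 2 ≤ u ⬝ᵥ u) {q : ℝ} (h0 : 0 ≤ q) (h1 : q ≤ 1)
    (hK : q * ∑ c, w c ⬝ᵥ w c ≤ 1) {x : ℝ} (hx : 0 < |x|) (hx8 : |x| ≤ 1 / 8)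
    (T : Finset (Fin n)) (m : ℕ) :
    ∑ b : Fin m → Fin n → Bool × ℤˣ, (∏ r, ∏ c, atomWeight q (b r c)) *
        trace (NormedSpace.exp (∑ r, rowMatrix x w T (b r)))
      ≤ Fintype.card ι + (∑ c, w c ⬝ᵥ w c) *
        ((1 + 400 * x ^ 2 * q ^ 2 * ∑ c, w c ⬝ᵥ w c) ^ m - 1) := by
  have hSK : 0 ≤ ∑ c, w c ⬝ᵥ w c :=
    Finset.sum_nonneg fun c _ => Finset.sum_nonneg fun _ _ => mul_self_nonneg _
  have hquad := dotProduct_sum_smul_exp_rowMatrix_le hw h0 h1 hK hx hx8 T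
  refine sum_trace_exp_le (p := fun a : Fin n → Bool × ℤˣ => ∏ c, atomWeight q (a c))
    (fun a => Finset.prod_nonneg fun c _ => atomWeight_nonneg h0 h1 _)
    (sum_prod_weight_eq_one (sum_atomWeight q)) (rowMatrix_transpose x w T)
    (sum_smul_rowMatrix q x w T) (by positivity) (fun u => ?_) ?_ m
  · refine (hquad u).trans ?_
    have := mul_le_mul_of_nonneg_left (hw u)
      (by positivity : 0 ≤ 400 * x ^ 2 * q ^ 2 * ∑ c, w c ⬝ᵥ w c)
    linarith
  · have htr : ∀ M : Matrix ι ι ℝ, trace M = ∑ i, Pi.single i 1 ⬝ᵥ M *ᵥ Pi.single i 1 := by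
      intro M
      simp [trace]
    rw [htr]
    refine (Finset.sum_le_sum fun i _ => hquad (Pi.single i 1)).trans (le_of_eq ?_)
    rw [Finset.sum_add_distrib, ← Finset.mul_sum, Finset.sum_comm]
    have hbasis : ∀ z : ι → ℝ, ∑ i, (z ⬝ᵥ Pi.single i 1) ^ 2 = z ⬝ᵥ z := by
      intro z
      simp only [dotProduct_single, mul_one]
      exact Finset.sum_congr rfl fun i _ => sq (z i)
    simp only [hbasis]
    simp
    ring

end RowBernstein

/-! ### Comparison of sketch columns with independent entries -/

/-- The column of a sketch, before normalisation, with the entry `y.2 i` in the row `y.1 i` for each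
`i` and zeros elsewhere. -/
def sketchCol {m s : ℕ} (y : (Fin s ↪ Fin m) × (Fin s → ℤˣ)) (r : Fin m) : ℝ :=
  ∑ i, if y.1 i = r then ((y.2 i : ℤ) : ℝ) else 0

/-- The action of a signed permutation on vectors. -/
def signedPerm {m : ℕ} (π : Equiv.Perm (Fin m)) (e : Fin m → ℤˣ) (x : Fin m → ℝ) : Fin m → ℝ :=
  fun r => ((e r : ℤ) : ℝ) * x (π r)

/-- The sum of `g` over the orbit of `x` under all signed permutations. -/
noncomputable def orbitSum {m : ℕ} (g : (Fin m → ℝ) → ℝ) (x : Fin m → ℝ) : ℝ :=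
  ∑ π : Equiv.Perm (Fin m), ∑ e : Fin m → ℤˣ, g (signedPerm π e x)

lemma orbitSum_signedPerm {m : ℕ} (g : (Fin m → ℝ) → ℝ) (π₀ : Equiv.Perm (Fin m))
    (e₀ : Fin m → ℤˣ) (x : Fin m → ℝ) :
    orbitSum g (signedPerm π₀ e₀ x) = orbitSum g x := by
  refine Fintype.sum_equiv (Equiv.mulLeft π₀) _ _ fun π => ?_
  refine Fintype.sum_equiv (Equiv.mulRight fun r => e₀ (π r)) _ _ fun e => ?_
  congr 1
  funext r
  simp only [signedPerm, Equiv.coe_mulLeft, Equiv.coe_mulRight, Pi.mul_apply, Equiv.Perm.mul_apply]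
  push_cast
  ring

lemma sketchCol_apply {m s : ℕ} (y : (Fin s ↪ Fin m) × (Fin s → ℤˣ)) (i : Fin s) :
    sketchCol y (y.1 i) = ((y.2 i : ℤ) : ℝ) := by
  rw [sketchCol, Finset.sum_eq_single i]
  · simp
  · intro j _ hj
    rw [if_neg fun h => hj (y.1.injective h)]
  · simp

lemma sketchCol_of_notMem {m s : ℕ} (y : (Fin s ↪ Fin m) × (Fin s → ℤˣ)) {r : Fin m}
    (hr : ∀ i, y.1 i ≠ r) : sketchCol y r = 0 :=
  Finset.sum_eq_zero fun i _ => if_neg (hr i)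

/-- The possible sketch columns form a single orbit under signed permutations. -/
lemma exists_signedPerm_sketchCol {m s : ℕ} (y y₀ : (Fin s ↪ Fin m) × (Fin s → ℤˣ)) :
    ∃ π e, sketchCol y = signedPerm π e (sketchCol y₀) := by
  have hpre : MulAction.IsPretransitive (Equiv.Perm (Fin m)) (Fin s ↪ Fin m) :=
    Equiv.Perm.isMultiplyPretransitive (Fin m) s
  obtain ⟨π, hπ⟩ : ∃ π : Equiv.Perm (Fin m), π • y.1 = y₀.1 :=
    MulAction.exists_smul_eq (Equiv.Perm (Fin m)) y.1 y₀.1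
  have hπ' : ∀ i, π (y.1 i) = y₀.1 i := fun i => by rw [← hπ]; rfl
  refine ⟨π, Function.extend y.1 (fun i => y.2 i * y₀.2 i) 1, ?_⟩
  funext r
  by_cases hr : ∃ i, y.1 i = r
  · obtain ⟨i, rfl⟩ := hr
    rw [signedPerm, hπ', sketchCol_apply, sketchCol_apply, y.1.injective.extend_apply]
    have h : ((y₀.2 i : ℤ) : ℝ) * ((y₀.2 i : ℤ) : ℝ) = 1 := by
      rcases Int.units_eq_one_or (y₀.2 i) with h | h <;> simp [h]
    push_cast
    rw [mul_assoc, h, mul_one]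
  · push Not at hr
    rw [signedPerm, sketchCol_of_notMem y hr, sketchCol_of_notMem y₀, mul_zero]
    intro i hi
    rw [← hπ'] at hi
    exact hr i (π.injective hi)

/-- The law of a sketch column is invariant under signed permutations of the rows. -/
lemma sum_orbitSum_sketchCol {m s : ℕ} (g : (Fin m → ℝ) → ℝ) :
    ∑ y : (Fin s ↪ Fin m) × (Fin s → ℤˣ), orbitSum g (sketchCol y)
      = (Fintype.card (Equiv.Perm (Fin m)) * Fintype.card (Fin m → ℤˣ) : ℝ) *
        ∑ y : (Fin s ↪ Fin m) × (Fin s → ℤˣ), g (sketchCol y) := by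
  simp only [orbitSum]
  rw [Finset.sum_comm]
  have h : ∀ (π : Equiv.Perm (Fin m)) (e : Fin m → ℤˣ),
      ∑ y : (Fin s ↪ Fin m) × (Fin s → ℤˣ), g (signedPerm π e (sketchCol y))
        = ∑ y : (Fin s ↪ Fin m) × (Fin s → ℤˣ), g (sketchCol y) := by
    intro π e
    rw [Fintype.sum_prod_type, Fintype.sum_prod_type]
    refine Fintype.sum_equiv (Equiv.embeddingCongr (Equiv.refl _) π.symm) _ _ fun ρ => ?_
    refine Fintype.sum_equiv (Equiv.mulLeft fun i => e (π.symm (ρ i))) _ _ fun σ => ?_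
    congr 1
    funext r
    simp only [signedPerm, sketchCol, Finset.mul_sum]
    refine Finset.sum_congr rfl fun i _ => ?_
    have hiff : (Equiv.embeddingCongr (Equiv.refl (Fin s)) π.symm ρ) i = π.symm (ρ i) := rfl
    simp only [hiff, Equiv.symm_apply_eq]
    split_ifs with hc
    · simp only [Equiv.coe_mulLeft, Pi.mul_apply, hc, Equiv.symm_apply_apply]
      push_cast
      rfl
    · simp
  simp only [Finset.sum_comm (s := (Finset.univ : Finset ((Fin s ↪ Fin m) × (Fin s → ℤˣ)))), h]
  simp only [Finset.sum_const, Finset.card_univ, nsmul_eq_mul]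
  ring

/-- The law of a vector of independent sparse signs is invariant under signed permutations. -/
lemma sum_orbitSum_atomValue {m : ℕ} (q : ℝ) (g : (Fin m → ℝ) → ℝ) :
    ∑ a : Fin m → Bool × ℤˣ, (∏ r, atomWeight q (a r)) *
        orbitSum g (fun r => 2 * atomValue (a r))
      = (Fintype.card (Equiv.Perm (Fin m)) * Fintype.card (Fin m → ℤˣ) : ℝ) *
        ∑ a : Fin m → Bool × ℤˣ, (∏ r, atomWeight q (a r)) *
          g (fun r => 2 * atomValue (a r)) := by
  simp only [orbitSum, Finset.mul_sum]
  rw [Finset.sum_comm]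
  have h : ∀ (π : Equiv.Perm (Fin m)) (e : Fin m → ℤˣ),
      ∑ a : Fin m → Bool × ℤˣ, (∏ r, atomWeight q (a r)) *
          g (signedPerm π e (fun r => 2 * atomValue (a r)))
        = ∑ a : Fin m → Bool × ℤˣ, (∏ r, atomWeight q (a r)) *
          g (fun r => 2 * atomValue (a r)) := by
    intro π e
    let f : (Fin m → Bool × ℤˣ) → Fin m → Bool × ℤˣ := fun a r =>
      ((a (π r)).1, e r * (a (π r)).2)
    have hf : Function.Injective f := by
      intro a b hab
      funext r
      have h1 := congrFun hab (π.symm r)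
      simp only [f, Equiv.apply_symm_apply, Prod.mk.injEq, mul_right_inj] at h1
      exact Prod.ext h1.1 h1.2
    refine Fintype.sum_equiv (Equiv.ofBijective f (Finite.injective_iff_bijective.1 hf)) _ _
      fun a => ?_
    rw [Equiv.ofBijective_apply]
    have e1 : ∏ r, atomWeight q (f a r) = ∏ r, atomWeight q (a r) :=
      Equiv.prod_comp π fun r => atomWeight q (a r)
    rw [e1]
    congr 2
    funext r
    simp only [signedPerm, f, atomValue]
    split_ifs
    · push_cast; ring
    · simp
  simp only [Finset.sum_comm (s := (Finset.univ : Finset (Fin m → Bool × ℤˣ))), h]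
  simp only [Finset.sum_const, Finset.card_univ, nsmul_eq_mul, ← Finset.mul_sum]
  ring

/-- Removing entries from a vector can only decrease the orbit sum of a convex function, since the
smaller vector is the mean of two vectors in the orbit of the larger one. -/
lemma orbitSum_le_of_flip {m : ℕ} {g : (Fin m → ℝ) → ℝ} (hg : ConvexOn ℝ Set.univ g)
    {x u : Fin m → ℝ} (e₀ : Fin m → ℤˣ)
    (h : ∀ r, 2 * u r = x r + ((e₀ r : ℤ) : ℝ) * x r) : orbitSum g u ≤ orbitSum g x := by
  have h1 : orbitSum g (signedPerm 1 e₀ x) = orbitSum g x := orbitSum_signedPerm g 1 e₀ x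
  have h2 : orbitSum g u ≤ 1 / 2 * orbitSum g x + 1 / 2 * orbitSum g (signedPerm 1 e₀ x) := by
    simp only [orbitSum, Finset.mul_sum, ← Finset.sum_add_distrib]
    refine Finset.sum_le_sum fun π _ => Finset.sum_le_sum fun e _ => ?_
    have e1 : signedPerm π e u = (1 / 2 : ℝ) • signedPerm π e x
        + (1 / 2 : ℝ) • signedPerm π e (signedPerm 1 e₀ x) := by
      funext r
      simp only [signedPerm, Pi.add_apply, Pi.smul_apply, smul_eq_mul, Equiv.Perm.one_apply]
      have := h (π r)
      linear_combination (((e r : ℤ) : ℝ) / 2) * this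
    rw [e1]
    exact hg.2 (Set.mem_univ _) (Set.mem_univ _) (by norm_num) (by norm_num) (by norm_num)
  linarith

/-- The binomial law with mean `4 s` is at least `s` with probability at least one half. -/
lemma half_le_sum_card_support {m s : ℕ} {q : ℝ} (h0 : 0 ≤ q) (h1 : q ≤ 1)
    (hq : q * m = 4 * s) :
    1 / 2 ≤ ∑ a : Fin m → Bool × ℤˣ, (∏ r, atomWeight q (a r)) *
      (if s ≤ (Finset.univ.filter fun r => (a r).1 = true).card then 1 else 0) := by
  have hw0 : ∀ a : Fin m → Bool × ℤˣ, 0 ≤ ∏ r, atomWeight q (a r) := fun a =>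
    Finset.prod_nonneg fun r _ => atomWeight_nonneg h0 h1 _
  -- Markov's inequality for `2 ^ (-N)`, where `N` is the number of non-zero entries
  have hpt : ∀ a : Fin m → Bool × ℤˣ,
      1 - (2 : ℝ) ^ s / 2 * ∏ r, (if (a r).1 = true then (1 / 2 : ℝ) else 1)
        ≤ if s ≤ (Finset.univ.filter fun r => (a r).1 = true).card then 1 else 0 := by
    intro a
    rw [Finset.prod_ite, Finset.prod_const, Finset.prod_const_one, mul_one]
    split_ifs with h
    · have : (0 : ℝ) ≤ 2 ^ s / 2 * (1 / 2) ^
        (Finset.univ.filter fun r => (a r).1 = true).card := by positivity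
      linarith
    · push Not at h
      set j := (Finset.univ.filter fun r => (a r).1 = true).card
      obtain ⟨i, rfl⟩ := Nat.exists_eq_add_of_lt h
      have e : (2 : ℝ) ^ (j + i + 1) / 2 * (1 / 2) ^ j = 2 ^ i := by
        rw [one_div, inv_pow, pow_succ, pow_add]
        field_simp
      rw [e]
      have := one_le_pow₀ (one_le_two (α := ℝ)) (n := i)
      linarith
  have hexp : ∑ a : Fin m → Bool × ℤˣ, (∏ r, atomWeight q (a r)) *
      ∏ r, (if (a r).1 = true then (1 / 2 : ℝ) else 1) = (1 - q / 2) ^ m := by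
    simp only [← Finset.prod_mul_distrib]
    rw [sum_prod_weight fun _ (x : Bool × ℤˣ) =>
      atomWeight q x * (if x.1 = true then (1 / 2 : ℝ) else 1)]
    rw [Finset.prod_const, Finset.card_univ, Fintype.card_fin, Fintype.sum_prod_type]
    simp only [Fintype.sum_bool, sum_intUnits, atomWeight]
    norm_num
    congr 1
    ring
  have h2 : (1 - q / 2) ^ m ≤ Real.exp (-2) ^ s := by
    have h3 : 1 - q / 2 ≤ Real.exp (-(q / 2)) := by linarith [Real.add_one_le_exp (-(q / 2))]
    calc (1 - q / 2) ^ m ≤ Real.exp (-(q / 2)) ^ m := pow_le_pow_left₀ (by linarith) h3 m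
      _ = Real.exp (-2) ^ s := by
        rw [← Real.exp_nat_mul, ← Real.exp_nat_mul]
        congr 1
        linarith
  have h4 : (2 : ℝ) ^ s * Real.exp (-2) ^ s ≤ 1 := by
    rw [← mul_pow]
    refine pow_le_one₀ (by positivity) ?_
    rw [Real.exp_neg, ← div_eq_mul_inv, div_le_one (Real.exp_pos 2)]
    linarith [Real.add_one_le_exp (2 : ℝ)]
  calc (1 : ℝ) / 2 ≤ 1 - 2 ^ s / 2 * (1 - q / 2) ^ m := by
        have := mul_le_mul_of_nonneg_left h2 (by positivity : (0 : ℝ) ≤ 2 ^ s / 2)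
        linarith
    _ = ∑ a : Fin m → Bool × ℤˣ, (∏ r, atomWeight q (a r)) *
        (1 - (2 : ℝ) ^ s / 2 * ∏ r, (if (a r).1 = true then (1 / 2 : ℝ) else 1)) := by
        simp only [mul_sub, mul_one, Finset.sum_sub_distrib]
        rw [sum_prod_weight_eq_one (sum_atomWeight q), ← hexp, Finset.mul_sum]
        congr 1
        exact Finset.sum_congr rfl fun a _ => by ring
    _ ≤ _ := Finset.sum_le_sum fun a _ => mul_le_mul_of_nonneg_left (hpt a) (hw0 a)

/-- A sketch column is dominated, in the convex order, by twice a vector with independent sparse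
random signs of four times the density. -/
theorem sum_sketchCol_le {m s : ℕ} (hsm : s ≤ m) {q : ℝ} (h0 : 0 ≤ q) (h1 : q ≤ 1)
    (hq : q * m = 4 * s) {g : (Fin m → ℝ) → ℝ} (hg : ConvexOn ℝ Set.univ g) :
    ∑ y : (Fin s ↪ Fin m) × (Fin s → ℤˣ),
        (Fintype.card ((Fin s ↪ Fin m) × (Fin s → ℤˣ)) : ℝ)⁻¹ * g (sketchCol y)
      ≤ ∑ a : Fin m → Bool × ℤˣ, (∏ r, atomWeight q (a r)) *
          g (fun r => 2 * atomValue (a r)) := by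
  let y₀ : (Fin s ↪ Fin m) × (Fin s → ℤˣ) := (Fin.castLEEmb hsm, 1)
  set Y := Fintype.card ((Fin s ↪ Fin m) × (Fin s → ℤˣ)) with hY
  have hYpos : (0 : ℝ) < Y := by
    rw [hY]
    exact_mod_cast Fintype.card_pos_iff.2 ⟨y₀⟩
  set M : ℝ := (Fintype.card (Equiv.Perm (Fin m)) * Fintype.card (Fin m → ℤˣ) : ℝ) with hM
  have hMpos : 0 < M := by
    rw [hM]
    have := Fintype.card_pos (α := Equiv.Perm (Fin m))
    have := Fintype.card_pos (α := Fin m → ℤˣ)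
    positivity
  set H₁ := orbitSum g (sketchCol y₀)
  set H₂ := orbitSum g (fun r => 2 * sketchCol y₀ r)
  set H₀ := orbitSum g 0
  have hw0 : ∀ a : Fin m → Bool × ℤˣ, 0 ≤ ∏ r, atomWeight q (a r) := fun a =>
    Finset.prod_nonneg fun r _ => atomWeight_nonneg h0 h1 _
  have hzero : ∀ x, H₀ ≤ orbitSum g x := fun x =>
    orbitSum_le_of_flip hg (fun _ => -1) fun r => by simp
  have hmid : H₁ ≤ 1 / 2 * H₂ + 1 / 2 * H₀ := by
    simp only [H₁, H₂, H₀, orbitSum, Finset.mul_sum, ← Finset.sum_add_distrib]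
    refine Finset.sum_le_sum fun π _ => Finset.sum_le_sum fun e _ => ?_
    have e1 : signedPerm π e (sketchCol y₀)
        = (1 / 2 : ℝ) • signedPerm π e (fun r => 2 * sketchCol y₀ r)
          + (1 / 2 : ℝ) • signedPerm π e 0 := by
      funext r
      simp only [signedPerm, Pi.add_apply, Pi.smul_apply, smul_eq_mul, Pi.zero_apply]
      ring
    rw [e1]
    exact hg.2 (Set.mem_univ _) (Set.mem_univ _) (by norm_num) (by norm_num) (by norm_num)
  have hbig : ∀ a : Fin m → Bool × ℤˣ,
      H₀ + (H₂ - H₀) * (if s ≤ (Finset.univ.filter fun r => (a r).1 = true).card then 1 else 0)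
        ≤ orbitSum g (fun r => 2 * atomValue (a r)) := by
    intro a
    split_ifs with h
    · -- choose `s` of the non-zero entries; they form a column in the orbit of the reference column
      have hcard : Fintype.card (Fin s) ≤
          Fintype.card {r // (a r).1 = true} := by
        rwa [Fintype.card_fin, Fintype.card_subtype]
      obtain ⟨f⟩ := Function.Embedding.nonempty_of_card_le hcard
      let y : (Fin s ↪ Fin m) × (Fin s → ℤˣ) :=
        (f.trans (Function.Embedding.subtype _), fun i => (a (f i)).2)
      obtain ⟨π, e, hy⟩ := exists_signedPerm_sketchCol y y₀
      have e1 : (fun r => 2 * sketchCol y r) = signedPerm π e (fun r => 2 * sketchCol y₀ r) := by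
        funext r
        rw [hy]
        simp only [signedPerm]
        ring
      have e2 : orbitSum g (fun r => 2 * sketchCol y r) = H₂ := by
        rw [e1, orbitSum_signedPerm]
      have e3 : orbitSum g (fun r => 2 * sketchCol y r)
          ≤ orbitSum g (fun r => 2 * atomValue (a r)) := by
        classical
        refine orbitSum_le_of_flip hg (fun r => if ∃ i, y.1 i = r then 1 else -1) fun r => ?_
        by_cases hr : ∃ i, y.1 i = r
        · rw [if_pos hr]
          obtain ⟨i, rfl⟩ := hr
          have ht : (a (y.1 i)).1 = true := (f i).2
          rw [sketchCol_apply, atomValue, if_pos ht]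
          have : (a (y.1 i)).2 = y.2 i := rfl
          rw [this]
          push_cast
          ring
        · rw [if_neg hr]
          push Not at hr
          rw [sketchCol_of_notMem y hr]
          push_cast
          ring
      linarith
    · linarith [hzero (fun r => 2 * atomValue (a r))]
  have hH : H₁ ≤ ∑ a : Fin m → Bool × ℤˣ, (∏ r, atomWeight q (a r)) *
      orbitSum g (fun r => 2 * atomValue (a r)) := by
    have hhalf := half_le_sum_card_support h0 h1 hq
    have h2 := Finset.sum_le_sum fun (a : Fin m → Bool × ℤˣ) (_ : a ∈ Finset.univ) =>
      mul_le_mul_of_nonneg_left (hbig a) (hw0 a)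
    refine le_trans ?_ h2
    simp only [mul_add, Finset.sum_add_distrib, ← Finset.sum_mul]
    rw [sum_prod_weight_eq_one (sum_atomWeight q)]
    have e : ∀ a : Fin m → Bool × ℤˣ, (∏ r, atomWeight q (a r)) * ((H₂ - H₀) *
        (if s ≤ (Finset.univ.filter fun r => (a r).1 = true).card then 1 else 0))
        = (H₂ - H₀) * ((∏ r, atomWeight q (a r)) *
        (if s ≤ (Finset.univ.filter fun r => (a r).1 = true).card then 1 else 0)) := by
      intro a; ring
    simp only [e]
    rw [← Finset.mul_sum]
    have h3 : 0 ≤ H₂ - H₀ := by linarith [hzero (fun r => 2 * sketchCol y₀ r)]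
    have h4 := mul_le_mul_of_nonneg_left hhalf h3
    linarith
  rw [sum_orbitSum_atomValue, ← hM] at hH
  have hsum : Y * H₁ = M * ∑ y : (Fin s ↪ Fin m) × (Fin s → ℤˣ), g (sketchCol y) := by
    rw [hM, ← sum_orbitSum_sketchCol]
    have : ∀ y : (Fin s ↪ Fin m) × (Fin s → ℤˣ), orbitSum g (sketchCol y) = H₁ := by
      intro y
      obtain ⟨π, e, hy⟩ := exists_signedPerm_sketchCol y y₀
      rw [hy, orbitSum_signedPerm]
    simp only [this, Finset.sum_const, Finset.card_univ, nsmul_eq_mul]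
    rfl
  rw [← Finset.mul_sum]
  refine le_of_mul_le_mul_left (le_trans (le_of_eq ?_) hH) hMpos
  field_simp
  linarith

lemma comp_fin_cons {α V : Type*} {n : ℕ} (u : α → V) (a : α) (ω : Fin n → α) :
    (fun c => u ((Fin.cons a ω : Fin (n + 1) → α) c))
      = (Fin.cons (u a) fun c => u (ω c) : Fin (n + 1) → V) := by
  funext c
  refine Fin.cases ?_ (fun i => ?_) c <;> simp

/-- Convex domination of each factor gives domination of separately convex functions of independent
vectors. -/
lemma sum_le_of_convex_dominated {V Ω Ω' : Type*} [AddCommGroup V] [Module ℝ V] [Fintype Ω]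
    [Fintype Ω'] {p : Ω → ℝ} {p' : Ω' → ℝ} (hp : ∀ a, 0 ≤ p a) (hp' : ∀ a, 0 ≤ p' a)
    {x : Ω → V} {x' : Ω' → V}
    (hdom : ∀ g : V → ℝ, ConvexOn ℝ Set.univ g → ∑ a, p a * g (x a) ≤ ∑ a, p' a * g (x' a))
    (n : ℕ) (F : (Fin n → V) → ℝ)
    (hF : ∀ b c, ConvexOn ℝ Set.univ fun y => F (Function.update b c y)) :
    ∑ ω : Fin n → Ω, (∏ c, p (ω c)) * F (fun c => x (ω c))
      ≤ ∑ ω : Fin n → Ω', (∏ c, p' (ω c)) * F (fun c => x' (ω c)) := by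
  induction n with
  | zero =>
    simp only [Finset.univ_unique, Finset.univ_eq_empty, Finset.prod_empty, one_mul,
      Finset.sum_singleton]
    exact le_of_eq (congrArg F (Subsingleton.elim _ _))
  | succ n ih =>
    rw [sum_fin_cons, sum_fin_cons]
    simp only [Fin.prod_univ_succ, Fin.cons_zero, Fin.cons_succ, comp_fin_cons]
    calc ∑ a, ∑ ω : Fin n → Ω, p a * (∏ c, p (ω c)) * F (Fin.cons (x a) fun c => x (ω c))
        = ∑ ω : Fin n → Ω, (∏ c, p (ω c)) *
            ∑ a, p a * F (Fin.cons (x a) fun c => x (ω c)) := by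
          rw [Finset.sum_comm]
          simp only [Finset.mul_sum]
          exact Finset.sum_congr rfl fun ω _ => Finset.sum_congr rfl fun a _ => by ring
      _ ≤ ∑ ω : Fin n → Ω, (∏ c, p (ω c)) *
            ∑ a, p' a * F (Fin.cons (x' a) fun c => x (ω c)) := by
          refine Finset.sum_le_sum fun ω _ => mul_le_mul_of_nonneg_left
            (hdom (fun y => F (Fin.cons y fun c => x (ω c))) ?_)
            (Finset.prod_nonneg fun c _ => hp _)
          have := hF (Fin.cons 0 fun c => x (ω c)) 0
          simpa only [Fin.update_cons_zero] using this
      _ = ∑ a, p' a * ∑ ω : Fin n → Ω, (∏ c, p (ω c)) *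
            F (Fin.cons (x' a) fun c => x (ω c)) := by
          simp only [Finset.mul_sum]
          rw [Finset.sum_comm]
          exact Finset.sum_congr rfl fun a _ => Finset.sum_congr rfl fun ω _ => by ring
      _ ≤ ∑ a, p' a * ∑ ω : Fin n → Ω', (∏ c, p' (ω c)) *
            F (Fin.cons (x' a) fun c => x' (ω c)) := by
          refine Finset.sum_le_sum fun a _ => mul_le_mul_of_nonneg_left
            (ih (fun b => F (Fin.cons (x' a) b)) fun b c => ?_) (hp' a)
          have := hF (Fin.cons (x' a) b) c.succ
          simpa only [← Fin.cons_update] using this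
      _ = _ := by
          simp only [Finset.mul_sum]
          exact Finset.sum_congr rfl fun a _ => Finset.sum_congr rfl fun ω _ => by ring

/-! ### Decoupling and the exponential moment of the sketch -/

section Decoupling

variable {ι : Type*} {n m : ℕ}

/-- The vector `∑ x_c w_c` over `c ∈ T`. -/
noncomputable def partSum (w : Fin n → ι → ℝ) (T : Finset (Fin n)) (x : Fin n → ℝ) : ι → ℝ :=
  ∑ c ∈ T, x c • w c

/-- The decoupled quadratic form of the array `b`, in which every product of two entries has one
column in `T` and one outside. -/
noncomputable def decoupledMatrix (x : ℝ) (w : Fin n → ι → ℝ) (T : Finset (Fin n))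
    (b : Fin n → Fin m → ℝ) : Matrix ι ι ℝ :=
  ∑ r, x • (vecMulVec (partSum w T fun c => b c r) (partSum w Tᶜ fun c => b c r)
    + vecMulVec (partSum w Tᶜ fun c => b c r) (partSum w T fun c => b c r))

/-- The off-diagonal part of the quadratic form of the array `b`. -/
noncomputable def chaosMatrix (x : ℝ) (w : Fin n → ι → ℝ) (b : Fin n → Fin m → ℝ) :
    Matrix ι ι ℝ :=
  x • ∑ r, (vecMulVec (partSum w Finset.univ fun c => b c r)
      (partSum w Finset.univ fun c => b c r) - ∑ c, (b c r) ^ 2 • vecMulVec (w c) (w c))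

lemma decoupledMatrix_transpose (x : ℝ) (w : Fin n → ι → ℝ) (T : Finset (Fin n))
    (b : Fin n → Fin m → ℝ) : (decoupledMatrix x w T b)ᵀ = decoupledMatrix x w T b := by
  rw [decoupledMatrix, transpose_sum]
  refine Finset.sum_congr rfl fun r _ => ?_
  rw [transpose_smul, transpose_add, transpose_vecMulVec, transpose_vecMulVec, add_comm]

lemma chaosMatrix_transpose (x : ℝ) (w : Fin n → ι → ℝ) (b : Fin n → Fin m → ℝ) :
    (chaosMatrix x w b)ᵀ = chaosMatrix x w b := by
  simp only [chaosMatrix, transpose_smul, transpose_sum, transpose_sub, transpose_vecMulVec]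

lemma sum_signs_mul (c c' : Fin n) :
    ∑ τ : Fin n → ℤˣ, ((τ c : ℤ) : ℝ) * ((τ c' : ℤ) : ℝ) = if c = c' then 2 ^ n else 0 := by
  split_ifs with h
  · subst h
    have : ∀ τ : Fin n → ℤˣ, ((τ c : ℤ) : ℝ) * ((τ c : ℤ) : ℝ) = 1 := by
      intro τ
      rcases Int.units_eq_one_or (τ c) with h | h <;> simp [h]
    simp [this]
  · -- flipping the sign of `c` negates the product
    let f : (Fin n → ℤˣ) → Fin n → ℤˣ := fun τ => Function.update τ c (-τ c)
    have hf : Function.Involutive f := by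
      intro τ
      simp [f]
    have h1 : ∑ τ : Fin n → ℤˣ, ((τ c : ℤ) : ℝ) * ((τ c' : ℤ) : ℝ)
        = ∑ τ : Fin n → ℤˣ, -(((τ c : ℤ) : ℝ) * ((τ c' : ℤ) : ℝ)) := by
      refine Fintype.sum_equiv (Equiv.ofBijective f hf.bijective) _ _ fun τ => ?_
      simp [f, Function.update_of_ne (Ne.symm h)]
    rw [Finset.sum_neg_distrib] at h1
    linarith

/-- The quadratic form is twice the average of its decoupled versions over all splittings of the
columns. -/
lemma chaosMatrix_eq_sum_decoupledMatrix (x : ℝ) (w : Fin n → ι → ℝ) (b : Fin n → Fin m → ℝ) :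
    chaosMatrix x w b = ∑ τ : Fin n → ℤˣ, ((2 : ℝ) ^ n)⁻¹ •
      decoupledMatrix (2 * x) w (Finset.univ.filter fun c => τ c = 1) b := by
  ext i j
  have hz : ∀ (τ : Fin n → ℤˣ) (r : Fin m) (i : ι),
      partSum w (Finset.univ.filter fun c => τ c = 1) (fun c => b c r) i
        = ∑ c, (1 + ((τ c : ℤ) : ℝ)) / 2 * (b c r * w c i) := by
    intro τ r i
    rw [partSum, Finset.sum_apply, Finset.sum_filter]
    refine Finset.sum_congr rfl fun c _ => ?_
    rcases Int.units_eq_one_or (τ c) with h | h <;> simp [h]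
  have hz' : ∀ (τ : Fin n → ℤˣ) (r : Fin m) (i : ι),
      partSum w (Finset.univ.filter fun c => τ c = 1)ᶜ (fun c => b c r) i
        = ∑ c, (1 - ((τ c : ℤ) : ℝ)) / 2 * (b c r * w c i) := by
    intro τ r i
    rw [partSum, Finset.sum_apply, Finset.compl_filter, Finset.sum_filter]
    refine Finset.sum_congr rfl fun c _ => ?_
    rcases Int.units_eq_one_or (τ c) with h | h <;> simp [h]
  have hpair : ∀ r : Fin m, ∑ τ : Fin n → ℤˣ,
      ((∑ c, (1 + ((τ c : ℤ) : ℝ)) / 2 * (b c r * w c i)) *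
          (∑ c, (1 - ((τ c : ℤ) : ℝ)) / 2 * (b c r * w c j))
        + (∑ c, (1 - ((τ c : ℤ) : ℝ)) / 2 * (b c r * w c i)) *
          (∑ c, (1 + ((τ c : ℤ) : ℝ)) / 2 * (b c r * w c j)))
      = 2 ^ n / 2 * ((∑ c, b c r * w c i) * (∑ c, b c r * w c j)
        - ∑ c, b c r ^ 2 * (w c i * w c j)) := by
    intro r
    have e : ∀ τ : Fin n → ℤˣ,
        ((∑ c, (1 + ((τ c : ℤ) : ℝ)) / 2 * (b c r * w c i)) *
          (∑ c, (1 - ((τ c : ℤ) : ℝ)) / 2 * (b c r * w c j))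
        + (∑ c, (1 - ((τ c : ℤ) : ℝ)) / 2 * (b c r * w c i)) *
          (∑ c, (1 + ((τ c : ℤ) : ℝ)) / 2 * (b c r * w c j)))
        = ∑ c, ∑ c', (1 / 2 * ((b c r * w c i) * (b c' r * w c' j))
          - 1 / 2 * ((b c r * w c i) * (b c' r * w c' j)) *
            (((τ c : ℤ) : ℝ) * ((τ c' : ℤ) : ℝ))) := by
      intro τ
      rw [Finset.sum_mul_sum, Finset.sum_mul_sum, ← Finset.sum_add_distrib]
      refine Finset.sum_congr rfl fun c _ => ?_
      rw [← Finset.sum_add_distrib]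
      exact Finset.sum_congr rfl fun c' _ => by ring
    simp only [e]
    rw [Finset.sum_comm]
    have e2 : ∀ c, ∑ τ : Fin n → ℤˣ, ∑ c', (1 / 2 * ((b c r * w c i) * (b c' r * w c' j))
          - 1 / 2 * ((b c r * w c i) * (b c' r * w c' j)) *
            (((τ c : ℤ) : ℝ) * ((τ c' : ℤ) : ℝ)))
        = 2 ^ n / 2 *
          (∑ c', (b c r * w c i) * (b c' r * w c' j) - b c r ^ 2 * (w c i * w c j)) := by
      intro c
      rw [Finset.sum_comm]
      have e3 : ∀ c', ∑ τ : Fin n → ℤˣ, (1 / 2 * ((b c r * w c i) * (b c' r * w c' j))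
          - 1 / 2 * ((b c r * w c i) * (b c' r * w c' j)) *
            (((τ c : ℤ) : ℝ) * ((τ c' : ℤ) : ℝ)))
          = 2 ^ n / 2 * ((b c r * w c i) * (b c' r * w c' j))
            - if c = c' then 2 ^ n / 2 * (b c r ^ 2 * (w c i * w c j)) else 0 := by
        intro c'
        rw [Finset.sum_sub_distrib, Finset.sum_const, ← Finset.mul_sum, sum_signs_mul,
          Finset.card_univ, Fintype.card_fun, Fintype.card_fin, Fintype.card_units_int,
          nsmul_eq_mul]
        push_cast
        split_ifs with h
        · subst h; ring
        · ring
      simp only [e3]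
      rw [Finset.sum_sub_distrib, ← Finset.mul_sum, Finset.sum_ite_eq, if_pos (Finset.mem_univ _)]
      ring
    simp only [e2]
    rw [← Finset.mul_sum, Finset.sum_sub_distrib, Finset.sum_mul_sum]
  simp only [chaosMatrix, decoupledMatrix, Matrix.smul_apply, Matrix.sum_apply, Matrix.add_apply,
    Matrix.sub_apply, vecMulVec_apply, smul_eq_mul, hz, hz']
  simp only [partSum, Finset.sum_apply, Pi.smul_apply, smul_eq_mul]
  rw [← Finset.mul_sum, Finset.sum_comm]
  simp only [← Finset.mul_sum, hpair]
  simp only [Finset.mul_sum]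
  refine Finset.sum_congr rfl fun r _ => ?_
  simp only [← Finset.mul_sum]
  field_simp

lemma partSum_update (w : Fin n → ι → ℝ) (T : Finset (Fin n)) (b : Fin n → Fin m → ℝ)
    (c : Fin n) (y₁ y₂ : Fin m → ℝ) {p₁ p₂ : ℝ} (hp : p₁ + p₂ = 1) (r : Fin m) :
    (partSum w T fun c' => Function.update b c (p₁ • y₁ + p₂ • y₂) c' r)
      = p₁ • (partSum w T fun c' => Function.update b c y₁ c' r)
        + p₂ • partSum w T fun c' => Function.update b c y₂ c' r := by
  simp only [partSum, Finset.smul_sum, ← Finset.sum_add_distrib]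
  refine Finset.sum_congr rfl fun c' _ => ?_
  rw [smul_smul, smul_smul, ← add_smul]
  congr 1
  by_cases h : c' = c
  · subst h
    simp
  · simp only [Function.update_of_ne h, ← add_mul, hp, one_mul]

lemma partSum_update_of_notMem (w : Fin n → ι → ℝ) {T : Finset (Fin n)} (b : Fin n → Fin m → ℝ)
    {c : Fin n} (hc : c ∉ T) (y : Fin m → ℝ) (r : Fin m) :
    (partSum w T fun c' => Function.update b c y c' r) = partSum w T fun c' => b c' r := by
  refine Finset.sum_congr rfl fun c' hc' => ?_
  dsimp only
  rw [Function.update_of_ne fun h => hc (by rwa [← h])]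

lemma decoupledMatrix_update (x : ℝ) (w : Fin n → ι → ℝ) (T : Finset (Fin n))
    (b : Fin n → Fin m → ℝ) (c : Fin n) (y₁ y₂ : Fin m → ℝ) {p₁ p₂ : ℝ} (hp : p₁ + p₂ = 1) :
    decoupledMatrix x w T (Function.update b c (p₁ • y₁ + p₂ • y₂))
      = p₁ • decoupledMatrix x w T (Function.update b c y₁)
        + p₂ • decoupledMatrix x w T (Function.update b c y₂) := by
  simp only [decoupledMatrix, Finset.smul_sum, ← Finset.sum_add_distrib]
  refine Finset.sum_congr rfl fun r _ => ?_
  rw [partSum_update w T b c y₁ y₂ hp, partSum_update w Tᶜ b c y₁ y₂ hp]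
  by_cases hc : c ∈ T
  · have hc' : c ∉ Tᶜ := by simpa using hc
    simp only [partSum_update_of_notMem w b hc', ← add_smul, hp, one_smul]
    simp only [add_vecMulVec, vecMulVec_add, smul_vecMulVec, vecMulVec_smul]
    module
  · simp only [partSum_update_of_notMem w b hc, ← add_smul, hp, one_smul]
    simp only [add_vecMulVec, vecMulVec_add, smul_vecMulVec, vecMulVec_smul]
    module

variable [Fintype ι] [DecidableEq ι]

/-- The decoupled matrix is affine in each single column, since no column lies on both sides of the
partition; the trace exponential is convex. -/
lemma convexOn_trace_exp_decoupledMatrix (x : ℝ) (w : Fin n → ι → ℝ) (T : Finset (Fin n))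
    (b : Fin n → Fin m → ℝ) (c : Fin n) :
    ConvexOn ℝ Set.univ fun y =>
      trace (NormedSpace.exp (decoupledMatrix x w T (Function.update b c y))) := by
  refine ⟨convex_univ, fun y₁ _ y₂ _ p₁ p₂ h₁ h₂ hp => ?_⟩
  have h := trace_exp_sum_le Finset.univ (fun i : Bool => if i then p₁ else p₂)
    (fun i _ => by split_ifs <;> assumption) (by simpa using hp)
    (fun i : Bool => decoupledMatrix x w T (Function.update b c (if i then y₁ else y₂)))
    (fun i _ => decoupledMatrix_transpose _ _ _ _)
  simp only [Fintype.sum_bool, if_true, Bool.false_eq_true, if_false] at h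
  dsimp only
  rw [decoupledMatrix_update x w T b c y₁ y₂ hp]
  exact h

/-- The trace exponential moment of the quadratic form of a random sketch. -/
theorem sum_trace_exp_chaosMatrix_le {w : Fin n → ι → ℝ}
    (hw : ∀ u : ι → ℝ, ∑ c, (w c ⬝ᵥ u) ^ 2 ≤ u ⬝ᵥ u) {s : ℕ} (hsm : s ≤ m) {q : ℝ} (h0 : 0 ≤ q)
    (h1 : q ≤ 1) (hq : q * m = 4 * s) (hK : q * ∑ c, w c ⬝ᵥ w c ≤ 1) {x : ℝ} (hx : 0 < |8 * x|)
    (hx8 : |8 * x| ≤ 1 / 8) :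
    ∑ ω : Fin n → (Fin s ↪ Fin m) × (Fin s → ℤˣ),
        ((Fintype.card ((Fin s ↪ Fin m) × (Fin s → ℤˣ)) : ℝ)⁻¹) ^ n *
          trace (NormedSpace.exp (chaosMatrix x w fun c => sketchCol (ω c)))
      ≤ Fintype.card ι + (∑ c, w c ⬝ᵥ w c) *
        ((1 + 400 * (8 * x) ^ 2 * q ^ 2 * ∑ c, w c ⬝ᵥ w c) ^ m - 1) := by
  set p := (Fintype.card ((Fin s ↪ Fin m) × (Fin s → ℤˣ)) : ℝ)⁻¹ with hp
  have hp0 : 0 ≤ p := by positivity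
  set R := Fintype.card ι + (∑ c, w c ⬝ᵥ w c) *
        ((1 + 400 * (8 * x) ^ 2 * q ^ 2 * ∑ c, w c ⬝ᵥ w c) ^ m - 1) with hR
  have hT : ∀ T : Finset (Fin n), ∑ ω : Fin n → (Fin s ↪ Fin m) × (Fin s → ℤˣ),
      p ^ n * trace (NormedSpace.exp (decoupledMatrix (2 * x) w T fun c => sketchCol (ω c)))
        ≤ R := by
    intro T
    have h2 := sum_le_of_convex_dominated (p := fun _ : (Fin s ↪ Fin m) × (Fin s → ℤˣ) => p)
      (p' := fun a : Fin m → Bool × ℤˣ => ∏ r, atomWeight q (a r)) (fun _ => hp0)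
      (fun a => Finset.prod_nonneg fun r _ => atomWeight_nonneg h0 h1 _)
      (fun g hg => sum_sketchCol_le hsm h0 h1 hq hg) n
      (fun b => trace (NormedSpace.exp (decoupledMatrix (2 * x) w T b)))
      (convexOn_trace_exp_decoupledMatrix (2 * x) w T)
    simp only [Finset.prod_const, Finset.card_univ, Fintype.card_fin] at h2
    refine h2.trans ?_
    have h3 := sum_trace_exp_rowMatrix_le hw h0 h1 hK hx hx8 T m
    refine le_trans (le_of_eq ?_) h3
    refine Fintype.sum_equiv (Equiv.piComm fun _ _ => Bool × ℤˣ) _ _ fun a => ?_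
    have e1 : ∏ c, ∏ r, atomWeight q (a c r)
        = ∏ r, ∏ c, atomWeight q ((Equiv.piComm fun _ _ => Bool × ℤˣ) a r c) :=
      Finset.prod_comm
    rw [e1]
    congr 3
    refine Finset.sum_congr rfl fun r _ => ?_
    have e2 : ∀ S : Finset (Fin n), (partSum w S fun c => 2 * atomValue (a c r))
        = (2 : ℝ) • sparseSum w S ((Equiv.piComm fun _ _ => Bool × ℤˣ) a r) := by
      intro S
      rw [partSum, sparseSum, Finset.smul_sum]
      exact Finset.sum_congr rfl fun c _ => by rw [smul_smul]; rfl
    simp only [e2, rowMatrix, smul_vecMulVec, vecMulVec_smul]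
    module
  have hJ : ∀ ω : Fin n → (Fin s ↪ Fin m) × (Fin s → ℤˣ),
      trace (NormedSpace.exp (chaosMatrix x w fun c => sketchCol (ω c)))
        ≤ ∑ τ : Fin n → ℤˣ, ((2 : ℝ) ^ n)⁻¹ * trace (NormedSpace.exp (decoupledMatrix (2 * x) w
          (Finset.univ.filter fun c => τ c = 1) fun c => sketchCol (ω c))) := by
    intro ω
    rw [chaosMatrix_eq_sum_decoupledMatrix]
    refine trace_exp_sum_le _ _ (fun _ _ => by positivity) ?_ _
      fun _ _ => decoupledMatrix_transpose _ _ _ _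
    simp
  calc ∑ ω : Fin n → (Fin s ↪ Fin m) × (Fin s → ℤˣ),
        p ^ n * trace (NormedSpace.exp (chaosMatrix x w fun c => sketchCol (ω c)))
      ≤ ∑ ω : Fin n → (Fin s ↪ Fin m) × (Fin s → ℤˣ), p ^ n *
        ∑ τ : Fin n → ℤˣ, ((2 : ℝ) ^ n)⁻¹ * trace (NormedSpace.exp (decoupledMatrix (2 * x) w
          (Finset.univ.filter fun c => τ c = 1) fun c => sketchCol (ω c))) :=
        Finset.sum_le_sum fun ω _ => mul_le_mul_of_nonneg_left (hJ ω) (by positivity)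
    _ = ∑ τ : Fin n → ℤˣ, ((2 : ℝ) ^ n)⁻¹ * ∑ ω : Fin n → (Fin s ↪ Fin m) × (Fin s → ℤˣ),
        p ^ n * trace (NormedSpace.exp (decoupledMatrix (2 * x) w
          (Finset.univ.filter fun c => τ c = 1) fun c => sketchCol (ω c))) := by
        simp only [Finset.mul_sum]
        rw [Finset.sum_comm]
        exact Finset.sum_congr rfl fun τ _ => Finset.sum_congr rfl fun ω _ => by ring
    _ ≤ ∑ τ : Fin n → ℤˣ, ((2 : ℝ) ^ n)⁻¹ * R :=
        Finset.sum_le_sum fun τ _ => mul_le_mul_of_nonneg_left (hT _) (by positivity)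
    _ = R := by
        rw [Finset.sum_const, Finset.card_univ]
        simp

end Decoupling

/-! ### The sketch preserves regularised quadratic forms -/

/-- The orthogonal projection `R` onto the row space of `K`. -/
lemma exists_rowSpace_proj {ι κ : Type*} [Fintype ι] [DecidableEq ι] [Fintype κ]
    (K : Matrix κ ι ℝ) :
    ∃ R : Matrix ι ι ℝ, Rᵀ = R ∧ R * R = R ∧ K * R = K ∧ trace R ≤ Fintype.card κ := by
  classical
  obtain ⟨U, l, h1, h2, h3, -⟩ := exists_spectral (A := Kᵀ * K) (by simp)
  let e : ι → ℝ := fun i => if l i = 0 then 0 else 1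
  have hee : diagonal e * diagonal e = diagonal e := by
    rw [diagonal_mul_diagonal]
    congr 1
    funext i
    simp only [e]
    split_ifs <;> simp
  have hle : diagonal l * diagonal e = diagonal l := by
    rw [diagonal_mul_diagonal]
    congr 1
    funext i
    simp only [e]
    split_ifs with h <;> simp [h]
  refine ⟨U * diagonal e * Uᵀ, ?_, ?_, ?_, ?_⟩
  · simp [transpose_mul, Matrix.mul_assoc]
  · calc U * diagonal e * Uᵀ * (U * diagonal e * Uᵀ)
        = U * (diagonal e * (Uᵀ * U) * diagonal e) * Uᵀ := by simp only [Matrix.mul_assoc]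
      _ = _ := by rw [h1, mul_one, hee]
  · have h4 : Kᵀ * K * (U * diagonal e * Uᵀ) = Kᵀ * K := by
      calc Kᵀ * K * (U * diagonal e * Uᵀ)
          = U * (diagonal l * (Uᵀ * U) * diagonal e) * Uᵀ := by
            rw [h3]; simp only [Matrix.mul_assoc]
        _ = _ := by rw [h1, mul_one, hle, h3]
    have h5 : (K - K * (U * diagonal e * Uᵀ))ᴴ * (K - K * (U * diagonal e * Uᵀ)) = 0 := by
      have h6 : Kᵀ * (K - K * (U * diagonal e * Uᵀ)) = 0 := by
        rw [Matrix.mul_sub, ← Matrix.mul_assoc, h4, sub_self]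
      rw [conjTranspose_eq_transpose_of_trivial, transpose_sub, transpose_mul K, Matrix.sub_mul, h6,
        Matrix.mul_assoc, h6, Matrix.mul_zero, sub_zero]
    rw [Matrix.conjTranspose_mul_self_eq_zero, sub_eq_zero] at h5
    exact h5.symm
  · have h4 : diagonal l = (Uᵀ * Kᵀ) * (K * U) := by
      calc diagonal l = (Uᵀ * U) * diagonal l * (Uᵀ * U) := by rw [h1, one_mul, mul_one]
        _ = Uᵀ * (U * diagonal l * Uᵀ) * U := by simp only [Matrix.mul_assoc]
        _ = _ := by rw [← h3]; simp only [Matrix.mul_assoc]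
    have h5 : (diagonal l).rank ≤ Fintype.card κ := by
      rw [h4]
      exact (Matrix.rank_mul_le_right _ _).trans (Matrix.rank_le_card_height _)
    rw [Matrix.rank_diagonal] at h5
    rw [trace_mul_comm, ← Matrix.mul_assoc, h1, one_mul, trace_diagonal]
    have h6 : ∑ i, e i = (Fintype.card {i // l i ≠ 0} : ℝ) := by
      rw [Fintype.card_subtype, Finset.card_filter]
      push_cast
      exact Finset.sum_congr rfl fun i _ => by simp only [e]; split_ifs <;> simp_all
    rw [h6]
    exact_mod_cast h5

section Ridge

variable {n d : ℕ}

lemma trace_transpose_mul_self_eq_sum {κ ι : Type*} [Fintype κ] [Fintype ι] (M : Matrix κ ι ℝ) :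
    trace (Mᵀ * M) = ∑ r, M r ⬝ᵥ M r := by
  simp only [trace, diag, mul_apply, transpose_apply, dotProduct]
  exact Finset.sum_comm

lemma mulVec_dotProduct_mulVec {κ ι : Type*} [Fintype κ] [Fintype ι] (M N : Matrix κ ι ℝ)
    (u v : ι → ℝ) : M *ᵥ u ⬝ᵥ N *ᵥ v = u ⬝ᵥ (Mᵀ * N) *ᵥ v := by
  rw [← mulVec_mulVec, dotProduct_mulVec u, ← mulVec_transpose, transpose_transpose]

lemma trace_mul_proj {κ ι : Type*} [Fintype κ] [Fintype ι] (M : Matrix κ ι ℝ) {R : Matrix ι ι ℝ}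
    (h1 : Rᵀ = R) (h2 : R * R = R) : trace ((M * R)ᵀ * (M * R)) = trace (Mᵀ * M * R) := by
  rw [transpose_mul, Matrix.mul_assoc, trace_mul_comm, h1]
  simp only [Matrix.mul_assoc]
  rw [h2]

/-- Pythagoras for the rows of a matrix and an orthogonal projection. -/
lemma trace_mul_one_sub_proj {κ ι : Type*} [Fintype κ] [Fintype ι] [DecidableEq ι]
    (M : Matrix κ ι ℝ) {R : Matrix ι ι ℝ} (h1 : Rᵀ = R) (h2 : R * R = R) :
    trace ((M * (1 - R))ᵀ * (M * (1 - R))) = trace (Mᵀ * M) - trace ((M * R)ᵀ * (M * R)) := by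
  have h3 : (1 - R) * (1 - R) = 1 - R := by
    rw [sub_mul, mul_sub, mul_sub, h2]; simp
  rw [trace_mul_proj M (by simp [h1]) h3, trace_mul_proj M h1 h2, Matrix.mul_sub, Matrix.mul_one,
    trace_sub]

/-- The regularised square root factorisation `A = W B` with `Bᵀ B = Aᵀ A + ρ² 1`. The factor `W` is
a contraction, and its squared Frobenius norm, the effective dimension of `A` at scale `ρ`, is at
most `2 k` once `k ρ²` exceeds the squared error of some rank `k` approximation. -/
lemma exists_ridge_factor (A : Matrix (Fin n) (Fin d) ℝ) {k : ℕ} (Y : Matrix (Fin d) (Fin k) ℝ)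
    {ρ : ℝ} (hρ : 0 < ρ)
    (hA : trace ((A - A * Y * Yᵀ)ᵀ * (A - A * Y * Yᵀ)) ≤ k * ρ ^ 2) :
    ∃ (W : Matrix (Fin n) (Fin d) ℝ) (B : Matrix (Fin d) (Fin d) ℝ), A = W * B ∧
      (∀ u, B *ᵥ u ⬝ᵥ B *ᵥ u = A *ᵥ u ⬝ᵥ A *ᵥ u + ρ ^ 2 * (u ⬝ᵥ u)) ∧
      (∀ u, W *ᵥ u ⬝ᵥ W *ᵥ u ≤ u ⬝ᵥ u) ∧ trace (Wᵀ * W) ≤ 2 * k := by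
  have hself : ∀ {κ : Type} [Fintype κ] (z : κ → ℝ), 0 ≤ z ⬝ᵥ z := fun z =>
    Finset.sum_nonneg fun _ _ => mul_self_nonneg _
  obtain ⟨U, l, h1, h2, h3, -⟩ := exists_spectral (A := Aᵀ * A) (by simp)
  have hl : ∀ i, 0 ≤ l i := by
    intro i
    have h : (Uᵀ * (U * diagonal l * Uᵀ) * U) i i = l i := by
      rw [show Uᵀ * (U * diagonal l * Uᵀ) * U = (Uᵀ * U) * diagonal l * (Uᵀ * U) by
        simp only [Matrix.mul_assoc], h1, one_mul, mul_one, diagonal_apply_eq]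
    rw [← h3, Matrix.mul_assoc] at h
    have h' : U.col i ⬝ᵥ (Aᵀ * A) *ᵥ U.col i = l i := h
    rw [← h', ← mulVec_dotProduct_mulVec]
    exact hself _
  have hlρ : ∀ i, 0 < l i + ρ ^ 2 := fun i => by have := hl i; positivity
  let a : Fin d → ℝ := fun i => Real.sqrt (l i + ρ ^ 2)
  have ha : ∀ i, 0 < a i := fun i => Real.sqrt_pos.2 (hlρ i)
  have haa : ∀ i, a i * a i = l i + ρ ^ 2 := fun i => Real.mul_self_sqrt (hlρ i).le
  let B : Matrix (Fin d) (Fin d) ℝ := diagonal a * Uᵀ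
  let C : Matrix (Fin d) (Fin d) ℝ := U * diagonal fun i => (a i)⁻¹
  have hdiag : (diagonal fun i => (a i)⁻¹) * diagonal a = 1 := by
    rw [diagonal_mul_diagonal, ← diagonal_one]
    congr 1
    funext i
    exact inv_mul_cancel₀ (ha i).ne'
  have hCB : C * B = 1 := by
    calc C * B = U * ((diagonal fun i => (a i)⁻¹) * diagonal a) * Uᵀ := by
          simp only [B, C, Matrix.mul_assoc]
      _ = 1 := by rw [hdiag, mul_one, h2]
  have hBC : B * C = 1 := mul_eq_one_comm.1 hCB
  have hBB : Bᵀ * B = Aᵀ * A + ρ ^ 2 • (1 : Matrix (Fin d) (Fin d) ℝ) := by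
    have e : diagonal a * diagonal a = diagonal l + ρ ^ 2 • (1 : Matrix (Fin d) (Fin d) ℝ) := by
      rw [diagonal_mul_diagonal, ← diagonal_one, ← diagonal_smul, diagonal_add]
      congr 1
      funext i
      simp [haa]
    calc Bᵀ * B = U * (diagonal a * diagonal a) * Uᵀ := by
          simp only [B, transpose_mul, transpose_transpose, diagonal_transpose, Matrix.mul_assoc]
      _ = _ := by
          rw [e, mul_add, add_mul, ← h3, mul_smul_comm, mul_one, smul_mul_assoc, h2]
  have hBq : ∀ u, B *ᵥ u ⬝ᵥ B *ᵥ u = A *ᵥ u ⬝ᵥ A *ᵥ u + ρ ^ 2 * (u ⬝ᵥ u) := by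
    intro u
    rw [mulVec_dotProduct_mulVec, hBB, add_mulVec, dotProduct_add, smul_mulVec, one_mulVec,
      dotProduct_smul, smul_eq_mul, mulVec_dotProduct_mulVec]
  have hWq : ∀ u, (A * C) *ᵥ u ⬝ᵥ (A * C) *ᵥ u ≤ u ⬝ᵥ u := by
    intro u
    have h := hBq (C *ᵥ u)
    rw [mulVec_mulVec, hBC, one_mulVec, mulVec_mulVec] at h
    have := mul_nonneg (sq_nonneg ρ) (hself (C *ᵥ u))
    linarith
  -- `C` shrinks row vectors by the factor `ρ`
  have hCρ : ∀ z : Fin d → ℝ, Cᵀ *ᵥ z ⬝ᵥ Cᵀ *ᵥ z ≤ (ρ ^ 2)⁻¹ * (z ⬝ᵥ z) := by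
    intro z
    have e : Cᵀ = (diagonal fun i => (a i)⁻¹) * Uᵀ := by
      simp only [C, transpose_mul, diagonal_transpose]
    rw [← sum_sq_transpose_mulVec h2 z, e, ← mulVec_mulVec, Finset.mul_sum]
    simp only [dotProduct, mulVec_diagonal]
    refine Finset.sum_le_sum fun i _ => ?_
    have e2 : (a i)⁻¹ * (Uᵀ *ᵥ z) i * ((a i)⁻¹ * (Uᵀ *ᵥ z) i)
        = (l i + ρ ^ 2)⁻¹ * (Uᵀ *ᵥ z) i ^ 2 := by
      rw [← haa, mul_inv]; ring
    rw [e2]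
    refine mul_le_mul_of_nonneg_right ?_ (sq_nonneg _)
    exact inv_anti₀ (by positivity) (by linarith [hl i])
  refine ⟨A * C, B, by rw [Matrix.mul_assoc, hCB, Matrix.mul_one], hBq, hWq, ?_⟩
  obtain ⟨R, hR1, hR2, hR3, hR4⟩ := exists_rowSpace_proj (Yᵀ * C)
  have hfirst : trace ((A * C * R)ᵀ * (A * C * R)) ≤ (k : ℝ) := by
    have e : ∀ M : Matrix (Fin d) (Fin d) ℝ,
        trace M = ∑ i, Pi.single i 1 ⬝ᵥ M *ᵥ Pi.single i 1 := by
      intro M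
      simp [trace]
    have h4 : trace ((A * C * R)ᵀ * (A * C * R)) ≤ trace (Rᵀ * R) := by
      rw [e, e]
      refine Finset.sum_le_sum fun i _ => ?_
      rw [← mulVec_dotProduct_mulVec, ← mulVec_dotProduct_mulVec, ← mulVec_mulVec]
      exact hWq _
    rw [hR1, hR2] at h4
    refine h4.trans (hR4.trans ?_)
    simp
  have hsecond : trace ((A * C * (1 - R))ᵀ * (A * C * (1 - R))) ≤ (k : ℝ) := by
    have e : A * C * (1 - R) = (A - A * Y * Yᵀ) * C * (1 - R) := by
      have h : Yᵀ * C * (1 - R) = 0 := by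
        rw [Matrix.mul_sub, Matrix.mul_one, hR3, sub_self]
      rw [Matrix.sub_mul, Matrix.sub_mul]
      have e3 : A * Y * Yᵀ * C * (1 - R) = A * Y * (Yᵀ * C * (1 - R)) := by
        simp only [Matrix.mul_assoc]
      rw [e3, h, Matrix.mul_zero, sub_zero]
    rw [e, trace_mul_one_sub_proj _ hR1 hR2]
    generalize A - A * Y * Yᵀ = Z at hA ⊢
    have h5 : trace ((Z * C)ᵀ * (Z * C)) ≤ (ρ ^ 2)⁻¹ * trace (Zᵀ * Z) := by
      rw [trace_transpose_mul_self_eq_sum, trace_transpose_mul_self_eq_sum, Finset.mul_sum]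
      refine Finset.sum_le_sum fun r _ => ?_
      have e2 : (Z * C) r = Cᵀ *ᵥ Z r := by
        rw [mulVec_transpose]; rfl
      rw [e2]
      exact hCρ _
    have h6 : (ρ ^ 2)⁻¹ * trace (Zᵀ * Z) ≤ k := by
      rw [inv_mul_le_iff₀ (by positivity)]
      linarith
    linarith [trace_transpose_mul_self_nonneg (Z * C * R)]
  rw [trace_mul_one_sub_proj _ hR1 hR2] at hsecond
  linarith

end Ridge

/-! ### The failure probability of the sketch -/

section Failure

variable {ι : Type*} [Fintype ι] [DecidableEq ι]

lemma card_add_trace_le_trace_exp {Y : Matrix ι ι ℝ} (hY : Yᵀ = Y) :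
    Fintype.card ι + trace Y ≤ trace (NormedSpace.exp Y) := by
  obtain ⟨U, l, h1, h2, h3, h4⟩ := exists_spectral hY
  have e2 : trace (NormedSpace.exp Y) = ∑ i, Real.exp (l i) := by
    rw [h4, trace_mul_comm, ← Matrix.mul_assoc, h1, one_mul, trace_diagonal]
  have e3 : trace Y = ∑ i, l i := by
    rw [h3, trace_mul_comm, ← Matrix.mul_assoc, h1, one_mul, trace_diagonal]
  have h5 : ∑ i, (l i + 1) ≤ ∑ i, Real.exp (l i) :=
    Finset.sum_le_sum fun i _ => Real.add_one_le_exp _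
  rw [Finset.sum_add_distrib] at h5
  simp only [Finset.sum_const, Finset.card_univ, nsmul_eq_mul, mul_one] at h5
  rw [e2, e3]
  linarith

/-- The two-sided version of `exp_sub_one_sub_le_trace`. -/
lemma exp_sub_one_sub_le_trace_abs {Y : Matrix ι ι ℝ} (hY : Yᵀ = Y) {v : ι → ℝ}
    (hv : v ⬝ᵥ v = 1) {x : ℝ} (hx : 0 ≤ x) (hxv : x ≤ |v ⬝ᵥ Y *ᵥ v|) :
    Real.exp x - 1 - x ≤ trace (NormedSpace.exp Y) + trace (NormedSpace.exp (-Y))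
      - 2 * Fintype.card ι := by
  have hY' : (-Y)ᵀ = -Y := by rw [transpose_neg, hY]
  have h1 := card_add_trace_le_trace_exp hY
  have h2 := card_add_trace_le_trace_exp hY'
  rw [trace_neg] at h2
  rcases le_abs'.1 hxv with h | h
  · have h3 := exp_sub_one_sub_le_trace hY' hv hx (by
      rw [neg_mulVec, dotProduct_neg]; linarith)
    rw [trace_neg] at h3
    linarith
  · have h3 := exp_sub_one_sub_le_trace hY hv hx h
    linarith

variable {n m s : ℕ}

lemma chaosMatrix_neg {ι : Type*} (x : ℝ) (w : Fin n → ι → ℝ) (b : Fin n → Fin m → ℝ) :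
    chaosMatrix (-x) w b = -chaosMatrix x w b := by
  simp [chaosMatrix]

lemma chaosMatrix_mul {ι : Type*} (y x : ℝ) (w : Fin n → ι → ℝ) (b : Fin n → Fin m → ℝ) :
    chaosMatrix (y * x) w b = y • chaosMatrix x w b := by
  simp only [chaosMatrix, mul_smul]

/-- Markov's inequality for the trace exponential moment, as a count of samples. -/
lemma card_chaosMatrix_ge_mul_le {w : Fin n → ι → ℝ}
    (hw : ∀ u : ι → ℝ, ∑ c, (w c ⬝ᵥ u) ^ 2 ≤ u ⬝ᵥ u) (hs : 0 < s) (hsm : 4 * s ≤ m)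
    (hK : 4 * s * ∑ c, w c ⬝ᵥ w c ≤ m) {θ γ : ℝ} (hθ : 0 < θ) (hγ : 0 < γ) (hθs : 64 * θ ≤ s)
    (F : Finset (Fin n → (Fin s ↪ Fin m) × (Fin s → ℤˣ)))
    (hF : ∀ ω ∈ F, ∃ u : ι → ℝ, u ⬝ᵥ u = 1 ∧
      γ ≤ |u ⬝ᵥ (chaosMatrix (1 / s) w fun c => sketchCol (ω c)) *ᵥ u|) :
    ((Fintype.card ((Fin s ↪ Fin m) × (Fin s → ℤˣ)) : ℝ)⁻¹) ^ n * F.card *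
        (Real.exp (θ * γ) - 1 - θ * γ) ≤
      2 * (∑ c, w c ⬝ᵥ w c) *
        ((1 + 409600 * θ ^ 2 / m ^ 2 * ∑ c, w c ⬝ᵥ w c) ^ m - 1) := by
  set p := (Fintype.card ((Fin s ↪ Fin m) × (Fin s → ℤˣ)) : ℝ)⁻¹ ^ n with hp
  have hs' : (0 : ℝ) < s := by exact_mod_cast hs
  have hm' : (0 : ℝ) < m := by exact_mod_cast (by omega : 0 < m)
  have hsm' : (4 : ℝ) * s ≤ m := by exact_mod_cast hsm
  let q : ℝ := 4 * s / m
  have hq0 : 0 ≤ q := by positivity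
  have hq1 : q ≤ 1 := (div_le_one hm').2 hsm'
  have hqm : q * m = 4 * s := by simp only [q]; field_simp
  have hqK : q * ∑ c, w c ⬝ᵥ w c ≤ 1 := by
    simp only [q]
    rw [div_mul_eq_mul_div]
    exact (div_le_one hm').2 hK
  have e8 : |8 * (θ / s)| = 8 * θ / s := by rw [abs_of_pos (by positivity)]; ring
  have e9 : |8 * -(θ / s)| = 8 * θ / s := by rw [mul_neg, abs_neg, e8]
  have h8 : 8 * θ / s ≤ 1 / 8 := by rw [div_le_iff₀ hs']; linarith
  have h1 := sum_trace_exp_chaosMatrix_le hw (by omega : s ≤ m) hq0 hq1 hqm hqK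
    (x := θ / s) (by rw [e8]; positivity) (by rw [e8]; exact h8)
  have h2 := sum_trace_exp_chaosMatrix_le hw (by omega : s ≤ m) hq0 hq1 hqm hqK
    (x := -(θ / s)) (by rw [e9]; positivity) (by rw [e9]; exact h8)
  have e : ∀ x : ℝ, x ^ 2 = (θ / s) ^ 2 → 400 * (8 * x) ^ 2 * q ^ 2 = 409600 * θ ^ 2 / m ^ 2 := by
    intro x hx
    rw [mul_pow, hx]
    simp only [q]
    field_simp
    ring
  rw [e _ rfl, ← hp] at h1
  rw [e _ (neg_sq _), ← hp] at h2
  have hcard : ∑ _ω : Fin n → (Fin s ↪ Fin m) × (Fin s → ℤˣ), p = 1 := by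
    rw [Finset.sum_const, Finset.card_univ, Fintype.card_pi, Finset.prod_const, Finset.card_univ,
      Fintype.card_fin, nsmul_eq_mul, hp, Nat.cast_pow, ← mul_pow, mul_inv_cancel₀, one_pow]
    have : Nonempty (Fin s ↪ Fin m) := ⟨Fin.castLEEmb (by omega)⟩
    exact_mod_cast Fintype.card_ne_zero
  have hpt : ∀ ω : Fin n → (Fin s ↪ Fin m) × (Fin s → ℤˣ),
      (if ω ∈ F then p * (Real.exp (θ * γ) - 1 - θ * γ) else 0) ≤
        p * trace (NormedSpace.exp (chaosMatrix (θ / s) w fun c => sketchCol (ω c)))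
        + p * trace (NormedSpace.exp (chaosMatrix (-(θ / s)) w fun c => sketchCol (ω c)))
        - p * (2 * Fintype.card ι) := by
    intro ω
    have hp0 : 0 ≤ p := by positivity
    rw [chaosMatrix_neg, ← mul_add, ← mul_sub]
    split_ifs with hω
    · obtain ⟨u, hu, hu'⟩ := hF ω hω
      refine mul_le_mul_of_nonneg_left ?_ hp0
      refine exp_sub_one_sub_le_trace_abs (chaosMatrix_transpose _ _ _) hu (by positivity) ?_
      rw [show θ / s = θ * (1 / s) by ring, chaosMatrix_mul, smul_mulVec, dotProduct_smul,
        smul_eq_mul, abs_mul, abs_of_pos hθ]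
      exact mul_le_mul_of_nonneg_left hu' hθ.le
    · refine mul_nonneg hp0 ?_
      have h3 := card_add_trace_le_trace_exp
        (chaosMatrix_transpose (θ / s) w fun c => sketchCol (ω c))
      have h4 := card_add_trace_le_trace_exp
        (Y := -chaosMatrix (θ / s) w fun c => sketchCol (ω c))
        (by rw [transpose_neg, chaosMatrix_transpose])
      rw [trace_neg] at h4
      linarith
  have h3 := Finset.sum_le_sum fun ω (_ : ω ∈ Finset.univ) => hpt ω
  rw [Finset.sum_sub_distrib, Finset.sum_add_distrib, ← Finset.sum_mul, hcard, ← Finset.sum_filter,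
    Finset.filter_mem_eq_inter, Finset.univ_inter, Finset.sum_const, nsmul_eq_mul] at h3
  linarith

/-- With `θ γ = 6 L` and enough rows, the quadratic form exceeds `γ` for at most a fraction
`β / 4` of the samples. -/
lemma card_chaosMatrix_ge_le {w : Fin n → ι → ℝ}
    (hw : ∀ u : ι → ℝ, ∑ c, (w c ⬝ᵥ u) ^ 2 ≤ u ⬝ᵥ u) {k : ℕ} (hk : 1 ≤ k) (hs : 0 < s)
    (hw2 : ∑ c, w c ⬝ᵥ w c ≤ 2 * k) (hm : 8 * s * k ≤ m) {β θ γ : ℝ} (hβ : 0 < β) (hβ1 : β < 1)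
    (hθ : 0 < θ) (hγ : 0 < γ) (hθs : 64 * θ ≤ s) (hθγ : θ * γ = 6 * Real.log (2 * k / β))
    (hθm : 819200 * θ ^ 2 * k ≤ Real.log (2 * k / β) * m)
    (F : Finset (Fin n → (Fin s ↪ Fin m) × (Fin s → ℤˣ)))
    (hF : ∀ ω ∈ F, ∃ u : ι → ℝ, u ⬝ᵥ u = 1 ∧
      γ ≤ |u ⬝ᵥ (chaosMatrix (1 / s) w fun c => sketchCol (ω c)) *ᵥ u|) :
    ((Fintype.card ((Fin s ↪ Fin m) × (Fin s → ℤˣ)) : ℝ)⁻¹) ^ n * F.card ≤ β / 4 := by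
  have hk' : (1 : ℝ) ≤ k := by exact_mod_cast hk
  have hs' : (0 : ℝ) < s := by exact_mod_cast hs
  have hm' : (8 : ℝ) * s * k ≤ m := by exact_mod_cast hm
  have hm0 : (0 : ℝ) < m := lt_of_lt_of_le (by positivity) hm'
  have h4s : 4 * s ≤ m := by nlinarith
  have h := card_chaosMatrix_ge_mul_le hw hs h4s (by nlinarith) hθ hγ hθs F hF
  rw [hθγ] at h
  set K := ∑ c, w c ⬝ᵥ w c with hKdef
  set L := Real.log (2 * k / β) with hL
  have hK0 : 0 ≤ K := Finset.sum_nonneg fun c _ => Finset.sum_nonneg fun _ _ => mul_self_nonneg _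
  have h2 : 2 ≤ 2 * k / β := by rw [le_div_iff₀ hβ]; nlinarith
  have hexpL : Real.exp L = 2 * k / β := Real.exp_log (by linarith)
  have hL0 : Real.log 2 ≤ L := Real.log_le_log (by norm_num) h2
  have hlog2 := Real.log_two_gt_d9
  have hpow : (1 + 409600 * θ ^ 2 / m ^ 2 * K) ^ m ≤ Real.exp L := by
    have h5 : 1 + 409600 * θ ^ 2 / m ^ 2 * K ≤ Real.exp (409600 * θ ^ 2 / m ^ 2 * K) := by
      linarith [Real.add_one_le_exp (409600 * θ ^ 2 / (m : ℝ) ^ 2 * K)]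
    refine (pow_le_pow_left₀ (by positivity) h5 m).trans ?_
    rw [← Real.exp_nat_mul]
    refine Real.exp_le_exp.2 ?_
    have e : (m : ℝ) * (409600 * θ ^ 2 / m ^ 2 * K) = 409600 * θ ^ 2 * K / m := by
      field_simp
    rw [e, div_le_iff₀ hm0]
    refine le_trans ?_ hθm
    nlinarith [mul_le_mul_of_nonneg_left hw2 (by positivity : 0 ≤ 409600 * θ ^ 2)]
  have hhalf : Real.exp (6 * L) / 2 ≤ Real.exp (6 * L) - 1 - 6 * L := by
    have := Real.quadratic_le_exp_of_nonneg (x := 6 * L) (by linarith)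
    nlinarith
  have hexp6 : Real.exp (6 * L) = (2 * k / β) ^ 6 := by
    rw [← hexpL, ← Real.exp_nat_mul]; norm_num
  set P := ((Fintype.card ((Fin s ↪ Fin m) × (Fin s → ℤˣ)) : ℝ)⁻¹) ^ n * F.card with hP
  have hP0 : 0 ≤ P := by positivity
  set z := 2 * k / β with hz
  have hzβ : z * β = 2 * k := by rw [hz]; field_simp
  have h6 : P * (z ^ 6 / 2) ≤ 2 * (2 * k) * z := by
    calc P * (z ^ 6 / 2) ≤ P * (Real.exp (6 * L) - 1 - 6 * L) := by
          rw [← hexp6]; exact mul_le_mul_of_nonneg_left hhalf hP0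
      _ ≤ 2 * K * ((1 + 409600 * θ ^ 2 / m ^ 2 * K) ^ m - 1) := h
      _ ≤ 2 * K * z := by
          refine mul_le_mul_of_nonneg_left ?_ (by positivity)
          linarith
      _ ≤ _ := by
          refine mul_le_mul_of_nonneg_right ?_ (by linarith)
          linarith
  rw [← hzβ] at h6
  have hz2 : 0 < z ^ 2 := by positivity
  have h7 : P * z ^ 4 ≤ 4 * β := by
    refine le_of_mul_le_mul_right ?_ hz2
    nlinarith
  have h8 : (16 : ℝ) ≤ z ^ 4 := by
    calc (16 : ℝ) = 2 ^ 4 := by norm_num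
      _ ≤ _ := pow_le_pow_left₀ (by norm_num) h2 4
  have h9 : P * 16 ≤ P * z ^ 4 := mul_le_mul_of_nonneg_left h8 hP0
  linarith

lemma sum_sketchCol_sq (y : (Fin s ↪ Fin m) × (Fin s → ℤˣ)) : ∑ r, sketchCol y r ^ 2 = s := by
  have h : ∑ r, sketchCol y r ^ 2 = ∑ i : Fin s, sketchCol y (y.1 i) ^ 2 := by
    rw [← Finset.sum_map Finset.univ y.1 fun r => sketchCol y r ^ 2]
    refine (Finset.sum_subset (Finset.subset_univ _) fun r _ hr => ?_).symm
    rw [sketchCol_of_notMem y fun i hi => hr (by simp [← hi]), zero_pow two_ne_zero]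
  rw [h]
  have h2 : ∀ i, sketchCol y (y.1 i) ^ 2 = 1 := by
    intro i
    rw [sketchCol_apply]
    rcases Int.units_eq_one_or (y.2 i) with h | h <;> simp [h]
  simp [h2]

/-- The sketching matrix `S = s^{-1/2} ∑ᵢ Sᵢ`. -/
noncomputable def sketchMatrix (ω : SketchSample m n s) : Matrix (Fin m) (Fin n) ℝ :=
  (1 / Real.sqrt s) • ∑ i, sketchPart ω i

lemma sketchMatrix_apply (ω : SketchSample m n s) (r : Fin m) (c : Fin n) :
    sketchMatrix ω r c = 1 / Real.sqrt s * sketchCol (ω c) r := by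
  simp only [sketchMatrix, Matrix.smul_apply, Matrix.sum_apply, sketchPart, of_apply, sketchCol,
    smul_eq_mul]

lemma dotProduct_chaosMatrix_mulVec {ι : Type*} [Fintype ι] (hs : 0 < s)
    {S : Matrix (Fin m) (Fin n) ℝ}
    {b : Fin n → Fin m → ℝ} (hS : ∀ r c, S r c = 1 / Real.sqrt s * b c r)
    (hb : ∀ c, ∑ r, b c r ^ 2 = s) (W : Matrix (Fin n) ι ℝ) (u : ι → ℝ) :
    u ⬝ᵥ chaosMatrix (1 / s) W b *ᵥ u = S *ᵥ (W *ᵥ u) ⬝ᵥ S *ᵥ (W *ᵥ u) - W *ᵥ u ⬝ᵥ W *ᵥ u := by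
  have hs' : (s : ℝ) ≠ 0 := by exact_mod_cast hs.ne'
  have e1 : S *ᵥ (W *ᵥ u) ⬝ᵥ S *ᵥ (W *ᵥ u)
      = 1 / s * ∑ r, (∑ c, b c r * (W c ⬝ᵥ u)) ^ 2 := by
    rw [dotProduct, Finset.mul_sum]
    refine Finset.sum_congr rfl fun r _ => ?_
    have : (S *ᵥ (W *ᵥ u)) r = 1 / Real.sqrt s * ∑ c, b c r * (W c ⬝ᵥ u) := by
      rw [mulVec, dotProduct, Finset.mul_sum]
      refine Finset.sum_congr rfl fun c _ => ?_
      rw [hS, mul_assoc]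
      rfl
    rw [this, ← sq, mul_pow, div_pow, one_pow, Real.sq_sqrt (Nat.cast_nonneg s)]
  have e2 : ∀ r, partSum W Finset.univ (fun c => b c r) ⬝ᵥ u = ∑ c, b c r * (W c ⬝ᵥ u) := by
    intro r
    simp only [partSum]
    rw [sum_dotProduct]
    exact Finset.sum_congr rfl fun c _ => smul_dotProduct _ _ _
  have e3 : u ⬝ᵥ chaosMatrix (1 / s) W b *ᵥ u
      = 1 / s * ∑ r, ((∑ c, b c r * (W c ⬝ᵥ u)) ^ 2 - ∑ c, b c r ^ 2 * (W c ⬝ᵥ u) ^ 2) := by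
    simp only [chaosMatrix]
    rw [smul_mulVec, dotProduct_smul, smul_eq_mul, sum_mulVec, dotProduct_sum]
    congr 1
    refine Finset.sum_congr rfl fun r _ => ?_
    rw [sub_mulVec, dotProduct_sub, dotProduct_vecMulVec_mulVec, e2, ← sq, sum_mulVec,
      dotProduct_sum]
    congr 1
    refine Finset.sum_congr rfl fun c _ => ?_
    rw [smul_mulVec, dotProduct_smul, dotProduct_vecMulVec_mulVec, smul_eq_mul, sq (W c ⬝ᵥ u)]
  have e4 : ∑ r, ∑ c, b c r ^ 2 * (W c ⬝ᵥ u) ^ 2 = s * (W *ᵥ u ⬝ᵥ W *ᵥ u) := by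
    rw [Finset.sum_comm, dotProduct, Finset.mul_sum]
    refine Finset.sum_congr rfl fun c _ => ?_
    rw [← Finset.sum_mul, hb, sq]
    rfl
  rw [e3, Finset.sum_sub_distrib, mul_sub, e4, e1]
  field_simp

/-- All sketches outside a set of probability `β / 4` preserve the quadratic form of `A` up to the
factor `γ`, after regularisation at the scale `ρ` of the error of a rank `k` approximation. -/
theorem sketchLaw_bad_le {d k : ℕ} (A : Matrix (Fin n) (Fin d) ℝ) (Y : Matrix (Fin d) (Fin k) ℝ)
    {ρ : ℝ} (hρ : 0 < ρ) (hA : trace ((A - A * Y * Yᵀ)ᵀ * (A - A * Y * Yᵀ)) ≤ k * ρ ^ 2)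
    (hk : 1 ≤ k) (hs : 0 < s) (hm : 8 * s * k ≤ m) {β θ γ : ℝ} (hβ : 0 < β) (hβ1 : β < 1)
    (hθ : 0 < θ) (hγ : 0 < γ) (hθs : 64 * θ ≤ s) (hθγ : θ * γ = 6 * Real.log (2 * k / β))
    (hθm : 819200 * θ ^ 2 * k ≤ Real.log (2 * k / β) * m) :
    sketchLaw m n s {ω | ¬ ∀ u, |sketchMatrix ω *ᵥ (A *ᵥ u) ⬝ᵥ sketchMatrix ω *ᵥ (A *ᵥ u)
        - A *ᵥ u ⬝ᵥ A *ᵥ u| ≤ γ * (A *ᵥ u ⬝ᵥ A *ᵥ u + ρ ^ 2 * (u ⬝ᵥ u))}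
      ≤ ENNReal.ofReal (β / 4) := by
  classical
  obtain ⟨W, B, rfl, hB, hW, hW2⟩ := exists_ridge_factor A Y hρ hA
  set bad : Set (SketchSample m n s) := {ω | ¬ ∀ u, |sketchMatrix ω *ᵥ ((W * B) *ᵥ u) ⬝ᵥ
    sketchMatrix ω *ᵥ ((W * B) *ᵥ u) - (W * B) *ᵥ u ⬝ᵥ (W * B) *ᵥ u| ≤
      γ * ((W * B) *ᵥ u ⬝ᵥ (W * B) *ᵥ u + ρ ^ 2 * (u ⬝ᵥ u))} with hbad
  let F : Finset (Fin n → (Fin s ↪ Fin m) × (Fin s → ℤˣ)) := Finset.univ.filter fun ω => ω ∈ bad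
  have hmem : ∀ ω, ω ∈ F ↔ ω ∈ bad := fun ω => by
    simp only [F, Finset.mem_filter, Finset.mem_univ, true_and]
  have hF : ∀ ω ∈ F, ∃ u : Fin d → ℝ, u ⬝ᵥ u = 1 ∧
      γ ≤ |u ⬝ᵥ (chaosMatrix (1 / s) W fun c => sketchCol (ω c)) *ᵥ u| := by
    intro ω hω
    have hω' : ω ∈ bad := (hmem ω).1 hω
    obtain ⟨u, hu⟩ := not_forall.1 hω'
    rw [not_le, ← hB, ← mulVec_mulVec,
      ← dotProduct_chaosMatrix_mulVec hs (sketchMatrix_apply ω)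
        (fun c => sum_sketchCol_sq _) W] at hu
    set v := B *ᵥ u with hv
    have hv0 : 0 ≤ v ⬝ᵥ v := Finset.sum_nonneg fun _ _ => mul_self_nonneg _
    have hvpos : 0 < v ⬝ᵥ v := by
      refine hv0.lt_of_ne fun h => ?_
      have hvz : v = 0 := dotProduct_self_eq_zero.1 h.symm
      rw [hvz] at hu
      simp at hu
    have hr : 0 < Real.sqrt (v ⬝ᵥ v) := Real.sqrt_pos.2 hvpos
    have hrr : Real.sqrt (v ⬝ᵥ v) * Real.sqrt (v ⬝ᵥ v) = v ⬝ᵥ v := Real.mul_self_sqrt hv0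
    refine ⟨(Real.sqrt (v ⬝ᵥ v))⁻¹ • v, ?_, ?_⟩
    · rw [smul_dotProduct, dotProduct_smul, smul_eq_mul, smul_eq_mul, ← mul_assoc,
        ← mul_inv, hrr, inv_mul_cancel₀ hvpos.ne']
    · rw [smul_dotProduct, mulVec_smul, dotProduct_smul, smul_eq_mul, smul_eq_mul, ← mul_assoc,
        ← mul_inv, hrr, abs_mul, abs_of_pos (inv_pos.2 hvpos), inv_mul_eq_div, le_div_iff₀ hvpos]
      exact hu.le
  have hcount := card_chaosMatrix_ge_le (w := W) (fun u => by
      refine le_trans (le_of_eq ?_) (hW u)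
      rw [dotProduct]
      exact Finset.sum_congr rfl fun c _ => sq _) hk hs
    (by rw [← trace_transpose_mul_self_eq_sum]; exact hW2) hm hβ hβ1 hθ hγ hθs hθγ hθm F hF
  rw [sketchLaw, uniformOn_univ]
  have e1 : Measure.count bad = (F.card : ENNReal) := by
    let F' : Finset (SketchSample m n s) := F
    have : bad = ↑F' := by
      ext ω
      exact ((hmem ω).symm.trans Finset.mem_coe.symm)
    rw [this]
    exact Measure.count_apply_finset' trivial
  have e2 : (Fintype.card (SketchSample m n s) : ℝ)
      = (Fintype.card ((Fin s ↪ Fin m) × (Fin s → ℤˣ)) : ℝ) ^ n := by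
    have : Fintype.card (SketchSample m n s)
        = Fintype.card ((Fin s ↪ Fin m) × (Fin s → ℤˣ)) ^ n := by
      change Fintype.card (Fin n → (Fin s ↪ Fin m) × (Fin s → ℤˣ)) = _
      simp
    exact_mod_cast this
  have hne : Nonempty (SketchSample m n s) := by
    have : s ≤ m := by nlinarith
    exact ⟨fun _ => (Fin.castLEEmb this, fun _ => 1)⟩
  have hpos : (0 : ℝ) < Fintype.card (SketchSample m n s) := by
    exact_mod_cast Fintype.card_pos
  rw [e1]
  rw [inv_pow, ← e2, inv_mul_eq_div] at hcount
  rw [← ENNReal.ofReal_natCast F.card, ← ENNReal.ofReal_natCast (Fintype.card _),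
    ← ENNReal.ofReal_div_of_pos hpos]
  exact ENNReal.ofReal_le_ofReal hcount

end Failure

/-! ### Low rank approximation from a perturbed regularised sketch -/

section Projections

variable {κ ι : Type*} [Fintype κ] [Fintype ι]

lemma norm_sq_eq_trace (M : Matrix κ ι ℝ) : ‖M‖ ^ 2 = trace (Mᵀ * M) := by
  rw [trace_transpose_mul_self_eq_sum, Matrix.frobenius_norm_def, ← Real.rpow_natCast,
    ← Real.rpow_mul (by positivity)]
  norm_num
  exact Finset.sum_congr rfl fun i _ => Finset.sum_congr rfl fun j _ => sq _

lemma norm_sq_eq_sum (M : Matrix κ ι ℝ) : ‖M‖ ^ 2 = ∑ i, ∑ j, M i j ^ 2 := by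
  rw [norm_sq_eq_trace, trace_transpose_mul_self_eq_sum]
  exact Finset.sum_congr rfl fun i _ => Finset.sum_congr rfl fun j _ => (sq _).symm

lemma abs_trace_transpose_mul_le (M N : Matrix κ ι ℝ) : |trace (Mᵀ * N)| ≤ ‖M‖ * ‖N‖ := by
  refine abs_le_of_sq_le_sq ?_ (by positivity)
  have e : trace (Mᵀ * N) = ∑ p : κ × ι, M p.1 p.2 * N p.1 p.2 := by
    simp only [trace, diag, mul_apply, transpose_apply]
    rw [Finset.sum_comm, Fintype.sum_prod_type]
  rw [mul_pow, norm_sq_eq_sum, norm_sq_eq_sum, e]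
  refine (Finset.sum_mul_sq_le_sq_mul_sq _ _ _).trans (le_of_eq ?_)
  rw [Fintype.sum_prod_type, Fintype.sum_prod_type]

lemma norm_add_sq_add_norm_sub_sq (M N : Matrix κ ι ℝ) :
    ‖M + N‖ ^ 2 + ‖M - N‖ ^ 2 = 2 * (‖M‖ ^ 2 + ‖N‖ ^ 2) := by
  simp only [norm_sq_eq_sum, Matrix.add_apply, Matrix.sub_apply, Finset.mul_sum,
    ← Finset.sum_add_distrib]
  exact Finset.sum_congr rfl fun i _ => Finset.sum_congr rfl fun j _ => by ring

lemma trace_transpose_mul_mul {κ' : Type*} [Fintype κ'] (Z : Matrix ι κ ℝ) (G : Matrix ι κ' ℝ)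
    (V : Matrix κ' κ ℝ) : trace (Zᵀ * G * V) = trace (G * (V * Zᵀ)) := by
  rw [Matrix.mul_assoc, trace_mul_comm, Matrix.mul_assoc]

variable [DecidableEq ι] {R : Matrix ι ι ℝ}

lemma norm_mul_proj_le (M : Matrix κ ι ℝ) (h1 : Rᵀ = R) (h2 : R * R = R) : ‖M * R‖ ≤ ‖M‖ := by
  refine (sq_le_sq₀ (norm_nonneg _) (norm_nonneg _)).1 ?_
  have h := trace_mul_one_sub_proj M h1 h2
  rw [norm_sq_eq_trace, norm_sq_eq_trace]
  linarith [trace_transpose_mul_self_nonneg (M * (1 - R))]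

lemma norm_proj_mul_le (M : Matrix ι κ ℝ) (h1 : Rᵀ = R) (h2 : R * R = R) : ‖R * M‖ ≤ ‖M‖ := by
  rw [← Matrix.frobenius_norm_transpose, transpose_mul, h1, ← Matrix.frobenius_norm_transpose M]
  exact norm_mul_proj_le _ h1 h2

end Projections

/-- The difference `Q' - Q` of two complementary projections, split into pieces that are small
where both `A Q'` and `A Q` are. -/
lemma trace_mul_sub_proj {ι : Type*} [Fintype ι] [DecidableEq ι] {G P P' : Matrix ι ι ℝ}
    (hG : Gᵀ = G) (hP : Pᵀ = P) (hP' : P'ᵀ = P') (hPP' : P' * P' = P') :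
    trace (G * ((1 - P') - (1 - P))) = trace (G * ((1 - P') * P * (1 - P')))
      - trace (G * (P' * (1 - P) * P')) - 2 * trace (G * (P' * (1 - P) * (1 - P'))) := by
  have h1 : trace (G * (P' * (1 - P) * (1 - P'))) = trace (G * ((1 - P') * (1 - P) * P')) := by
    rw [← trace_transpose, transpose_mul, transpose_mul, transpose_mul, hG, trace_mul_comm]
    simp only [transpose_sub, transpose_one, hP, hP', Matrix.mul_assoc]
  have h2 : (1 - P') - (1 - P) = (1 - P') * P * (1 - P') - P' * (1 - P) * P'
      - P' * (1 - P) * (1 - P') - (1 - P') * (1 - P) * P' := by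
    have h3 : (1 - P') * (1 - P) * P' = -((1 - P') * P * P') := by
      rw [mul_sub, mul_one, sub_mul, sub_mul 1 P' P', one_mul, hPP', sub_self, zero_sub]
    rw [h3]
    noncomm_ring
  rw [h2, mul_sub, mul_sub, mul_sub, trace_sub, trace_sub, trace_sub, ← h1]
  ring

section Perturbation

variable {n m d k : ℕ}

lemma IsOrthoProj.mul_self {X : Matrix (Fin d) (Fin k) ℝ} (hX : IsOrthoProj X) :
    X * Xᵀ * (X * Xᵀ) = X * Xᵀ := by
  rw [Matrix.mul_assoc, ← Matrix.mul_assoc Xᵀ, hX, Matrix.one_mul]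

lemma IsOrthoProj.norm_sq {X : Matrix (Fin d) (Fin k) ℝ} (hX : IsOrthoProj X) :
    ‖X * Xᵀ‖ ^ 2 = k := by
  rw [norm_sq_eq_trace, transpose_mul, transpose_transpose, hX.mul_self, trace_mul_comm, hX]
  simp

lemma lowRankError_eq {r : ℕ} (B : Matrix (Fin r) (Fin d) ℝ) (X : Matrix (Fin d) (Fin k) ℝ) :
    lowRankError B X = ‖B * (1 - X * Xᵀ)‖ := by
  rw [lowRankError, Matrix.mul_sub, Matrix.mul_one, Matrix.mul_assoc]

variable {A : Matrix (Fin n) (Fin d) ℝ} {S : Matrix (Fin m) (Fin n) ℝ} {γ ρ : ℝ}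

lemma abs_norm_sq_sub_le
    (hS : ∀ u, |S *ᵥ (A *ᵥ u) ⬝ᵥ S *ᵥ (A *ᵥ u) - A *ᵥ u ⬝ᵥ A *ᵥ u| ≤
      γ * (A *ᵥ u ⬝ᵥ A *ᵥ u + ρ ^ 2 * (u ⬝ᵥ u))) (Z : Matrix (Fin d) (Fin d) ℝ) :
    |‖S * A * Z‖ ^ 2 - ‖A * Z‖ ^ 2| ≤ γ * (‖A * Z‖ ^ 2 + ρ ^ 2 * ‖Z‖ ^ 2) := by
  have e : ∀ {l : ℕ} (M : Matrix (Fin l) (Fin d) ℝ), ‖M‖ ^ 2 = ∑ j, Mᵀ j ⬝ᵥ Mᵀ j := by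
    intro l M
    rw [← Matrix.frobenius_norm_transpose, norm_sq_eq_trace, trace_transpose_mul_self_eq_sum]
  have e1 : ∀ j, (A * Z)ᵀ j = A *ᵥ Zᵀ j := fun j => rfl
  have e2 : ∀ j, (S * A * Z)ᵀ j = S *ᵥ (A *ᵥ Zᵀ j) := fun j => by
    rw [mulVec_mulVec]; rfl
  simp only [e, e1, e2]
  rw [← Finset.sum_sub_distrib, Finset.mul_sum, ← Finset.sum_add_distrib, Finset.mul_sum]
  exact (Finset.abs_sum_le_sum_abs _ _).trans (Finset.sum_le_sum fun j _ => hS _)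

/-- Closeness of the two quadratic forms passes to the bilinear forms by polarisation. -/
lemma abs_two_mul_trace_le
    (hS : ∀ u, |S *ᵥ (A *ᵥ u) ⬝ᵥ S *ᵥ (A *ᵥ u) - A *ᵥ u ⬝ᵥ A *ᵥ u| ≤
      γ * (A *ᵥ u ⬝ᵥ A *ᵥ u + ρ ^ 2 * (u ⬝ᵥ u))) (Z V : Matrix (Fin d) (Fin d) ℝ) :
    |2 * trace (Zᵀ * ((S * A)ᵀ * (S * A) - Aᵀ * A) * V)| ≤
      γ * (‖A * Z‖ ^ 2 + ρ ^ 2 * ‖Z‖ ^ 2 + (‖A * V‖ ^ 2 + ρ ^ 2 * ‖V‖ ^ 2)) := by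
  have hpol : ∀ {l : ℕ} (B : Matrix (Fin l) (Fin d) ℝ),
      4 * trace (Zᵀ * (Bᵀ * B) * V) = ‖B * (Z + V)‖ ^ 2 - ‖B * (Z - V)‖ ^ 2 := by
    intro l B
    have h : trace (Vᵀ * (Bᵀ * B) * Z) = trace (Zᵀ * (Bᵀ * B) * V) := by
      rw [← trace_transpose]
      simp only [transpose_mul, transpose_transpose, Matrix.mul_assoc]
    simp only [norm_sq_eq_trace, transpose_mul, transpose_add, transpose_sub, Matrix.mul_add,
      Matrix.mul_sub, Matrix.add_mul, Matrix.sub_mul, trace_add, trace_sub]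
    simp only [Matrix.mul_assoc] at h ⊢
    rw [h]
    ring
  have h1 := abs_norm_sq_sub_le hS (Z + V)
  have h2 := abs_norm_sq_sub_le hS (Z - V)
  have h3 := norm_add_sq_add_norm_sub_sq (A * Z) (A * V)
  have h4 := norm_add_sq_add_norm_sub_sq Z V
  rw [← Matrix.mul_add, ← Matrix.mul_sub] at h3
  have h5 : 4 * trace (Zᵀ * ((S * A)ᵀ * (S * A) - Aᵀ * A) * V)
      = (‖S * A * (Z + V)‖ ^ 2 - ‖A * (Z + V)‖ ^ 2)
        - (‖S * A * (Z - V)‖ ^ 2 - ‖A * (Z - V)‖ ^ 2) := by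
    rw [Matrix.mul_sub, Matrix.sub_mul, trace_sub, mul_sub, hpol, hpol]
    ring
  have h6 : γ * (‖A * (Z + V)‖ ^ 2 + ρ ^ 2 * ‖Z + V‖ ^ 2)
      + γ * (‖A * (Z - V)‖ ^ 2 + ρ ^ 2 * ‖Z - V‖ ^ 2)
      = 2 * (γ * (‖A * Z‖ ^ 2 + ρ ^ 2 * ‖Z‖ ^ 2 + (‖A * V‖ ^ 2 + ρ ^ 2 * ‖V‖ ^ 2))) := by
    linear_combination γ * h3 + γ * ρ ^ 2 * h4
  rw [abs_le] at h1 h2 ⊢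
  constructor <;> linarith [h1.1, h1.2, h2.1, h2.2]

/-- The error of the sketched objective on the difference of two projections. The cross term is
bounded after inserting the projection onto the row space of `P' Q`, which has rank at most `k`. -/
lemma abs_trace_sketch_error_le (hγ : 0 ≤ γ)
    (hS : ∀ u, |S *ᵥ (A *ᵥ u) ⬝ᵥ S *ᵥ (A *ᵥ u) - A *ᵥ u ⬝ᵥ A *ᵥ u| ≤
      γ * (A *ᵥ u ⬝ᵥ A *ᵥ u + ρ ^ 2 * (u ⬝ᵥ u)))
    {X Y : Matrix (Fin d) (Fin k) ℝ} (hX : IsOrthoProj X) (hY : IsOrthoProj Y) :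
    |trace (((S * A)ᵀ * (S * A) - Aᵀ * A) * ((1 - X * Xᵀ) - (1 - Y * Yᵀ)))| ≤
      4 * γ * ((lowRankError A X + lowRankError A Y) ^ 2 + k * ρ ^ 2) := by
  set G := (S * A)ᵀ * (S * A) - Aᵀ * A with hG
  have hGt : Gᵀ = G := by
    simp only [hG, transpose_sub, transpose_mul, transpose_transpose]
  obtain ⟨R, hR1, hR2, hR3, hR4⟩ := exists_rowSpace_proj (Xᵀ * (1 - Y * Yᵀ))
  rw [Fintype.card_fin] at hR4
  rw [lowRankError_eq, lowRankError_eq]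
  have hXR : X * Xᵀ * (1 - Y * Yᵀ) * R = X * Xᵀ * (1 - Y * Yᵀ) := by
    rw [Matrix.mul_assoc X, Matrix.mul_assoc, hR3]
  have hPk := hX.norm_sq
  have hPk' := hY.norm_sq
  have hPP := hX.mul_self
  have hPP' := hY.mul_self
  have hPt : (X * Xᵀ)ᵀ = X * Xᵀ := by simp
  have hPt' : (Y * Yᵀ)ᵀ = Y * Yᵀ := by simp
  clear hR3
  generalize X * Xᵀ = P' at *
  generalize Y * Yᵀ = P at *
  have hQt : (1 - P')ᵀ = 1 - P' := by simp [hPt]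
  have hQQ : (1 - P') * (1 - P') = 1 - P' := by rw [sub_mul, mul_sub, mul_sub, hPP]; simp
  have hQt' : (1 - P)ᵀ = 1 - P := by simp [hPt']
  have hQQ' : (1 - P) * (1 - P) = 1 - P := by rw [sub_mul, mul_sub, mul_sub, hPP']; simp
  set a := ‖A * (1 - P')‖ with ha
  set o := ‖A * (1 - P)‖ with ho
  have ha0 : 0 ≤ a := norm_nonneg _
  have ho0 : 0 ≤ o := norm_nonneg _
  have hao : a ^ 2 ≤ (a + o) ^ 2 := pow_le_pow_left₀ ha0 (by linarith) 2
  rw [trace_mul_sub_proj hGt hPt' hPt hPP]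
  -- the piece `Q' P Q'`
  have hone : |2 * trace (G * ((1 - P') * P * (1 - P')))| ≤
      γ * (2 * ((a + o) ^ 2 + k * ρ ^ 2)) := by
    have e : trace (G * ((1 - P') * P * (1 - P')))
        = trace (((1 - P') * P)ᵀ * G * ((1 - P') * P)) := by
      rw [trace_transpose_mul_mul, transpose_mul, hQt, hPt',
        Matrix.mul_assoc (1 - P') P (P * (1 - P')),
        ← Matrix.mul_assoc P P, hPP', ← Matrix.mul_assoc (1 - P') P (1 - P')]
    rw [e]
    refine (abs_two_mul_trace_le hS _ _).trans (mul_le_mul_of_nonneg_left ?_ hγ)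
    have h1 : ‖A * ((1 - P') * P)‖ ^ 2 ≤ a ^ 2 := by
      rw [← Matrix.mul_assoc]
      exact pow_le_pow_left₀ (norm_nonneg _) (norm_mul_proj_le _ hPt' hPP') 2
    have h2 : ‖(1 - P') * P‖ ^ 2 ≤ k := by
      rw [← hPk']
      exact pow_le_pow_left₀ (norm_nonneg _) (norm_proj_mul_le _ hQt hQQ) 2
    nlinarith [mul_le_mul_of_nonneg_left h2 (sq_nonneg ρ)]
  have hV1 : ‖A * (P' * (1 - P))‖ ^ 2 ≤ (a + o) ^ 2 := by
    refine pow_le_pow_left₀ (norm_nonneg _) ?_ 2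
    have e : A * (P' * (1 - P)) = A * (1 - P) - A * (1 - P') * (1 - P) := by
      rw [← Matrix.sub_mul, Matrix.mul_sub A, Matrix.mul_one, sub_sub_cancel, Matrix.mul_assoc]
    rw [e]
    refine (norm_sub_le _ _).trans ?_
    linarith [norm_mul_proj_le (A * (1 - P')) hQt' hQQ']
  have hV2 : ‖P' * (1 - P)‖ ^ 2 ≤ k := by
    rw [← hPk]
    exact pow_le_pow_left₀ (norm_nonneg _) (norm_mul_proj_le _ hQt' hQQ') 2
  -- the piece `P' Q P'`
  have htwo : |2 * trace (G * (P' * (1 - P) * P'))| ≤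
      γ * (2 * ((a + o) ^ 2 + k * ρ ^ 2)) := by
    have e : trace (G * (P' * (1 - P) * P'))
        = trace ((P' * (1 - P))ᵀ * G * (P' * (1 - P))) := by
      rw [trace_transpose_mul_mul, transpose_mul, hQt', hPt,
        Matrix.mul_assoc P' (1 - P) ((1 - P) * P'),
        ← Matrix.mul_assoc (1 - P) (1 - P), hQQ', ← Matrix.mul_assoc P' (1 - P) P']
    rw [e]
    refine (abs_two_mul_trace_le hS _ _).trans (mul_le_mul_of_nonneg_left ?_ hγ)
    nlinarith [mul_le_mul_of_nonneg_left hV2 (sq_nonneg ρ)]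
  -- the cross term `P' Q Q'`
  have hthree : |2 * trace (G * (P' * (1 - P) * (1 - P')))| ≤
      γ * (2 * ((a + o) ^ 2 + k * ρ ^ 2)) := by
    have e : trace (G * (P' * (1 - P) * (1 - P')))
        = trace (((1 - P') * R)ᵀ * G * (P' * (1 - P))) := by
      rw [trace_transpose_mul_mul, transpose_mul, hQt, hR1, ← Matrix.mul_assoc (P' * (1 - P)), hXR]
    rw [e]
    refine (abs_two_mul_trace_le hS _ _).trans (mul_le_mul_of_nonneg_left ?_ hγ)
    have h1 : ‖A * ((1 - P') * R)‖ ^ 2 ≤ a ^ 2 := by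
      rw [← Matrix.mul_assoc]
      exact pow_le_pow_left₀ (norm_nonneg _) (norm_mul_proj_le _ hR1 hR2) 2
    have h2 : ‖(1 - P') * R‖ ^ 2 ≤ k := by
      refine (pow_le_pow_left₀ (norm_nonneg _) (norm_proj_mul_le R hQt hQQ) 2).trans ?_
      rw [norm_sq_eq_trace, hR1, hR2]
      exact hR4
    nlinarith [mul_le_mul_of_nonneg_left h2 (sq_nonneg ρ),
      mul_le_mul_of_nonneg_left hV2 (sq_nonneg ρ)]
  rw [abs_le] at hone htwo hthree ⊢
  constructor <;> nlinarith [hone.1, hone.2, htwo.1, htwo.2, hthree.1, hthree.2]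

lemma le_of_quadratic_le {a o ν α : ℝ} (hα : 0 ≤ α) (hα1 : α ≤ 1) (ho : 0 ≤ o) (hν : 0 ≤ ν)
    (haν : 36 * ν ≤ a) (h : a ^ 2 - o ^ 2 ≤ α / 3 * a ^ 2 + 8 * a * ν + ν ^ 2) :
    a ≤ (1 + α) * o + 36 * ν := by
  have h1 : (a - 36 * ν) ^ 2 ≤ ((1 + α) * o) ^ 2 := by
    have h2 : 1 ≤ (1 + α) ^ 2 * (1 - α / 3) := by
      nlinarith [mul_nonneg hα hα, mul_nonneg (mul_nonneg hα hα) hα,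
        mul_nonneg hα (sub_nonneg.2 hα1)]
    have h3 : (1 + α) ^ 2 ≤ 4 := by nlinarith
    have h4 : (1 + α) ^ 2 * (8 * a * ν + ν ^ 2) ≤ 4 * (8 * a * ν + ν ^ 2) :=
      mul_le_mul_of_nonneg_right h3 (by have : 0 ≤ a := by linarith
                                        positivity)
    have h5 : (1 + α) ^ 2 * ((1 - α / 3) * a ^ 2 - (8 * a * ν + ν ^ 2)) ≤ (1 + α) ^ 2 * o ^ 2 :=
      mul_le_mul_of_nonneg_left (by linarith) (by positivity)
    have h6 := mul_le_mul_of_nonneg_right h2 (sq_nonneg a)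
    have h7 := mul_nonneg hν (sub_nonneg.2 haν)
    have h8 := mul_nonneg hν hν
    linarith
  linarith [(sq_le_sq₀ (by linarith) (by positivity)).1 h1]

/-- If the sketch `S` preserves the `ρ`-regularised quadratic form of `A`, then a projection that is
at least as good as `Y` for the noisy sketch `S A + N` is nearly as good as `Y` for `A`. -/
theorem lowRankError_le_of_sketch {N : Matrix (Fin m) (Fin d) ℝ} {X Y : Matrix (Fin d) (Fin k) ℝ}
    (hX : IsOrthoProj X) (hY : IsOrthoProj Y) {α T : ℝ} (hα : 0 < α) (hα1 : α ≤ 1) (hT : 0 ≤ T)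
    (hS : ∀ u, |S *ᵥ (A *ᵥ u) ⬝ᵥ S *ᵥ (A *ᵥ u) - A *ᵥ u ⬝ᵥ A *ᵥ u| ≤
      α / 96 * (A *ᵥ u ⬝ᵥ A *ᵥ u + ρ ^ 2 * (u ⬝ᵥ u)))
    (hρ : k * ρ ^ 2 = lowRankError A Y ^ 2 + T ^ 2)
    (hXY : lowRankError (S * A + N) X ^ 2 ≤ lowRankError (S * A + N) Y ^ 2) :
    lowRankError A X ≤ (1 + α) * lowRankError A Y + 36 * ‖N‖ + T := by
  have hG := abs_trace_sketch_error_le (by positivity) hS hX hY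
  rw [lowRankError_eq, lowRankError_eq] at *
  have hPk := hX.norm_sq
  have hPk' := hY.norm_sq
  have hPP := hX.mul_self
  have hPP' := hY.mul_self
  have hPt : (X * Xᵀ)ᵀ = X * Xᵀ := by simp
  have hPt' : (Y * Yᵀ)ᵀ = Y * Yᵀ := by simp
  have hPP0 : 0 ≤ trace (X * Xᵀ * (Y * Yᵀ)) := by
    have : trace (X * Xᵀ * (Y * Yᵀ)) = trace ((Xᵀ * Y)ᵀ * (Xᵀ * Y)) := by
      rw [transpose_mul, transpose_transpose, trace_mul_comm (X * Xᵀ), Matrix.mul_assoc Y,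
        trace_mul_comm Y]
      simp only [Matrix.mul_assoc]
    rw [this]
    exact trace_transpose_mul_self_nonneg _
  generalize X * Xᵀ = P' at *
  generalize Y * Yᵀ = P at *
  have hQt : (1 - P')ᵀ = 1 - P' := by simp [hPt]
  have hQQ : (1 - P') * (1 - P') = 1 - P' := by rw [sub_mul, mul_sub, mul_sub, hPP]; simp
  have hQt' : (1 - P)ᵀ = 1 - P := by simp [hPt']
  have hQQ' : (1 - P) * (1 - P) = 1 - P := by rw [sub_mul, mul_sub, mul_sub, hPP']; simp
  set a := ‖A * (1 - P')‖ with ha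
  set o := ‖A * (1 - P)‖ with ho
  set ν := ‖N‖ with hν
  have ha0 : 0 ≤ a := norm_nonneg _
  have ho0 : 0 ≤ o := norm_nonneg _
  have hν0 : 0 ≤ ν := norm_nonneg _
  by_cases hao : a ≤ o
  · nlinarith
  by_cases haT : a ≤ T
  · nlinarith
  by_cases haν : a ≤ 36 * ν
  · nlinarith
  push Not at hao haT haν
  set D := (1 - P') - (1 - P) with hD
  have hDt : Dᵀ = D := by rw [hD, transpose_sub, hQt, hQt']
  have hoT : o ^ 2 + T ^ 2 ≤ 2 * a ^ 2 := by
    have h1 := pow_le_pow_left₀ ho0 hao.le 2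
    have h2 := pow_le_pow_left₀ hT haT.le 2
    linarith
  have hao2 : (a + o) ^ 2 ≤ 4 * a ^ 2 := by
    have := pow_le_pow_left₀ (by linarith : 0 ≤ a + o) (by linarith : a + o ≤ 2 * a) 2
    linarith
  -- the sketched image of `D`
  have hSAD : ‖S * A * D‖ ≤ 4 * a := by
    refine (sq_le_sq₀ (norm_nonneg _) (by positivity)).1 ?_
    have h1 := (abs_le.1 (abs_norm_sq_sub_le hS D)).2
    have h2 : ‖A * D‖ ^ 2 ≤ 4 * a ^ 2 := by
      refine (pow_le_pow_left₀ (norm_nonneg _) ?_ 2).trans hao2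
      rw [hD, Matrix.mul_sub]
      exact norm_sub_le _ _
    have h3 : ‖D‖ ^ 2 ≤ 2 * k := by
      have e : D = P - P' := by rw [hD]; abel
      have e1 : ‖D‖ ^ 2 = ‖P‖ ^ 2 + ‖P'‖ ^ 2 - 2 * trace (P' * P) := by
        rw [e, norm_sq_eq_trace, norm_sq_eq_trace, norm_sq_eq_trace, transpose_sub, hPt, hPt',
          sub_mul, mul_sub, mul_sub, trace_sub, trace_sub, trace_sub, trace_mul_comm P P']
        ring
      rw [e1, hPk, hPk']
      linarith
    have h4 : ρ ^ 2 * ‖D‖ ^ 2 ≤ 4 * a ^ 2 := by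
      have := mul_le_mul_of_nonneg_left h3 (sq_nonneg ρ)
      linarith only [this, hρ, hoT]
    have h5 : α / 96 * (‖A * D‖ ^ 2 + ρ ^ 2 * ‖D‖ ^ 2) ≤ 1 * (4 * a ^ 2 + 4 * a ^ 2) :=
      mul_le_mul (by linarith only [hα1]) (add_le_add h2 h4)
        (add_nonneg (sq_nonneg _) (mul_nonneg (sq_nonneg _) (sq_nonneg _))) zero_le_one
    rw [mul_pow]
    linarith only [h1, h2, h5, sq_nonneg a]
  have hcross : |trace ((S * A * D)ᵀ * N)| ≤ 4 * a * ν :=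
    (abs_trace_transpose_mul_le _ _).trans (mul_le_mul_of_nonneg_right hSAD hν0)
  have hN : ‖N * (1 - P)‖ ^ 2 ≤ ν ^ 2 :=
    pow_le_pow_left₀ (norm_nonneg _) (norm_mul_proj_le _ hQt' hQQ') 2
  have hsq : ∀ {l : ℕ} (B : Matrix (Fin l) (Fin d) ℝ),
      ‖B * (1 - P')‖ ^ 2 - ‖B * (1 - P)‖ ^ 2 = trace (Bᵀ * B * D) := by
    intro l B
    rw [norm_sq_eq_trace, norm_sq_eq_trace, trace_mul_proj B hQt hQQ, trace_mul_proj B hQt' hQQ',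
      ← trace_sub, ← Matrix.mul_sub]
  have hexp : trace ((S * A + N)ᵀ * (S * A + N) * D)
      = trace (((S * A)ᵀ * (S * A) - Aᵀ * A) * D) + trace (Aᵀ * A * D)
        + 2 * trace ((S * A * D)ᵀ * N) + trace (Nᵀ * N * D) := by
    have e1 : trace ((S * A * D)ᵀ * N) = trace ((S * A)ᵀ * N * D) := by
      rw [transpose_mul, hDt, Matrix.mul_assoc, trace_mul_comm]
    have e2 : trace (Nᵀ * (S * A) * D) = trace ((S * A)ᵀ * N * D) := by
      rw [← e1, ← trace_transpose]
      simp only [transpose_mul, transpose_transpose, hDt, Matrix.mul_assoc]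
    rw [e1]
    simp only [transpose_add, Matrix.add_mul, Matrix.mul_add, Matrix.sub_mul, trace_add,
      trace_sub, e2]
    ring
  have hmain : a ^ 2 - o ^ 2 ≤ α / 3 * a ^ 2 + 8 * a * ν + ν ^ 2 := by
    have h1 := hsq (S * A + N)
    have h2 := hsq A
    have h3 := hsq N
    rw [hexp] at h1
    have h4 : (a + o) ^ 2 + k * ρ ^ 2 ≤ 8 * a ^ 2 := by
      rw [hρ]
      linarith only [hao2, hoT, sq_nonneg a]
    have h5 := mul_le_mul_of_nonneg_left h4 (by positivity : 0 ≤ 4 * (α / 96))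
    have h6 := (abs_le.1 hG).1
    have h7 := (abs_le.1 hcross).1
    have h8 := sq_nonneg ‖N * (1 - P')‖
    linarith only [h1, h2, h3, h5, h6, h7, h8, hXY, hN]
  exact (le_of_quadratic_le hα.le hα1 ho0 hν0 haν.le hmain).trans (by linarith)

end Perturbation

/-! ### The size of the sketched Gaussian noise -/

section Noise

lemma lintegral_pi_prod {ι : Type*} [Fintype ι] {E : ι → Type*} [∀ i, MeasurableSpace (E i)]
    (μ : ∀ i, Measure (E i)) [∀ i, IsProbabilityMeasure (μ i)] {f : ∀ i, E i → ENNReal}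
    (hf : ∀ i, Measurable (f i)) :
    ∫⁻ x, ∏ i, f i (x i) ∂Measure.pi μ = ∏ i, ∫⁻ y, f i y ∂μ i := by
  refine (lintegral_prod_eq_prod_lintegral_of_indepFun Finset.univ
    (fun i (x : ∀ i, E i) => f i (x i)) (iIndepFun_pi fun i => (hf i).aemeasurable)
    fun i => (hf i).comp (measurable_pi_apply i)).trans ?_
  refine Finset.prod_congr rfl fun i _ => ?_
  exact (measurePreserving_eval μ i).lintegral_comp (hf i)

lemma lintegral_exp_mul_gaussianReal (v : NNReal) (a : ℝ) :
    ∫⁻ x, ENNReal.ofReal (Real.exp (a * x)) ∂gaussianReal 0 v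
      = ENNReal.ofReal (Real.exp (v / 2 * a ^ 2)) := by
  rw [← ofReal_integral_eq_lintegral_ofReal (integrable_exp_mul_gaussianReal a)
    (ae_of_all _ fun _ => (Real.exp_pos _).le)]
  have h := congrFun (mgf_id_gaussianReal (μ := 0) (v := v)) a
  simp only [mgf, id] at h
  rw [h]
  congr 2
  ring

lemma ofReal_exp_sum {ι : Type*} (s : Finset ι) (f : ι → ℝ) :
    ENNReal.ofReal (Real.exp (∑ i ∈ s, f i)) = ∏ i ∈ s, ENNReal.ofReal (Real.exp (f i)) := by
  rw [Real.exp_sum, ENNReal.ofReal_prod_of_nonneg fun i _ => (Real.exp_pos _).le]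

lemma lintegral_exp_sum_gaussianReal {ι κ : Type*} [Fintype ι] [Fintype κ] (v : NNReal)
    (a : ι → κ → ℝ) :
    ∫⁻ g, ENNReal.ofReal (Real.exp (∑ c, ∑ p, a c p * g c p))
        ∂(Measure.pi fun _ : ι => Measure.pi fun _ : κ => gaussianReal 0 v)
      = ENNReal.ofReal (Real.exp (v / 2 * ∑ c, ∑ p, a c p ^ 2)) := by
  simp only [Finset.mul_sum, ofReal_exp_sum]
  rw [lintegral_pi_prod (fun _ : ι => Measure.pi fun _ : κ => gaussianReal 0 v)
    (f := fun c y => ∏ p, ENNReal.ofReal (Real.exp (a c p * y p))) (fun c => by fun_prop)]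
  refine Finset.prod_congr rfl fun c _ => ?_
  rw [lintegral_pi_prod (fun _ : κ => gaussianReal 0 v)
    (f := fun p y => ENNReal.ofReal (Real.exp (a c p * y))) (fun c => by fun_prop)]
  exact Finset.prod_congr rfl fun p _ => lintegral_exp_mul_gaussianReal v _

/-- Exponential moment of the square of a standard Gaussian variable. -/
lemma lintegral_exp_mul_sq_gaussianReal_le {x : ℝ} (hx : 0 ≤ x) (hx1 : x ≤ 1 / 4) :
    ∫⁻ h, ENNReal.ofReal (Real.exp (x * h ^ 2)) ∂gaussianReal 0 1
      ≤ ENNReal.ofReal (Real.exp (2 * x)) := by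
  have e : ∀ h : ℝ, gaussianPDFReal 0 1 h * Real.exp (x * h ^ 2)
      = (Real.sqrt (2 * Real.pi))⁻¹ * Real.exp (-(1 / 2 - x) * h ^ 2) := by
    intro h
    rw [gaussianPDFReal_def]
    simp only [NNReal.coe_one, mul_one, sub_zero]
    rw [mul_assoc, ← Real.exp_add]
    congr 2
    ring
  have hint : Integrable fun h : ℝ => gaussianPDFReal 0 1 h * Real.exp (x * h ^ 2) := by
    simp only [e]
    exact (integrable_exp_neg_mul_sq (by linarith)).const_mul _
  rw [gaussianReal_of_var_ne_zero _ one_ne_zero,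
    lintegral_withDensity_eq_lintegral_mul _ (measurable_gaussianPDF 0 1) (by fun_prop)]
  have e2 : ∀ h : ℝ, (gaussianPDF 0 1 * fun h => ENNReal.ofReal (Real.exp (x * h ^ 2))) h
      = ENNReal.ofReal (gaussianPDFReal 0 1 h * Real.exp (x * h ^ 2)) := by
    intro h
    rw [ENNReal.ofReal_mul (gaussianPDFReal_nonneg _ _ _)]
    rfl
  rw [lintegral_congr e2, ← ofReal_integral_eq_lintegral_ofReal hint (ae_of_all _ fun h =>
    mul_nonneg (gaussianPDFReal_nonneg _ _ _) (Real.exp_pos _).le)]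
  refine ENNReal.ofReal_le_ofReal ?_
  simp only [e]
  rw [integral_const_mul, integral_gaussian]
  have h1 : 1 ≤ Real.exp (4 * x) * (1 - 2 * x) := by
    have h2 := Real.add_one_le_exp (4 * x)
    have h3 := mul_le_mul_of_nonneg_right h2 (by linarith : 0 ≤ 1 - 2 * x)
    nlinarith
  rw [← Real.sqrt_inv, ← Real.sqrt_mul (by positivity)]
  refine Real.sqrt_le_iff.2 ⟨(Real.exp_pos _).le, ?_⟩
  rw [← Real.exp_nat_mul]
  have h4 : (2 * Real.pi)⁻¹ * (Real.pi / (1 / 2 - x)) = 1 / (1 - 2 * x) := by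
    have h5 : 1 / 2 - x ≠ 0 := by linarith
    have h6 : 1 - 2 * x ≠ 0 := by linarith
    have := Real.pi_pos.ne'
    field_simp
  rw [h4, div_le_iff₀ (by linarith)]
  refine h1.trans (le_of_eq ?_)
  congr 2
  push_cast
  ring

lemma lintegral_exp_sum_sq_gaussianReal_le {ι : Type*} [Fintype ι] {x : ι → ℝ}
    (hx : ∀ i, 0 ≤ x i) (hx1 : ∀ i, x i ≤ 1 / 4) :
    ∫⁻ h, ENNReal.ofReal (Real.exp (∑ i, x i * h i ^ 2))
        ∂(Measure.pi fun _ : ι => gaussianReal 0 1)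
      ≤ ENNReal.ofReal (Real.exp (2 * ∑ i, x i)) := by
  simp only [Finset.mul_sum, ofReal_exp_sum]
  rw [lintegral_pi_prod (fun _ : ι => gaussianReal 0 1)
    (f := fun i y => ENNReal.ofReal (Real.exp (x i * y ^ 2))) (fun i => by fun_prop)]
  exact Finset.prod_le_prod' fun i _ => lintegral_exp_mul_sq_gaussianReal_le (hx i) (hx1 i)

variable {m n s d : ℕ}

lemma sum_comm_four (F : Fin n → Fin s → Fin d → Fin m → ℝ) :
    ∑ c, ∑ i, ∑ j, ∑ r, F c i j r = ∑ r, ∑ j, ∑ c, ∑ i, F c i j r := by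
  have h1 : ∀ c, ∑ i, ∑ j, ∑ r, F c i j r = ∑ r, ∑ j, ∑ i, F c i j r := fun c => by
    rw [Finset.sum_comm, Finset.sum_congr rfl fun j _ => Finset.sum_comm]
    exact Finset.sum_comm
  rw [Finset.sum_congr rfl fun c _ => h1 c, Finset.sum_comm]
  exact Finset.sum_congr rfl fun r _ => Finset.sum_comm

/-- The unscaled sketch `∑ᵢ Sᵢ Gᵢ` of stacked messages. -/
noncomputable def blockSum (S : Fin s → Matrix (Fin m) (Fin n) ℝ)
    (g : Fin n → Fin s × Fin d → ℝ) : Matrix (Fin m) (Fin d) ℝ :=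
  ∑ i, S i * Matrix.of fun c j => g c (i, j)

lemma blockSum_apply (S : Fin s → Matrix (Fin m) (Fin n) ℝ) (g : Fin n → Fin s × Fin d → ℝ)
    (r : Fin m) (j : Fin d) : blockSum S g r j = ∑ c, ∑ i, S i r c * g c (i, j) := by
  simp only [blockSum, Matrix.sum_apply, mul_apply, of_apply]
  exact Finset.sum_comm

/-- Linearisation of the squared norm: `exp (x²/2)` is the moment generating function of a
standard Gaussian, and for a fixed Gaussian dual vector the noise enters linearly. -/
lemma lintegral_exp_norm_blockSum_sq (S : Fin s → Matrix (Fin m) (Fin n) ℝ) (v : NNReal) (u : ℝ) :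
    ∫⁻ g, ENNReal.ofReal (Real.exp (u ^ 2 / 2 * ‖blockSum (d := d) S g‖ ^ 2))
        ∂(Measure.pi fun _ : Fin n => Measure.pi fun _ : Fin s × Fin d => gaussianReal 0 v)
      = ∫⁻ h, ENNReal.ofReal (Real.exp (v / 2 * ∑ c, ∑ p : Fin s × Fin d,
          (u * ∑ r, S p.1 r c * h (r, p.2)) ^ 2))
        ∂(Measure.pi fun _ : Fin m × Fin d => gaussianReal 0 1) := by
  have h1 : ∀ g : Fin n → Fin s × Fin d → ℝ,
      ENNReal.ofReal (Real.exp (u ^ 2 / 2 * ‖blockSum (d := d) S g‖ ^ 2))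
        = ∫⁻ h : Fin m × Fin d → ℝ, ENNReal.ofReal (Real.exp (∑ c, ∑ p : Fin s × Fin d,
            (u * ∑ r, S p.1 r c * h (r, p.2)) * g c p))
          ∂(Measure.pi fun _ : Fin m × Fin d => gaussianReal 0 1) := by
    intro g
    have h2 : ∀ h : Fin m × Fin d → ℝ, ∑ c, ∑ p : Fin s × Fin d,
        (u * ∑ r, S p.1 r c * h (r, p.2)) * g c p
        = ∑ q : Fin m × Fin d, u * blockSum S g q.1 q.2 * h q := by
      intro h
      simp only [blockSum_apply, Fintype.sum_prod_type, Finset.mul_sum, Finset.sum_mul]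
      rw [sum_comm_four]
      refine Finset.sum_congr rfl fun r _ => Finset.sum_congr rfl fun j _ =>
        Finset.sum_congr rfl fun c _ => Finset.sum_congr rfl fun i _ => ?_
      ring
    simp only [h2, ofReal_exp_sum]
    rw [lintegral_pi_prod (fun _ : Fin m × Fin d => gaussianReal 0 1)
      (f := fun q y => ENNReal.ofReal (Real.exp (u * blockSum S g q.1 q.2 * y)))
      (fun q => by fun_prop)]
    simp only [lintegral_exp_mul_gaussianReal]
    rw [← ofReal_exp_sum, norm_sq_eq_sum, Fintype.sum_prod_type, Finset.mul_sum]
    congr 2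
    refine Finset.sum_congr rfl fun r _ => ?_
    rw [Finset.mul_sum]
    refine Finset.sum_congr rfl fun j _ => ?_
    rw [NNReal.coe_one]
    ring
  rw [lintegral_congr h1, lintegral_lintegral_swap]
  · exact lintegral_congr fun h => lintegral_exp_sum_gaussianReal v _
  · refine Measurable.aemeasurable ?_
    unfold Function.uncurry
    fun_prop

lemma sum_sketchPart_mul (ω : SketchSample m n s) (i : Fin s) (c : Fin n) (h : Fin m → ℝ) :
    (∑ r, sketchPart ω i r c * h r) ^ 2 = ∑ r, (if (ω c).1 i = r then 1 else 0) * h r ^ 2 := by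
  simp only [sketchPart, of_apply, ite_mul, zero_mul, one_mul, Finset.sum_ite_eq, Finset.mem_univ,
    if_true, mul_pow]
  rcases Int.units_eq_one_or ((ω c).2 i) with h | h <;> simp [h]

/-- Exponential moment of the squared Frobenius norm of the sketched noise. The square is linearised
by an auxiliary standard Gaussian matrix, after which the noise is integrated out entry by entry. -/
lemma lintegral_exp_norm_sketch_noise_le (hn : 0 < n) (ω : SketchSample m n s) {v : NNReal}
    (hv : v ≠ 0) :
    ∫⁻ g, ENNReal.ofReal (Real.exp (1 / (4 * v * n) * ‖blockSum (d := d) (sketchPart ω) g‖ ^ 2))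
        ∂(Measure.pi fun _ : Fin n => Measure.pi fun _ : Fin s × Fin d => gaussianReal 0 v)
      ≤ ENNReal.ofReal (Real.exp (s * d / 2)) := by
  have hv' : (0 : ℝ) < v := by exact_mod_cast pos_iff_ne_zero.2 hv
  have hn' : (0 : ℝ) < n := by exact_mod_cast hn
  let u : ℝ := Real.sqrt (1 / (2 * v * n))
  have hu : u ^ 2 = 1 / (2 * v * n) := Real.sq_sqrt (by positivity)
  have e : (1 : ℝ) / (4 * v * n) = u ^ 2 / 2 := by rw [hu]; field_simp; norm_num
  -- the number of messages that reach row `r`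
  let N : Fin m → ℝ := fun r => ∑ c, ∑ i, if (ω c).1 i = r then (1 : ℝ) else 0
  have hN0 : ∀ r, 0 ≤ N r := fun r =>
    Finset.sum_nonneg fun c _ => Finset.sum_nonneg fun i _ => by split_ifs <;> norm_num
  have hN1 : ∀ r, N r ≤ n := by
    intro r
    have h1 : ∀ c, ∑ i, (if (ω c).1 i = r then (1 : ℝ) else 0) ≤ 1 := by
      intro c
      rw [Finset.sum_boole]
      have : (Finset.univ.filter fun i => (ω c).1 i = r).card ≤ 1 :=
        Finset.card_le_one.2 fun a ha b hb => (ω c).1.injective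
          ((Finset.mem_filter.1 ha).2.trans (Finset.mem_filter.1 hb).2.symm)
      exact_mod_cast this
    refine (Finset.sum_le_sum fun c _ => h1 c).trans ?_
    simp
  have hNsum : ∑ r, N r = n * s := by
    simp only [N]
    rw [Finset.sum_comm]
    have h1 : ∀ c, ∑ r, ∑ i, (if (ω c).1 i = r then (1 : ℝ) else 0) = s := by
      intro c
      rw [Finset.sum_comm]
      simp
    rw [Finset.sum_congr rfl fun c _ => h1 c]
    simp
  rw [e, lintegral_exp_norm_blockSum_sq]
  have h1 : ∀ h : Fin m × Fin d → ℝ, (v : ℝ) / 2 * ∑ c, ∑ p : Fin s × Fin d,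
      (u * ∑ r, sketchPart ω p.1 r c * h (r, p.2)) ^ 2
      = ∑ q : Fin m × Fin d, N q.1 / (4 * n) * h q ^ 2 := by
    intro h
    have h2 : ∑ c, ∑ p : Fin s × Fin d, (u * ∑ r, sketchPart ω p.1 r c * h (r, p.2)) ^ 2
        = u ^ 2 * ∑ q : Fin m × Fin d, N q.1 * h q ^ 2 := by
      simp only [mul_pow, ← Finset.mul_sum]
      congr 1
      simp only [sum_sketchPart_mul ω _ _ fun r => h (r, _), Fintype.sum_prod_type, N,
        Finset.sum_mul]
      exact sum_comm_four _
    rw [h2, hu, Finset.mul_sum, Finset.mul_sum]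
    refine Finset.sum_congr rfl fun q _ => ?_
    field_simp
    ring
  simp only [h1]
  refine (lintegral_exp_sum_sq_gaussianReal_le (x := fun q : Fin m × Fin d => N q.1 / (4 * n))
    (fun q => div_nonneg (hN0 _) (by positivity)) fun q => ?_).trans ?_
  · rw [div_le_iff₀ (by positivity)]
    linarith [hN1 q.1]
  · refine ENNReal.ofReal_le_ofReal (Real.exp_le_exp.2 (le_of_eq ?_))
    rw [Fintype.sum_prod_type]
    simp only [Finset.sum_const, Finset.card_univ, Fintype.card_fin, nsmul_eq_mul,
      ← Finset.mul_sum, ← Finset.sum_div, hNsum]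
    field_simp
    ring

lemma measure_norm_sketch_noise_ge_le (hn : 0 < n) (ω : SketchSample m n s) {v : NNReal}
    (hv : v ≠ 0) :
    (Measure.pi fun _ : Fin n => Measure.pi fun _ : Fin s × Fin d => gaussianReal 0 v)
        {g | 6 * n * d * s * v ≤ ‖blockSum (d := d) (sketchPart ω) g‖ ^ 2}
      ≤ ENNReal.ofReal (Real.exp (-(s * d))) := by
  have hv' : (0 : ℝ) < v := by exact_mod_cast pos_iff_ne_zero.2 hv
  have hn' : (0 : ℝ) < n := by exact_mod_cast hn
  set μ := Measure.pi fun _ : Fin n => Measure.pi fun _ : Fin s × Fin d => gaussianReal 0 v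
  have hmeas : Measurable fun g : Fin n → Fin s × Fin d → ℝ =>
      ENNReal.ofReal (Real.exp (1 / (4 * v * n) * ‖blockSum (d := d) (sketchPart ω) g‖ ^ 2)) := by
    simp only [norm_sq_eq_sum, blockSum_apply]
    fun_prop
  have h1 := mul_meas_ge_le_lintegral (μ := μ) hmeas (ENNReal.ofReal (Real.exp (3 / 2 * (s * d))))
  have h2 := h1.trans (lintegral_exp_norm_sketch_noise_le hn ω hv)
  have h3 : {g | 6 * n * d * s * v ≤ ‖blockSum (d := d) (sketchPart ω) g‖ ^ 2} ⊆
      {g | ENNReal.ofReal (Real.exp (3 / 2 * (s * d))) ≤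
        ENNReal.ofReal
          (Real.exp (1 / (4 * v * n) * ‖blockSum (d := d) (sketchPart ω) g‖ ^ 2))} := by
    intro g hg
    refine ENNReal.ofReal_le_ofReal (Real.exp_le_exp.2 ?_)
    rw [one_div_mul_eq_div, le_div_iff₀ (by positivity)]
    have : 6 * n * d * s * v ≤ ‖blockSum (d := d) (sketchPart ω) g‖ ^ 2 := hg
    linarith
  refine (measure_mono h3).trans ?_
  have h4 : Real.exp (-(s * d)) = Real.exp (s * d / 2) / Real.exp (3 / 2 * (s * d)) := by
    rw [← Real.exp_sub]
    congr 1
    ring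
  rw [h4, ENNReal.ofReal_div_of_pos (Real.exp_pos _), ENNReal.le_div_iff_mul_le
    (Or.inl (by simp [Real.exp_pos])) (Or.inl ENNReal.ofReal_ne_top), mul_comm]
  exact h2

lemma linearTransform_add (ω : SketchSample m n s) (A : Matrix (Fin n) (Fin d) ℝ)
    (g : Fin n → Fin s × Fin d → ℝ) :
    linearTransform (sketchPart ω) (fun c p => A c p.2 + g c p)
      = sketchMatrix ω * A + (1 / Real.sqrt s) • blockSum (sketchPart ω) g := by
  have h : ∀ i : Fin s, (Matrix.of fun c j => A c j + g c (i, j))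
      = A + Matrix.of fun c j => g c (i, j) := fun i => rfl
  simp only [linearTransform, h, Matrix.mul_add, Finset.sum_add_distrib, smul_add, blockSum,
    sketchMatrix, Matrix.smul_mul, Matrix.sum_mul]

/-- Noise with variance `v` per message entry moves the sketch of `A` by at most `√(6 n d v)`, up
to probability `exp (-s d)`. -/
theorem pi_denseRandomizer_bad_le (hn : 0 < n) (hs : 0 < s) (ω : SketchSample m n s)
    (A : Matrix (Fin n) (Fin d) ℝ) {v : NNReal} (hv : v ≠ 0) :
    (Measure.pi fun c => denseRandomizer s (gaussianReal 0 v) (A c))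
        {Y | 6 * n * d * v ≤ ‖linearTransform (sketchPart ω) Y - sketchMatrix ω * A‖ ^ 2}
      ≤ ENNReal.ofReal (Real.exp (-(s * d))) := by
  have hs' : (0 : ℝ) < s := by exact_mod_cast hs
  have hf : ∀ c : Fin n, Measurable fun (g : Fin s × Fin d → ℝ) p => A c p.2 + g p := fun c => by
    fun_prop
  have hprob : ∀ c : Fin n, IsProbabilityMeasure ((Measure.pi fun _ : Fin s × Fin d =>
      gaussianReal 0 v).map fun (g : Fin s × Fin d → ℝ) p => A c p.2 + g p) := fun c =>
    Measure.isProbabilityMeasure_map (hf c).aemeasurable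
  simp only [denseRandomizer]
  rw [← Measure.pi_map_pi fun c => (hf c).aemeasurable, Measure.map_apply (by fun_prop)]
  · refine le_trans (measure_mono fun g hg => ?_) (measure_norm_sketch_noise_ge_le hn ω hv)
    have hsmul : ‖(1 / Real.sqrt s) • blockSum (sketchPart ω) g‖ ^ 2
        = 1 / s * ‖blockSum (sketchPart ω) g‖ ^ 2 := by
      simp only [norm_sq_eq_sum, Matrix.smul_apply, smul_eq_mul, mul_pow, div_pow,
        Real.sq_sqrt hs'.le, one_pow, Finset.mul_sum]
    rw [Set.mem_preimage, Set.mem_ofPred_eq, linearTransform_add, add_sub_cancel_left, hsmul] at hg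
    rw [Set.mem_ofPred_eq]
    rw [div_mul_eq_mul_div, one_mul, le_div_iff₀ hs'] at hg
    linarith
  · refine measurableSet_le measurable_const ?_
    simp only [norm_sq_eq_sum, linearTransform, Matrix.sub_apply, Matrix.smul_apply,
      Matrix.sum_apply, mul_apply, of_apply]
    fun_prop

end Noise

/-! ### Parameters -/

section Parameters

lemma ceil_le_two_mul {x : ℝ} (hx : 1 ≤ x) : (⌈x⌉₊ : ℝ) ≤ 2 * x := by
  linarith [Nat.ceil_lt_add_one (by linarith : 0 ≤ x)]

lemma half_le_log_two_mul_div {x β : ℝ} (hx : 1 ≤ x) (hβ : 0 < β) (hβ1 : β < 1) :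
    1 / 2 ≤ Real.log (2 * x / β) := by
  have h : Real.log 2 ≤ Real.log (2 * x / β) := by
    refine Real.log_le_log (by norm_num) ?_
    rw [le_div_iff₀ hβ]
    nlinarith
  linarith [Real.log_two_gt_d9]

lemma half_le_log_two_div {β : ℝ} (hβ : 0 < β) (hβ1 : β < 1) : 1 / 2 ≤ Real.log (2 / β) := by
  simpa using half_le_log_two_mul_div le_rfl hβ hβ1

/-- The cube of `log (2k/β)` costs only one factor `k` over the cube of `log (2/β)`. -/
lemma log_two_mul_div_pow_three_le {k : ℕ} (hk : 1 ≤ k) {β : ℝ} (hβ : 0 < β) (hβ1 : β < 1) :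
    Real.log (2 * k / β) ^ 3 ≤ 216 * k * Real.log (2 / β) ^ 3 := by
  have hk' : (1 : ℝ) ≤ k := by exact_mod_cast hk
  have e : Real.log (2 * k / β) = Real.log k + Real.log (2 / β) := by
    rw [← Real.log_mul (by positivity) (by positivity)]
    congr 1
    ring
  have hlb : Real.log 2 ≤ Real.log (2 / β) := by
    refine Real.log_le_log (by norm_num) ?_
    rw [le_div_iff₀ hβ]
    linarith
  have h2 := Real.log_two_gt_d9
  set z : ℝ := (k : ℝ) ^ (1 / 3 : ℝ) with hz
  have hz3 : z ^ 3 = k := by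
    rw [hz, ← Real.rpow_natCast, ← Real.rpow_mul (by positivity)]
    norm_num
  have hz1 : 1 ≤ z := Real.one_le_rpow hk' (by norm_num)
  have hlog : Real.log k ≤ 3 * z := by
    have := Real.log_le_rpow_div (x := (k : ℝ)) (by positivity) (ε := 1 / 3) (by norm_num)
    linarith
  have h3 : Real.log (2 * k / β) ≤ 6 * z * Real.log (2 / β) := by
    rw [e]
    nlinarith
  have h4 : 0 ≤ Real.log (2 * k / β) := by linarith [half_le_log_two_mul_div hk' hβ hβ1]
  calc Real.log (2 * k / β) ^ 3 ≤ (6 * z * Real.log (2 / β)) ^ 3 := pow_le_pow_left₀ h4 h3 3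
    _ = _ := by rw [mul_pow, mul_pow, hz3]; norm_num

lemma additiveError_pos {k d : ℕ} (hk : 1 ≤ k) (hkd : k ≤ d) {η α β ε δ : ℝ} (hη : 0 < η)
    (hα : 0 < α) (hβ : 0 < β) (hβ1 : β < 1) (hε : 0 < ε) (hδ : 0 < δ) (hδ1 : δ < 1) :
    0 < additiveError k d η α β ε δ := by
  have h1 := half_le_log_two_div hβ hβ1
  have h2 := half_le_log_two_div hδ hδ1
  have hd' : (1 : ℝ) ≤ d := by exact_mod_cast hk.trans hkd
  have hk' : (1 : ℝ) ≤ k := by exact_mod_cast hk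
  have h3 := half_le_log_two_mul_div hd' hβ hβ1
  have h4 : 0 < Real.log (2 / β) := by linarith
  have h5 : 0 < Real.log (2 / δ) := by linarith
  have h6 : 0 < Real.log (2 * d / β) := by linarith
  unfold additiveError
  positivity

lemma additiveError_sq {k d : ℕ} {η α β ε δ : ℝ}
    (hβ : 0 < β) (hβ1 : β < 1) (hδ : 0 < δ) (hδ1 : δ < 1) :
    additiveError k d η α β ε δ ^ 2 = η ^ 2 * k ^ 2 * d ^ 3 * α⁻¹ ^ 6 * Real.log (2 / β) ^ 3 *
      ε⁻¹ ^ 2 * Real.log (2 / δ) * Real.log (2 * d / β) ^ 2 := by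
  have h1 := half_le_log_two_div hβ hβ1
  have h2 := half_le_log_two_div hδ hδ1
  have e3 : ∀ x : ℝ, 0 ≤ x → (x ^ (3 / 2 : ℝ)) ^ 2 = x ^ 3 := by
    intro x hx
    rw [← Real.rpow_natCast, ← Real.rpow_mul hx, ← Real.rpow_natCast]
    norm_num
  have e1 : ∀ x : ℝ, 0 ≤ x → (x ^ (1 / 2 : ℝ)) ^ 2 = x := by
    intro x hx
    rw [← Real.rpow_natCast, ← Real.rpow_mul hx]
    norm_num
  unfold additiveError
  rw [mul_pow, mul_pow, mul_pow, mul_pow, mul_pow, div_pow, mul_pow, e3 _ (by positivity),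
    e3 _ (by linarith), e1 _ (by linarith), inv_pow α]
  ring

variable {n d k t' m s : ℕ} {cs cm η α β ε δ : ℝ}

/-- The trivial bound: below the threshold on `n` the squared Frobenius norm of `A` is within the
additive error. -/
lemma sq_norm_bound_of_small (hk : 1 ≤ k) (hkd : k ≤ d) (ht : 2 * t' < n) (hα : 0 < α)
    (hα1 : α ≤ 1) (hβ : 0 < β) (hβ1 : β < 1) (hε : 0 < ε) (hε1 : ε ≤ 1) (hδ : 0 < δ) (hδ1 : δ < 1)
    (hcm : 0 < cm) (hm1 : 1 ≤ m) (hsm : s ≤ m)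
    (hm : (m : ℝ) ≤ 2 * (cm * (k * Real.log (2 * k / β) / α ^ 2)))
    (hn : (n : ℝ) < 8 * m * Real.log (2 * d * m / δ) + s + t') :
    n * d * η ^ 2 ≤ 3584 * cm ^ 2 * additiveError k d η α β ε δ ^ 2 := by
  have hd' : (1 : ℝ) ≤ d := by exact_mod_cast hk.trans hkd
  have hk' : (1 : ℝ) ≤ k := by exact_mod_cast hk
  have hkd' : (k : ℝ) ≤ d := by exact_mod_cast hkd
  have hm1' : (1 : ℝ) ≤ m := by exact_mod_cast hm1
  have hsm' : (s : ℝ) ≤ m := by exact_mod_cast hsm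
  have ht' : 2 * (t' : ℝ) < n := by exact_mod_cast ht
  rw [additiveError_sq hβ hβ1 hδ hδ1]
  have hlb := half_le_log_two_div hβ hβ1
  have hld := half_le_log_two_div hδ hδ1
  have hl0 := half_le_log_two_mul_div hk' hβ hβ1
  have hlL : Real.log (2 * k / β) ≤ Real.log (2 * d / β) :=
    Real.log_le_log (by positivity) (by gcongr)
  have hlog : Real.log (2 * d * m / δ) ≤ d + m + Real.log (2 / δ) := by
    have e : 2 * d * m / δ = d * m * (2 / δ) := by ring
    rw [e, Real.log_mul (by positivity) (by positivity), Real.log_mul (by positivity)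
      (by positivity)]
    linarith [Real.log_le_self (by linarith : (0 : ℝ) ≤ d),
      Real.log_le_self (by linarith : (0 : ℝ) ≤ m)]
  set L := Real.log (2 * k / β)
  set lβ := Real.log (2 / β)
  set lδ := Real.log (2 / δ)
  set ld := Real.log (2 * d / β)
  set a := α⁻¹ with ha
  have ha1 : 1 ≤ a := (one_le_inv₀ hα).2 hα1
  have hε' : 1 ≤ ε⁻¹ := (one_le_inv₀ hε).2 hε1
  have hmd : (1 : ℝ) ≤ d * m := one_le_mul_of_one_le_of_one_le hd' hm1'
  have hsum : (d : ℝ) + m + lδ + 1 ≤ 7 * (d * m * lδ) := by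
    have h1 : (d : ℝ) ≤ d * m := le_mul_of_one_le_right (by linarith) hm1'
    have h2 : (m : ℝ) ≤ d * m := le_mul_of_one_le_left (by linarith) hd'
    have h3 : lδ ≤ d * m * lδ := le_mul_of_one_le_left (by linarith) hmd
    have h4 : (d * m : ℝ) * (1 / 2) ≤ d * m * lδ := mul_le_mul_of_nonneg_left hld (by linarith)
    linarith
  have hn1 : (n : ℝ) ≤ 112 * (d * m ^ 2 * lδ) := by
    have h1 : (m : ℝ) * Real.log (2 * d * m / δ) ≤ m * (d + m + lδ) :=
      mul_le_mul_of_nonneg_left hlog (by linarith)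
    have h2 : (m : ℝ) * (d + m + lδ + 1) ≤ m * (7 * (d * m * lδ)) :=
      mul_le_mul_of_nonneg_left hsum (by linarith)
    nlinarith
  have hm2 : (m : ℝ) ^ 2 ≤ 4 * cm ^ 2 * k ^ 2 * ld ^ 2 * a ^ 4 := by
    have h1 : (m : ℝ) ≤ 2 * cm * k * ld * a ^ 2 := by
      refine hm.trans ?_
      have e : 2 * (cm * (k * L / α ^ 2)) = 2 * cm * k * L * a ^ 2 := by
        rw [ha, inv_pow]; ring
      rw [e]
      gcongr
    calc (m : ℝ) ^ 2 ≤ (2 * cm * k * ld * a ^ 2) ^ 2 := pow_le_pow_left₀ (by linarith) h1 2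
      _ = _ := by ring
  have hld0 : 0 ≤ ld := by linarith
  have hlδ0 : 0 ≤ lδ := by linarith
  have h8 : 1 ≤ 8 * lβ ^ 3 := by
    have := pow_le_pow_left₀ (by norm_num) hlb 3
    linarith
  calc (n : ℝ) * d * η ^ 2
      ≤ 112 * (d * (4 * cm ^ 2 * k ^ 2 * ld ^ 2 * a ^ 4) * lδ) * d * η ^ 2 := by
        refine mul_le_mul_of_nonneg_right (mul_le_mul_of_nonneg_right (hn1.trans ?_)
          (by linarith)) (sq_nonneg η)
        gcongr
    _ = 448 * cm ^ 2 * (η ^ 2 * k ^ 2 * (d ^ 2 * 1) * (a ^ 4 * 1) * 1 * 1 * lδ * ld ^ 2) := by ring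
    _ ≤ 448 * cm ^ 2 * (η ^ 2 * k ^ 2 * (d ^ 2 * d) * (a ^ 4 * a ^ 2) * (8 * lβ ^ 3) * ε⁻¹ ^ 2 * lδ
          * ld ^ 2) := by
        gcongr
        · exact one_le_pow₀ ha1
        · exact one_le_pow₀ hε'
    _ = _ := by ring

/-- Insertion of the bounds for `s`, `m` and the logarithm `lX` into the noise variance `V`. -/
lemma noise_bound_aux {n d s m r k L lβ lδ ld a lX V e : ℝ} (hnr : n ≤ 4 * r) (hd : 0 ≤ d)
    (hs0 : 0 ≤ s) (hm0 : 0 ≤ m) (hk : 0 ≤ k) (hcs : 0 < cs) (hcm : 0 < cm) (ha1 : 1 ≤ a)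
    (hL0 : 0 ≤ L) (hlb : 0 ≤ lβ) (hlδ : 1 / 2 ≤ lδ) (hld : 1 / 2 ≤ ld) (hlL : L ≤ ld)
    (hL3 : L ^ 3 ≤ 216 * k * lβ ^ 3) (hs : s ≤ 2 * cs * L * a) (hm : m ≤ 2 * cm * k * L * a ^ 2)
    (hlX0 : 0 ≤ lX) (hlX : lX ≤ s + ld + 2 * lδ) (hV0 : 0 ≤ V)
    (hV : V * r = 4 * s ^ 3 * η ^ 2 * lX * m * d ^ 2 * e ^ 2) :
    6 * n * d * V ≤ 331776 * cs ^ 3 * cm * (4 * cs + 6) *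
      (η ^ 2 * k ^ 2 * d ^ 3 * a ^ 6 * lβ ^ 3 * e ^ 2 * lδ * ld ^ 2) := by
  have hld0 : 0 ≤ ld := by linarith
  have hlδ0 : 0 ≤ lδ := by linarith
  have ha0 : 0 ≤ a := by linarith
  have hlX2 : lX ≤ (4 * cs + 6) * (ld * lδ * a) := by
    have h1 : s ≤ 2 * cs * ld * a := hs.trans (by gcongr)
    have h2 : ld * a ≤ 2 * (ld * lδ * a) := by
      have : ld * a * (1 / 2) ≤ ld * a * lδ := mul_le_mul_of_nonneg_left hlδ (by positivity)
      linarith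
    have h3 : ld ≤ ld * a := le_mul_of_one_le_right hld0 ha1
    have h4 : lδ ≤ 2 * (ld * lδ * a) := by
      have h5 : lδ ≤ lδ * a := le_mul_of_one_le_right hlδ0 ha1
      have : lδ * a * (1 / 2) ≤ lδ * a * ld := mul_le_mul_of_nonneg_left hld (by positivity)
      linarith
    have h6 := mul_le_mul_of_nonneg_left h2 hcs.le
    linarith
  have h3 : s ^ 3 ≤ (2 * cs * L * a) ^ 3 := pow_le_pow_left₀ hs0 hs 3
  have h4 : s ^ 3 * m * lX ≤ (2 * cs * L * a) ^ 3 * (2 * cm * k * L * a ^ 2) *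
      ((4 * cs + 6) * (ld * lδ * a)) :=
    mul_le_mul (mul_le_mul h3 hm hm0 (by positivity)) hlX2 hlX0 (by positivity)
  have h1 : L ^ 3 * L ≤ 216 * k * lβ ^ 3 * ld :=
    mul_le_mul hL3 hlL hL0 (by positivity)
  have h2 : 0 ≤ η ^ 2 * d ^ 3 * e ^ 2 := by positivity
  have h5 : 0 ≤ 1536 * cs ^ 3 * cm * (4 * cs + 6) * (k * a ^ 6 * lδ * ld) *
      (η ^ 2 * d ^ 3 * e ^ 2) := by positivity
  calc 6 * n * d * V = 6 * (d * V) * n := by ring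
    _ ≤ 6 * (d * V) * (4 * r) := mul_le_mul_of_nonneg_left hnr (by positivity)
    _ = 24 * d * (V * r) := by ring
    _ = 96 * (η ^ 2 * d ^ 3 * e ^ 2) * (s ^ 3 * m * lX) := by rw [hV]; ring
    _ ≤ 96 * (η ^ 2 * d ^ 3 * e ^ 2) * ((2 * cs * L * a) ^ 3 * (2 * cm * k * L * a ^ 2) *
          ((4 * cs + 6) * (ld * lδ * a))) := mul_le_mul_of_nonneg_left h4 (by positivity)
    _ = 1536 * cs ^ 3 * cm * (4 * cs + 6) * (k * a ^ 6 * lδ * ld) *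
          (η ^ 2 * d ^ 3 * e ^ 2) * (L ^ 3 * L) := by ring
    _ ≤ 1536 * cs ^ 3 * cm * (4 * cs + 6) * (k * a ^ 6 * lδ * ld) *
          (η ^ 2 * d ^ 3 * e ^ 2) * (216 * k * lβ ^ 3 * ld) := mul_le_mul_of_nonneg_left h1 h5
    _ = _ := by ring

/-- The logarithm in the noise variance, when the failure term `f` leaves at least half of
`δ / d`. -/
lemma log_noise_bounds {s d f : ℝ} (hs : 1 ≤ s) (hd : 1 ≤ d) (hδ : 0 < δ) (hδ1 : δ < 1)
    (hf0 : 0 ≤ f) (hf : f ≤ δ / (2 * d)) :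
    0 < Real.log (1.25 * s / (δ / d - f)) ∧
      Real.log (1.25 * s / (δ / d - f)) ≤ s + Real.log d + 2 * Real.log (2 / δ) := by
  have hd0 : 0 < d := by linarith
  have hhalf : δ / d - δ / (2 * d) = δ / (2 * d) := by field_simp; norm_num
  have hgap : δ / (2 * d) ≤ δ / d - f := by linarith
  have hδd : 0 < δ / (2 * d) := by positivity
  have hδd1 : δ / d ≤ 1 := by
    rw [div_le_one hd0]; linarith
  have hX1 : 1 < 1.25 * s / (δ / d - f) := by
    rw [lt_div_iff₀ (by linarith)]
    linarith
  have hX2 : 1.25 * s / (δ / d - f) ≤ s * d * (2 / δ) ^ 2 := by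
    rw [div_le_iff₀ (by linarith)]
    have h1 : s * d * (2 / δ) ^ 2 * (δ / (2 * d)) ≤ s * d * (2 / δ) ^ 2 * (δ / d - f) :=
      mul_le_mul_of_nonneg_left hgap (by positivity)
    refine le_trans ?_ h1
    have e : s * d * (2 / δ) ^ 2 * (δ / (2 * d)) = 2 * s / δ := by
      field_simp
    rw [e, le_div_iff₀ hδ]
    nlinarith
  refine ⟨Real.log_pos hX1, (Real.log_le_log (by linarith) hX2).trans ?_⟩
  rw [Real.log_mul (by positivity) (by positivity), Real.log_mul (by positivity) (by positivity),
    Real.log_pow]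
  have h1 := Real.log_le_self (by linarith : 0 ≤ s)
  push_cast
  linarith

/-- Above the threshold on `n` the randomizer adds noise, its variance is given by the formula, and
`√(6 n d v)` is within the additive error. -/
lemma noise_bound_of_large (hk : 1 ≤ k) (hkd : k ≤ d) (ht : 2 * t' < n) (hη : 0 < η) (hα : 0 < α)
    (hα1 : α ≤ 1) (hβ : 0 < β) (hβ1 : β < 1) (hε : 0 < ε) (hδ : 0 < δ) (hδ1 : δ < 1)
    (hcs : 0 < cs) (hcm : 0 < cm) (hs1 : 1 ≤ s) (hsm : s ≤ m)
    (hs : (s : ℝ) ≤ 2 * (cs * (Real.log (2 * k / β) / α)))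
    (hm : (m : ℝ) ≤ 2 * (cm * (k * Real.log (2 * k / β) / α ^ 2)))
    (hn : 8 * m * Real.log (2 * d * m / δ) + s + t' ≤ (n : ℝ)) :
    8 * m * Real.log (d * m / δ) + t' ≤ (n : ℝ) ∧ failureTerm n m s t' < δ / d ∧
    0 < noiseVariance n d m s t' η ε δ ∧
    6 * n * d * noiseVariance n d m s t' η ε δ ≤
      331776 * cs ^ 3 * cm * (4 * cs + 6) * additiveError k d η α β ε δ ^ 2 := by
  have hd' : (1 : ℝ) ≤ d := by exact_mod_cast hk.trans hkd
  have hk' : (1 : ℝ) ≤ k := by exact_mod_cast hk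
  have hkd' : (k : ℝ) ≤ d := by exact_mod_cast hkd
  have hs1' : (1 : ℝ) ≤ s := by exact_mod_cast hs1
  have hsm' : (s : ℝ) ≤ m := by exact_mod_cast hsm
  have hm1' : (1 : ℝ) ≤ m := hs1'.trans hsm'
  have ht' : 2 * (t' : ℝ) < n := by exact_mod_cast ht
  have hlb := half_le_log_two_div hβ hβ1
  have hld := half_le_log_two_div hδ hδ1
  have hl0 := half_le_log_two_mul_div hk' hβ hβ1
  have hdm : (1 : ℝ) ≤ d * m := one_le_mul_of_one_le_of_one_le hd' hm1'
  have hlam : 1 / 2 ≤ Real.log (2 * d * m / δ) := by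
    rw [mul_assoc]
    exact half_le_log_two_mul_div hdm hδ hδ1
  have hlL : Real.log (2 * k / β) ≤ Real.log (2 * d / β) :=
    Real.log_le_log (by positivity) (by gcongr)
  have hL3 := log_two_mul_div_pow_three_le hk hβ hβ1
  set r : ℝ := (n : ℝ) - s - t' with hr
  have hr8 : 8 * m * Real.log (2 * d * m / δ) ≤ r := by linarith
  have hrs : (s : ℝ) ≤ r := by nlinarith
  have hr0 : 0 < r := by linarith
  have hnr : (n : ℝ) ≤ 4 * r := by linarith
  have hfail : failureTerm n m s t' ≤ δ / (2 * d) := by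
    rw [failureTerm]
    have h1 : Real.exp (-r / (8 * m)) ≤ Real.exp (-Real.log (2 * d * m / δ)) := by
      refine Real.exp_le_exp.2 ?_
      rw [neg_div, neg_le_neg_iff, le_div_iff₀ (by positivity)]
      linarith
    rw [Real.exp_neg, Real.exp_log (by positivity)] at h1
    calc (m : ℝ) * Real.exp (-r / (8 * m)) ≤ m * (2 * d * m / δ)⁻¹ :=
          mul_le_mul_of_nonneg_left h1 (by linarith)
      _ = _ := by
          field_simp
  have hfail0 : 0 ≤ failureTerm n m s t' := by
    unfold failureTerm; positivity
  have hhalf : δ / (2 * d) < δ / d := div_lt_div_of_pos_left hδ (by linarith) (by linarith)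
  obtain ⟨hlogX0, hlogX'⟩ := log_noise_bounds hs1' hd' hδ hδ1 hfail0 hfail
  have hvpos : 0 < noiseVariance n d m s t' η ε δ := by
    unfold noiseVariance
    rw [← hr]
    positivity
  refine ⟨?_, by linarith, hvpos, ?_⟩
  · have h1 : Real.log (d * m / δ) ≤ Real.log (2 * d * m / δ) := by
      refine Real.log_le_log (by positivity) ?_
      gcongr
      linarith
    have h2 := mul_le_mul_of_nonneg_left h1 (by positivity : (0 : ℝ) ≤ 8 * m)
    linarith
  have hlogX : Real.log (1.25 * s / (δ / d - failureTerm n m s t')) ≤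
      s + Real.log (2 * d / β) + 2 * Real.log (2 / δ) := by
    have h2 : Real.log d ≤ Real.log (2 * d / β) := by
      refine Real.log_le_log (by linarith) ?_
      rw [le_div_iff₀ hβ]
      nlinarith
    linarith
  rw [additiveError_sq hβ hβ1 hδ hδ1]
  have hv : noiseVariance n d m s t' η ε δ * r = 4 * s ^ 3 * η ^ 2 *
      Real.log (1.25 * s / (δ / d - failureTerm n m s t')) * m * d ^ 2 * ε⁻¹ ^ 2 := by
    unfold noiseVariance
    rw [← hr]
    field_simp
  have hs2 : (s : ℝ) ≤ 2 * cs * Real.log (2 * k / β) * α⁻¹ := by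
    refine hs.trans (le_of_eq ?_)
    ring
  have hm2 : (m : ℝ) ≤ 2 * cm * k * Real.log (2 * k / β) * α⁻¹ ^ 2 := by
    refine hm.trans (le_of_eq ?_)
    rw [inv_pow]; ring
  exact noise_bound_aux hnr (by linarith) (by linarith) (by linarith) (by linarith) hcs hcm
    ((one_le_inv₀ hα).2 hα1) (by linarith) (by linarith) hld (by linarith) hlL hL3 hs2 hm2
    hlogX0.le hlogX hvpos.le hv

end Parameters

/-! ### The good event -/

section Assembly

variable {n d k t' m s : ℕ} {cs cm η α β ε δ : ℝ} {v : NNReal}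

lemma isProbabilityMeasure_denseRandomizer (x : Fin d → ℝ) :
    IsProbabilityMeasure (denseRandomizer s (gaussianReal 0 v) x) :=
  Measure.isProbabilityMeasure_map (Measurable.aemeasurable (by fun_prop))

lemma isProbabilityMeasure_sparseRandomizer (x : Fin d → ℝ) :
    IsProbabilityMeasure (sparseRandomizer n m s t' δ (gaussianReal 0 v) x) := by
  unfold sparseRandomizer
  split_ifs
  · infer_instance
  · exact isProbabilityMeasure_denseRandomizer x

lemma isProbabilityMeasure_sketchLaw (hsm : s ≤ m) : IsProbabilityMeasure (sketchLaw m n s) := by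
  have : Nonempty (SketchSample m n s) := ⟨fun _ => (Fin.castLEEmb hsm, fun _ => 1)⟩
  have : Finite (SketchSample m n s) := Finite.of_fintype _
  unfold sketchLaw
  infer_instance

lemma runLaw_univ (hsm : s ≤ m) (A : Matrix (Fin n) (Fin d) ℝ) :
    runLaw m s t' δ (gaussianReal 0 v) A Set.univ = 1 := by
  have := isProbabilityMeasure_sketchLaw (n := n) hsm
  have h : ∀ c, IsProbabilityMeasure (sparseRandomizer n m s t' δ (gaussianReal 0 v) (A c)) :=
    fun c => isProbabilityMeasure_sparseRandomizer (A c)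
  unfold runLaw
  exact measure_univ

/-- A set of sketches of probability at least `1 - β / 4`, together with the event that the noise is
small, has probability at least `1 - β`. -/
lemma runLaw_good_ge (hn : 0 < n) (hs : 0 < s) (hsm : s ≤ m) (hβ : 0 < β)
    (A : Matrix (Fin n) (Fin d) ℝ) (hv : v ≠ 0)
    (hdense : 8 * m * Real.log (d * m / δ) + t' ≤ (n : ℝ)) {G : Set (SketchSample m n s)}
    (hG : sketchLaw m n s Gᶜ ≤ ENNReal.ofReal (β / 4)) (hexp : Real.exp (-(s * d)) ≤ β / 2) :
    MeasurableSet {p : SketchSample m n s × (Fin n → Fin s × Fin d → ℝ) | p.1 ∈ G ∧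
        ‖linearTransform (sketchPart p.1) p.2 - sketchMatrix p.1 * A‖ ^ 2 < 6 * n * d * v} ∧
      ENNReal.ofReal (1 - β) ≤ runLaw m s t' δ (gaussianReal 0 v) A
        {p | p.1 ∈ G ∧
          ‖linearTransform (sketchPart p.1) p.2 - sketchMatrix p.1 * A‖ ^ 2 < 6 * n * d * v} := by
  have hprob := isProbabilityMeasure_sketchLaw (n := n) hsm
  have hfin : Finite (SketchSample m n s) := Finite.of_fintype _
  have hcount : Countable (SketchSample m n s) := Finite.to_countable
  set E : Set (SketchSample m n s × (Fin n → Fin s × Fin d → ℝ)) := {p | p.1 ∈ G ∧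
    ‖linearTransform (sketchPart p.1) p.2 - sketchMatrix p.1 * A‖ ^ 2 < 6 * n * d * v} with hE
  let B : SketchSample m n s → Set (Fin n → Fin s × Fin d → ℝ) := fun ω =>
    {Y | 6 * n * d * v ≤ ‖linearTransform (sketchPart ω) Y - sketchMatrix ω * A‖ ^ 2}
  have hB : ∀ ω, MeasurableSet (B ω) := by
    intro ω
    refine measurableSet_le measurable_const ?_
    simp only [norm_sq_eq_sum, linearTransform, Matrix.sub_apply, Matrix.smul_apply,
      Matrix.sum_apply, mul_apply, of_apply]
    fun_prop
  let E₁ : Set (SketchSample m n s × (Fin n → Fin s × Fin d → ℝ)) := Gᶜ ×ˢ Set.univ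
  let E₂ : Set (SketchSample m n s × (Fin n → Fin s × Fin d → ℝ)) := ⋃ ω, {ω} ×ˢ B ω
  have hGm : MeasurableSet Gᶜ := trivial
  have hE₁ : MeasurableSet E₁ := hGm.prod MeasurableSet.univ
  have hE₂ : MeasurableSet E₂ := MeasurableSet.iUnion fun ω =>
    MeasurableSet.prod (s := {ω}) trivial (hB ω)
  have hEc : Eᶜ = E₁ ∪ E₂ := by
    ext p
    simp only [hE, E₁, E₂, B, Set.mem_compl_iff, Set.mem_ofPred_eq, not_and_or, not_lt,
      Set.mem_union, Set.mem_prod, Set.mem_univ, and_true, Set.mem_iUnion, Set.mem_singleton_iff]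
    refine or_congr_right ⟨fun h => ⟨p.1, rfl, h⟩, ?_⟩
    rintro ⟨ω, h1, h2⟩
    rw [h1]
    exact h2
  have hEm : MeasurableSet E := by
    rw [← compl_compl E, hEc]
    exact (hE₁.union hE₂).compl
  refine ⟨hEm, ?_⟩
  have hlaw : runLaw m s t' δ (gaussianReal 0 v) A = (sketchLaw m n s).prod
      (Measure.pi fun c => denseRandomizer s (gaussianReal 0 v) (A c)) := by
    simp only [runLaw, sparseRandomizer, if_neg (not_lt.2 hdense)]
  rw [hlaw]
  set ν := Measure.pi fun c => denseRandomizer s (gaussianReal 0 v) (A c)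
  have hdr : ∀ c, IsProbabilityMeasure (denseRandomizer s (gaussianReal 0 v) (A c)) :=
    fun c => isProbabilityMeasure_denseRandomizer (A c)
  have hν : IsProbabilityMeasure ν := by
    unfold ν
    infer_instance
  have h1 : (sketchLaw m n s).prod ν E₁ ≤ ENNReal.ofReal (β / 4) := by
    rw [Measure.prod_prod, measure_univ, mul_one]
    exact hG
  have h2 : (sketchLaw m n s).prod ν E₂ ≤ ENNReal.ofReal (β / 2) := by
    rw [Measure.prod_apply hE₂]
    have h3 : ∀ ω, ν (Prod.mk ω ⁻¹' E₂) ≤ ENNReal.ofReal (β / 2) := by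
      intro ω
      have e : Prod.mk ω ⁻¹' E₂ = B ω := by
        ext Y
        simp [E₂]
      rw [e]
      exact (pi_denseRandomizer_bad_le hn hs ω A hv).trans (ENNReal.ofReal_le_ofReal hexp)
    refine (lintegral_mono h3).trans ?_
    rw [lintegral_const, measure_univ, mul_one]
  have h3 : (sketchLaw m n s).prod ν Eᶜ ≤ ENNReal.ofReal β := by
    rw [hEc]
    refine (measure_union_le _ _).trans ((add_le_add h1 h2).trans ?_)
    rw [← ENNReal.ofReal_add (by linarith) (by linarith)]
    exact ENNReal.ofReal_le_ofReal (by linarith)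
  rw [ENNReal.ofReal_sub _ hβ.le, ENNReal.ofReal_one, tsub_le_iff_right]
  calc (1 : ENNReal) = (sketchLaw m n s).prod ν (E ∪ Eᶜ) := by
        rw [Set.union_compl_self, measure_univ]
    _ ≤ (sketchLaw m n s).prod ν E + (sketchLaw m n s).prod ν Eᶜ := measure_union_le _ _
    _ ≤ _ := by gcongr

lemma IsLowRankSolver.exists_lt_lowRankOpt_add {r : ℕ}
    {Ak : Matrix (Fin r) (Fin d) ℝ → Matrix (Fin d) (Fin k) ℝ} (hAk : IsLowRankSolver Ak)
    (A : Matrix (Fin n) (Fin d) ℝ) {T : ℝ} (hT : 0 < T) :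
    ∃ Y : Matrix (Fin d) (Fin k) ℝ, IsOrthoProj Y ∧ lowRankError A Y < lowRankOpt k A + T := by
  have : Nonempty {X : Matrix (Fin d) (Fin k) ℝ // IsOrthoProj X} := ⟨⟨Ak 0, (hAk 0).1⟩⟩
  obtain ⟨Y, hY⟩ := exists_lt_of_ciInf_lt (f := fun X : {X : Matrix (Fin d) (Fin k) ℝ //
    IsOrthoProj X} => lowRankError A X.1) (lt_add_of_pos_right (lowRankOpt k A) hT)
  exact ⟨Y.1, Y.2, hY⟩

lemma lowRankOpt_nonneg (A : Matrix (Fin n) (Fin d) ℝ) : 0 ≤ lowRankOpt k A :=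
  Real.iInf_nonneg fun _ => norm_nonneg _

lemma lowRankError_le_norm (A : Matrix (Fin n) (Fin d) ℝ) {X : Matrix (Fin d) (Fin k) ℝ}
    (hX : IsOrthoProj X) : lowRankError A X ≤ ‖A‖ := by
  rw [lowRankError_eq]
  refine norm_mul_proj_le A (by simp) ?_
  rw [sub_mul, mul_sub, mul_sub, hX.mul_self]
  simp

lemma norm_sq_le_of_abs_le {A : Matrix (Fin n) (Fin d) ℝ} (hA : ∀ i j, |A i j| ≤ η) :
    ‖A‖ ^ 2 ≤ n * d * η ^ 2 := by
  rw [norm_sq_eq_sum]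
  have h1 : ∀ i j, A i j ^ 2 ≤ η ^ 2 := fun i j => by
    rw [← sq_abs]
    exact pow_le_pow_left₀ (abs_nonneg _) (hA i j) 2
  refine (Finset.sum_le_sum fun i _ => Finset.sum_le_sum fun j _ => h1 i j).trans (le_of_eq ?_)
  simp [mul_assoc]

lemma le_mul_of_sq_le_mul_sq {x c y : ℝ} (hc : 1 ≤ c) (hy : 0 ≤ y) (h : x ^ 2 ≤ c * y ^ 2) :
    x ≤ c * y := by
  refine le_of_abs_le (abs_le_of_sq_le_sq (h.trans ?_) (by positivity))
  rw [mul_pow]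
  exact mul_le_mul_of_nonneg_right (by nlinarith) (sq_nonneg y)

/-- The guarantee above the threshold on `n`, where the noise is present. -/
theorem exists_event_of_large (hk : 1 ≤ k) (hkd : k ≤ d) (ht : 2 * t' < n) (hη : 0 < η)
    (hα : 0 < α) (hα1 : α ≤ 1) (hβ : 0 < β) (hβ1 : β < 1) (hε : 0 < ε) (hδ : 0 < δ) (hδ1 : δ < 1)
    (hcs : 36864 ≤ cs) (hcm : 819200 * 576 ^ 2 ≤ cm) (hs1 : 1 ≤ s) (hsm : 8 * s * k ≤ m)
    (hs0 : cs * (Real.log (2 * k / β) / α) ≤ s)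
    (hs : (s : ℝ) ≤ 2 * (cs * (Real.log (2 * k / β) / α)))
    (hm0 : cm * (k * Real.log (2 * k / β) / α ^ 2) ≤ m)
    (hm : (m : ℝ) ≤ 2 * (cm * (k * Real.log (2 * k / β) / α ^ 2)))
    (hv : failureTerm n m s t' < δ / d → (v : ℝ) = noiseVariance n d m s t' η ε δ)
    (hn : 8 * m * Real.log (2 * d * m / δ) + s + t' ≤ (n : ℝ)) (A : Matrix (Fin n) (Fin d) ℝ)
    {Ak : Matrix (Fin m) (Fin d) ℝ → Matrix (Fin d) (Fin k) ℝ} (hAk : IsLowRankSolver Ak) :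
    ∃ E : Set (SketchSample m n s × (Fin n → Fin s × Fin d → ℝ)), MeasurableSet E ∧
      ENNReal.ofReal (1 - β) ≤ runLaw m s t' δ (gaussianReal 0 v) A E ∧
      ∀ ω ∈ E, lowRankError A (runOutput Ak ω) ≤ (1 + α) * lowRankOpt k A +
        (3 + 36 * (331776 * cs ^ 3 * cm * (4 * cs + 6))) * additiveError k d η α β ε δ := by
  have hk' : (1 : ℝ) ≤ k := by exact_mod_cast hk
  have hd1 : 1 ≤ d := hk.trans hkd
  have hsm' : s ≤ m := by nlinarith
  have hcs0 : 0 < cs := by linarith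
  have hcm0 : 0 < cm := by linarith
  obtain ⟨hdense, hfail, hV0, hV⟩ := noise_bound_of_large hk hkd ht hη hα hα1 hβ hβ1 hε hδ hδ1
    hcs0 hcm0 hs1 hsm' hs hm hn
  rw [← hv hfail] at hV0 hV
  have hv0 : v ≠ 0 := by
    rintro rfl
    simp at hV0
  have hL := half_le_log_two_mul_div hk' hβ hβ1
  have hT := additiveError_pos hk hkd hη hα hβ hβ1 hε hδ hδ1
  set T := additiveError k d η α β ε δ
  obtain ⟨Y, hY, hYlt⟩ := hAk.exists_lt_lowRankOpt_add A hT
  set o := lowRankError A Y with ho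
  have ho0 : 0 ≤ o := norm_nonneg _
  set ρ := Real.sqrt ((o ^ 2 + T ^ 2) / k) with hρdef
  have hρ : 0 < ρ := Real.sqrt_pos.2 (by positivity)
  have hρ2 : k * ρ ^ 2 = o ^ 2 + T ^ 2 := by
    rw [hρdef, Real.sq_sqrt (by positivity)]
    field_simp
  have hbad := sketchLaw_bad_le (m := m) (s := s) A Y hρ (by
      rw [← norm_sq_eq_trace, hρ2]
      have : ‖A - A * Y * Yᵀ‖ = o := rfl
      rw [this]
      linarith [sq_nonneg T]) hk hs1 hsm hβ hβ1 (θ := 576 * Real.log (2 * k / β) / α)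
    (γ := α / 96) (by positivity) (by positivity)
    (by
      refine le_trans ?_ hs0
      rw [mul_div_assoc, ← mul_assoc]
      exact mul_le_mul_of_nonneg_right (by linarith) (by positivity))
    (by field_simp; norm_num)
    (by
      have h1 := mul_le_mul_of_nonneg_left hm0 (by linarith : 0 ≤ Real.log (2 * k / β))
      refine le_trans ?_ h1
      have e1 : 819200 * (576 * Real.log (2 * k / β) / α) ^ 2 * k
          = 819200 * 576 ^ 2 * (Real.log (2 * k / β) * (k * Real.log (2 * k / β) / α ^ 2)) := by
        field_simp
      have e2 : Real.log (2 * k / β) * (cm * (k * Real.log (2 * k / β) / α ^ 2))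
          = cm * (Real.log (2 * k / β) * (k * Real.log (2 * k / β) / α ^ 2)) := by ring
      rw [e1, e2]
      exact mul_le_mul_of_nonneg_right hcm (by positivity))
  have hexp : Real.exp (-(s * d)) ≤ β / 2 := by
    have h1 : Real.log (2 * k / β) ≤ s * d := by
      have h2 : Real.log (2 * k / β) ≤ cs * (Real.log (2 * k / β) / α) := by
        rw [mul_div_assoc', le_div_iff₀ hα]
        nlinarith
      have h3 : (s : ℝ) ≤ s * d :=
        le_mul_of_one_le_right (Nat.cast_nonneg s) (by exact_mod_cast hd1)
      linarith
    calc Real.exp (-(s * d)) ≤ Real.exp (-Real.log (2 * k / β)) :=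
          Real.exp_le_exp.2 (by linarith)
      _ = β / (2 * k) := by
          rw [Real.exp_neg, Real.exp_log (by positivity), inv_div]
      _ ≤ β / 2 := by
          refine div_le_div_of_nonneg_left hβ.le (by norm_num) (by linarith)
  obtain ⟨hE, hE'⟩ := runLaw_good_ge (t' := t') (by omega) hs1 hsm' hβ A hv0 hdense
    (G := {ω | ∀ u, |sketchMatrix ω *ᵥ (A *ᵥ u) ⬝ᵥ sketchMatrix ω *ᵥ (A *ᵥ u)
      - A *ᵥ u ⬝ᵥ A *ᵥ u| ≤ α / 96 * (A *ᵥ u ⬝ᵥ A *ᵥ u + ρ ^ 2 * (u ⬝ᵥ u))}) hbad hexp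
  refine ⟨_, hE, hE', ?_⟩
  rintro ω ⟨hω1, hω2⟩
  obtain ⟨hX, hXmin⟩ := hAk (linearTransform (sketchPart ω.1) ω.2)
  have hN : ‖linearTransform (sketchPart ω.1) ω.2 - sketchMatrix ω.1 * A‖ ≤
      331776 * cs ^ 3 * cm * (4 * cs + 6) * T := by
    refine le_mul_of_sq_le_mul_sq ?_ hT.le (hω2.le.trans hV)
    have h1 : 1 ≤ cs ^ 3 := one_le_pow₀ (by linarith)
    have h2 : 1 ≤ 331776 * cs ^ 3 := by linarith
    have h3 : 1 ≤ 331776 * cs ^ 3 * cm := one_le_mul_of_one_le_of_one_le h2 (by linarith)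
    exact one_le_mul_of_one_le_of_one_le h3 (by linarith)
  have hfinal := lowRankError_le_of_sketch hX hY hα hα1 hT.le hω1 hρ2 (N := linearTransform
    (sketchPart ω.1) ω.2 - sketchMatrix ω.1 * A) (by
      rw [add_sub_cancel]
      exact hXmin Y hY)
  have h1 : (1 + α) * o ≤ (1 + α) * (lowRankOpt k A + T) :=
    mul_le_mul_of_nonneg_left hYlt.le (by linarith)
  have h2 : α * T ≤ 1 * T := mul_le_mul_of_nonneg_right hα1 hT.le
  have e : runOutput Ak ω = Ak (linearTransform (sketchPart ω.1) ω.2) := rfl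
  rw [e]
  linarith

end Assembly

end LTM

theorem mainTheorem1 :
    ∃ cs cm C : ℝ, 0 < cs ∧ cs ≤ cm ∧ 0 < C ∧
      ∀ (n d k t' m s : ℕ) (η α β ε δ : ℝ) (v : NNReal) (A : Matrix (Fin n) (Fin d) ℝ)
        (Ak : Matrix (Fin m) (Fin d) ℝ → Matrix (Fin d) (Fin k) ℝ),
        1 ≤ k → k ≤ d → 2 * t' < n →
        0 < α → α ≤ 1 → 0 < β → β < 1 → 0 < ε → 0 < δ → δ < 1 →
        m = LTM.sketchRows cm k α β →
        s = LTM.sketchSparsity cs k α β →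
        -- the noise variance; unrestricted if the formula is meaningless
        (LTM.failureTerm n m s t' < δ / d → (v : ℝ) = LTM.noiseVariance n d m s t' η ε δ) →
        (ε ≤ 1 ∨ 8 * m * Real.log (2 * d * m / δ) + s + t' ≤ (n : ℝ)) →
        (∀ i j, |A i j| ≤ η) →
        LTM.IsLowRankSolver Ak →
        ∃ E : Set (LTM.SketchSample m n s × (Fin n → Fin s × Fin d → ℝ)),
          MeasurableSet E ∧
          ENNReal.ofReal (1 - β) ≤
            LTM.runLaw m s t' δ (ProbabilityTheory.gaussianReal 0 v) A E ∧
          ∀ ω ∈ E,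
            LTM.IsOrthoProj (LTM.runOutput Ak ω) ∧
            LTM.lowRankError A (LTM.runOutput Ak ω) ≤
              (1 + C * α) * LTM.lowRankOpt k A + C * LTM.additiveError k d η α β ε δ := by
  -- The sketch is to be accurate to `γ = α / 96` on quadratic forms. The Chernoff parameter
  -- `θ = 576 L / α`, `L = log (2 k / β)`, has `θ γ = 6 L`, and the matrix Bernstein bound needs
  -- `64 θ ≤ s` and `819200 θ² k ≤ L m`.
  obtain ⟨cs, hcs⟩ : ∃ cs : ℝ, cs = 36864 := ⟨_, rfl⟩
  obtain ⟨cm, hcm⟩ : ∃ cm : ℝ, cm = 819200 * 576 ^ 2 := ⟨_, rfl⟩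
  have hcs0 : 0 < cs := by rw [hcs]; norm_num
  have hcm0 : 0 < cm := by rw [hcm]; norm_num
  have hcsm : 16 * cs ≤ cm := by rw [hcs, hcm]; norm_num
  obtain ⟨C₁, hC₁⟩ : ∃ C₁ : ℝ, C₁ = 3584 * cm ^ 2 := ⟨_, rfl⟩
  obtain ⟨C₂, hC₂⟩ : ∃ C₂ : ℝ, C₂ = 3 + 36 * (331776 * cs ^ 3 * cm * (4 * cs + 6)) := ⟨_, rfl⟩
  have hC₁1 : 1 ≤ C₁ := by rw [hC₁, hcm]; norm_num
  have hC₂0 : 1 ≤ C₂ := by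
    have : 0 ≤ 36 * (331776 * cs ^ 3 * cm * (4 * cs + 6)) := by positivity
    linarith
  refine ⟨cs, cm, C₁ + C₂, hcs0, by linarith, by linarith, ?_⟩
  intro n d k t' m s η α β ε δ v A Ak hk hkd ht hα hα1 hβ hβ1 hε hδ hδ1 hm hs hv hreg hA hAk
  have hk' : (1 : ℝ) ≤ k := by exact_mod_cast hk
  have hL := LTM.half_le_log_two_mul_div hk' hβ hβ1
  set L := Real.log (2 * k / β) with hLdef
  have hα2 : α ^ 2 ≤ 1 := pow_le_one₀ hα.le hα1
  have hLα : 1 / 2 ≤ L / α := by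
    rw [le_div_iff₀ hα]
    linarith
  have hkLα : L / α ≤ k * L / α ^ 2 := by
    rw [div_le_div_iff₀ hα (by positivity)]
    have h1 : L * α ^ 2 ≤ L * α * 1 := by
      rw [sq, ← mul_assoc]
      exact mul_le_mul_of_nonneg_left hα1 (by positivity)
    have h2 : L * α * 1 ≤ L * α * k := mul_le_mul_of_nonneg_left hk' (by positivity)
    linarith
  have hx1 : 1 ≤ cs * (L / α) := by rw [hcs]; linarith
  have hx2 : 1 ≤ cm * (k * L / α ^ 2) := by
    have := mul_le_mul_of_nonneg_left (hLα.trans hkLα) hcm0.le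
    rw [hcm] at this ⊢
    linarith
  have hs0 : cs * (L / α) ≤ s := by
    rw [hs]
    exact Nat.le_ceil _
  have hs2 : (s : ℝ) ≤ 2 * (cs * (L / α)) := by
    rw [hs]
    exact LTM.ceil_le_two_mul hx1
  have hm0 : cm * (k * L / α ^ 2) ≤ m := by
    rw [hm]
    exact Nat.le_ceil _
  have hm2 : (m : ℝ) ≤ 2 * (cm * (k * L / α ^ 2)) := by
    rw [hm]
    exact LTM.ceil_le_two_mul hx2
  have hs1 : 1 ≤ s := by
    have : (1 : ℝ) ≤ s := hx1.trans hs0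
    exact_mod_cast this
  have hsm : 8 * s * k ≤ m := by
    have h1 : (8 * s * k : ℝ) ≤ m := by
      have h2 : (s : ℝ) * k ≤ 2 * (cs * (L / α)) * k :=
        mul_le_mul_of_nonneg_right hs2 (by positivity)
      have h3 : k * L / α ≤ k * L / α ^ 2 := by
        refine div_le_div_of_nonneg_left (by positivity) (by positivity) ?_
        nlinarith
      have h4 : 16 * cs * (k * L / α) ≤ cm * (k * L / α ^ 2) :=
        mul_le_mul hcsm h3 (by positivity) hcm0.le
      have h5 : 2 * (cs * (L / α)) * k = 2 * cs * (k * L / α) := by ring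
      rw [h5] at h2
      linarith
    exact_mod_cast h1
  have hsm1 : s ≤ m := by nlinarith
  have hOpt : 0 ≤ LTM.lowRankOpt k A := LTM.lowRankOpt_nonneg A
  have hη0 : 0 ≤ η := (abs_nonneg _).trans (hA ⟨0, by omega⟩ ⟨0, by omega⟩)
  have hadd : 0 ≤ LTM.additiveError k d η α β ε δ := by
    rcases hη0.eq_or_lt with h | h
    · simp [LTM.additiveError, ← h]
    · exact (LTM.additiveError_pos hk hkd h hα hβ hβ1 hε hδ hδ1).le
  -- outputs that are good for a trivial reason
  have htriv : ‖A‖ ≤ (C₁ + C₂) * LTM.additiveError k d η α β ε δ →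
      ∃ E : Set (LTM.SketchSample m n s × (Fin n → Fin s × Fin d → ℝ)), MeasurableSet E ∧
        ENNReal.ofReal (1 - β) ≤
          LTM.runLaw m s t' δ (ProbabilityTheory.gaussianReal 0 v) A E ∧
        ∀ ω ∈ E, LTM.IsOrthoProj (LTM.runOutput Ak ω) ∧
          LTM.lowRankError A (LTM.runOutput Ak ω) ≤ (1 + (C₁ + C₂) * α) * LTM.lowRankOpt k A
            + (C₁ + C₂) * LTM.additiveError k d η α β ε δ := by
    intro h
    refine ⟨Set.univ, MeasurableSet.univ, ?_, fun ω _ => ⟨(hAk _).1, ?_⟩⟩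
    · rw [LTM.runLaw_univ hsm1, ← ENNReal.ofReal_one]
      exact ENNReal.ofReal_le_ofReal (by linarith)
    · have h1 := LTM.lowRankError_le_norm A (hAk (LTM.linearTransform (LTM.sketchPart ω.1) ω.2)).1
      have h2 : 0 ≤ (1 + (C₁ + C₂) * α) * LTM.lowRankOpt k A := by positivity
      exact (h1.trans h).trans (by linarith)
  have hnorm := LTM.norm_sq_le_of_abs_le hA
  rcases hη0.eq_or_lt with hη | hη
  · refine htriv (le_trans (le_of_eq ?_) (mul_nonneg (by linarith) hadd))
    rw [← hη, zero_pow two_ne_zero, mul_zero] at hnorm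
    exact pow_eq_zero_iff two_ne_zero |>.1 (le_antisymm hnorm (sq_nonneg _))
  rcases lt_or_ge (n : ℝ) (8 * m * Real.log (2 * d * m / δ) + s + t') with hn | hn
  · refine htriv ?_
    have hε1 : ε ≤ 1 := hreg.resolve_right (not_le.2 hn)
    have h1 := LTM.sq_norm_bound_of_small (η := η) hk hkd ht hα hα1 hβ hβ1 hε hε1 hδ hδ1 hcm0
      (hs1.trans hsm1) hsm1 hm2 hn
    rw [← hC₁] at h1
    refine (LTM.le_mul_of_sq_le_mul_sq hC₁1 hadd (hnorm.trans h1)).trans ?_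
    exact mul_le_mul_of_nonneg_right (by linarith) hadd
  · obtain ⟨E, hE, hE', hE''⟩ := LTM.exists_event_of_large hk hkd ht hη hα hα1 hβ hβ1 hε hδ hδ1
      hcs.ge hcm.ge hs1 hsm hs0 hs2 hm0 hm2 hv hn A hAk
    refine ⟨E, hE, hE', fun ω hω => ⟨(hAk _).1, (hE'' ω hω).trans ?_⟩⟩
    rw [← hC₂]
    have h1 : (1 + α) * LTM.lowRankOpt k A ≤ (1 + (C₁ + C₂) * α) * LTM.lowRankOpt k A :=
      mul_le_mul_of_nonneg_right (by nlinarith) hOpt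
    have h2 : C₂ * LTM.additiveError k d η α β ε δ ≤
        (C₁ + C₂) * LTM.additiveError k d η α β ε δ :=
      mul_le_mul_of_nonneg_right (by linarith) hadd
    linarith
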